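/- **Setting.** Let $f(\mathbf x)=\mathbb E_{\xi\sim\mathcal D}[F(\mathbf x;\xi)]$ on $\mathbb R^d$, $d\ge 1$, where every $F(\cdot;\xi)$ is $L_1$-smooth ($\nabla F(\cdot;\xi)$ is $L_1$-Lipschitz) and $L_2$-Hessian Lipschitz ($\nabla^2F(\cdot;\xi)$ is $L_2$-Lipschitz in spectral norm), and the third-derivative tensor of $f$ is $L_3$-Lipschitz in Frobenius norm ($L_1,L_3>0$, $L_2\ge 0$). Let $\epsilon_H,\delta\in(0,1)$. **Algorithm NCD3-Stochastic.** At $\mathbf x$, run a negative curvature search ApproxNC-Stochastic, which returns a vector $\hat{\mathbf v}$ or $\bot$. If $\hat{\mathbf v}\ne\bot$, draw a Rademacher sign $\zeta$ and return $\hat{\mathbf y}=\mathbf x+\zeta\eta\hat{\mathbf v}$ with $\eta=\sqrt{3\epsilon_H/L_3}$; otherwise return $\bot$. ApproxNC-Stochastic consists of independent trials and returns the first candidate that a trial accepts, or $\bot$ if there is none. It is one of the following, with parameters (step size $\alpha$, numbers of steps $T$, of trials and of test samples $m$, and for Neon2 also $\sigma,r,\rho$) that depend only on $d,L_1,L_2,\epsilon_H,\delta$.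 * *Online Oja.* A trial draws $\mathbf w_0$ Gaussian, iterates $\mathbf w_{t+1}=\mathbf w_t-\alpha\nabla^2F(\mathbf x;\xi_t)\mathbf w_t$ with fresh samples $\xi_t\sim\mathcal D$, takes $\mathbf v=\mathbf w_s/\|\mathbf w_s\|_2$ with $s$ uniform in $\{0,\dots,T-1\}$, and accepts $\mathbf v$ if $\frac1m\sum_{i=1}^m\mathbf v^\top\nabla^2F(\mathbf x;\xi_i')\mathbf v\le-\frac34\epsilon_H$ for fresh samples $\xi_i'$. * *Neon2$^{\rm online}$.* A trial starts at $\mathbf x_1$ uniform on the sphere of radius $\sigma$ around $\mathbf x$ and iterates $\mathbf x_{t+1}=\mathbf x_t-\alpha(\nabla F(\mathbf x_t;\xi_t)-\nabla F(\mathbf x;\xi_t))$ for at most $T$ steps. When first $\|\mathbf x_{t+1}-\mathbf x\|_2\ge r$, it takes $\mathbf v=(\mathbf x_s-\mathbf x)/\|\mathbf x_s-\mathbf x\|_2$ with $s$ uniform in $\{1,\dots,t\}$, and accepts $\mathbf v$ if, with $\mathbf v'=\rho\mathbf v$ and fresh samples $\xi'_i$, $\frac1{m\|\mathbf v'\|_2^2}\sum_{i=1}^m\mathbf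 v'^\top(\nabla F(\mathbf x+\mathbf v';\xi_i')-\nabla F(\mathbf x;\xi_i'))\le-\frac34\epsilon_H$. **Lemma 4.6.** There are absolute constants $C,k$ such that, for each of the two methods and all $d,L_1,L_2,\epsilon_H,\delta$ as above, there are parameters of the method, depending only on these five numbers, such that the following holds for all $\mathcal D,F,f,L_3$ as above and every $\mathbf x$ with $\lambda_{\min}(\nabla^2f(\mathbf x))<-\epsilon_H$. 1. With probability at least $1-\delta$ over the randomness of ApproxNC-Stochastic, NCD3-Stochastic returns $\hat{\mathbf y}\neq\bot$ with $$\mathbb E_\zeta[f(\mathbf x)-f(\hat{\mathbf y})]\ge\frac{3\epsilon_H^2}{8L_3}.$$ 2. If $\delta\le\epsilon_H/(3\epsilon_H+8L_2)$, then, over all randomness of the algorithm (and with $\hat{\mathbf y}:=\mathbf x$ if the output is $\bot$), the random variable $f(\hat{\mathbf y})-f(\mathbf x)$ is integrable and $$\mathbb E[f(\hat{\mathbf y})-f(\mathbf x)]\le-\frac{\epsilon_H^2}{8L_3}.$$ 3. Every run makes at most $C\,\frac{L_1^2}{\epsilon_H^2}\,(1+\log(d/\delta))^k$ oracle calls, that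 is, $\widetilde O(L_1^2/\epsilon_H^2)$. These are evaluations of stochastic Hessian-vector products (time $\mathbb T_h$ each) for Oja's algorithm, and of stochastic gradients (time $\mathbb T_g$ each) for Neon2$^{\rm online}$. -/

import Mathlib

open MeasureTheory ProbabilityTheory
open scoped ENNReal

noncomputable section

namespace NCD3

/-! ### Smoothness notions -/

/-- `ℝ^d` with the Euclidean norm. -/
abbrev Vec (d : ℕ) := EuclideanSpace ℝ (Fin d)

/-- The Hessian `∇²f(x)` as an operator; its norm is the spectral norm. -/
def hessian {d : ℕ} (f : Vec d → ℝ) (x : Vec d) : Vec d →L[ℝ] Vec d :=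
  fderiv ℝ (gradient f) x

/-- `L`-smoothness: the gradient is `L`-Lipschitz. -/
def IsSmooth {d : ℕ} (L : ℝ) (f : Vec d → ℝ) : Prop :=
  Differentiable ℝ f ∧ ∀ x y, ‖gradient f x - gradient f y‖ ≤ L * ‖x - y‖

/-- Twice differentiable with `L`-Lipschitz Hessian (in spectral norm). -/
def IsHessianLipschitz {d : ℕ} (L : ℝ) (f : Vec d → ℝ) : Prop :=
  Differentiable ℝ f ∧ Differentiable ℝ (gradient f) ∧
    ∀ x y, ‖hessian f x - hessian f y‖ ≤ L * ‖x - y‖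

/-- The entry `∂³f / ∂x_i ∂x_j ∂x_k` of the third-order derivative tensor. -/
def thirdDeriv {d : ℕ} (f : Vec d → ℝ) (x : Vec d) (i j k : Fin d) : ℝ :=
  iteratedFDeriv ℝ 3 f x
    ![EuclideanSpace.single i 1, EuclideanSpace.single j 1, EuclideanSpace.single k 1]

/-- Three times differentiable with third-order derivative tensor `L`-Lipschitz in Frobenius norm.
(A Lipschitz third derivative is continuous, so asking for `C³` is the same as asking for three
times differentiable.) -/
def HasLipschitzThirdDeriv {d : ℕ} (L : ℝ) (f : Vec d → ℝ) : Prop :=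
  ContDiff ℝ 3 f ∧ ∀ x y,
    Real.sqrt (∑ i, ∑ j, ∑ k, (thirdDeriv f x i j k - thirdDeriv f y i j k) ^ 2) ≤ L * ‖x - y‖

/-- Smallest eigenvalue. For `d = 0` there are no eigenvalues and the value is `0`. -/
def lambdaMin {d : ℕ} (A : Vec d →L[ℝ] Vec d) : ℝ :=
  sInf {μ : ℝ | Module.End.HasEigenvalue (A : Vec d →ₗ[ℝ] Vec d) μ}

/-- The stochastic objective `f(x) = 𝔼_{ξ ∼ D} F(x; ξ)`: every `F(·; ξ)` is `L₁`-smooth and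
`L₂`-Hessian Lipschitz, and `f` has an `L₃`-Lipschitz third derivative. -/
structure IsStochasticObjective {d : ℕ} {Ξ : Type*} [MeasurableSpace Ξ] (D : Measure Ξ)
    (F : Vec d → Ξ → ℝ) (f : Vec d → ℝ) (L₁ L₂ L₃ : ℝ) : Prop where
  measurable : ∀ x, Measurable (F x)
  integrable : ∀ x, Integrable (F x) D
  eq_integral : ∀ x, f x = ∫ ξ, F x ξ ∂D
  smooth : ∀ ξ, IsSmooth L₁ (fun x => F x ξ)
  hessianLipschitz : ∀ ξ, IsHessianLipschitz L₂ (fun x => F x ξ)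
  thirdDerivLipschitz : HasLipschitzThirdDeriv L₃ f

/-! ### Computations that count their oracle calls -/

/-- A result together with the number of oracle calls spent on computing it. -/
structure Counted (α : Type*) where
  val : α
  calls : ℕ

instance : Monad Counted where
  pure a := ⟨a, 0⟩
  bind a f := ⟨(f a.val).val, a.calls + (f a.val).calls⟩

/-- One oracle call with answer `a`. -/
def query {α : Type*} (a : α) : Counted α := ⟨a, 1⟩

/-- The stochastic gradient oracle `(ξ, y) ↦ ∇F(y; ξ)`. -/
def gradOracle {d : ℕ} {Ξ : Type*} (F : Vec d → Ξ → ℝ) (ξ : Ξ) (y : Vec d) : Vec d :=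
  gradient (fun z => F z ξ) y

/-- The stochastic Hessian-vector product oracle `(ξ, y, u) ↦ ∇²F(y; ξ) u`. -/
def hvpOracle {d : ℕ} {Ξ : Type*} (F : Vec d → Ξ → ℝ) (ξ : Ξ) (y u : Vec d) : Vec d :=
  hessian (fun z => F z ξ) y u

/-- Rescaling to a unit vector (the zero vector is left alone). -/
def normalize {d : ℕ} (w : Vec d) : Vec d := ‖w‖⁻¹ • w

/-- Run the trials `0, 1, …, J - 1` in this order, and stop at the first one that succeeds;
`none` stands for `⊥`. -/
def firstSuccess {α : Type*} (trial : ℕ → Counted (Option α)) : ℕ → Counted (Option α)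
  | 0 => pure none
  | J + 1 => do
    match ← firstSuccess trial J with
    | some v => pure (some v)
    | none => trial J

/-! ### Randomness of the negative curvature search -/

/-- Randomness of one trial: a Gaussian vector for the starting point, the samples `ξ` used by the
iteration, a uniform number in `[0,1]` which selects an iterate, and the samples `ξ` used for
testing the candidate direction. -/
abbrev TrialSeed (d : ℕ) (Ξ : Type*) := Vec d × (ℕ → Ξ) × unitInterval × (ℕ → Ξ)

/-- All these random elements are independent, and the samples are i.i.d. from `D`. -/
def trialLaw (d : ℕ) {Ξ : Type*} [MeasurableSpace Ξ] (D : Measure Ξ) : Measure (TrialSeed d Ξ) :=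
  (stdGaussian (Vec d)).prod ((Measure.infinitePi fun _ : ℕ => D).prod
    ((volume : Measure unitInterval).prod (Measure.infinitePi fun _ : ℕ => D)))

instance {d : ℕ} {Ξ : Type*} [MeasurableSpace Ξ] (D : Measure Ξ) [IsProbabilityMeasure D] :
    IsProbabilityMeasure (trialLaw d D) := by
  unfold trialLaw; infer_instance

/-- The trials use independent randomness. -/
def seedLaw (d : ℕ) {Ξ : Type*} [MeasurableSpace Ξ] (D : Measure Ξ) :
    Measure (ℕ → TrialSeed d Ξ) :=
  Measure.infinitePi fun _ : ℕ => trialLaw d D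

instance {d : ℕ} {Ξ : Type*} [MeasurableSpace Ξ] (D : Measure Ξ) [IsProbabilityMeasure D] :
    IsProbabilityMeasure (seedLaw d D) := by
  unfold seedLaw; infer_instance

/-- The law of a random sign. -/
def rademacher : Measure ℝ :=
  (2⁻¹ : ℝ≥0∞) • Measure.dirac 1 + (2⁻¹ : ℝ≥0∞) • Measure.dirac (-1)

instance : IsProbabilityMeasure rademacher := by
  constructor
  simp [rademacher, ENNReal.inv_two_add_inv_two]

/-! ### Online Oja's algorithm -/

/-- Parameters of online Oja's algorithm: step size, number of steps of one trial, number of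
trials, and number of samples for testing a candidate direction. -/
structure OjaParams where
  stepSize : ℝ
  steps : ℕ
  trials : ℕ
  tests : ℕ

/-- Oja's iteration `w_{t+1} = (I - η ∇²F(x; ξ_t)) w_t` for the lowest eigenvector of `∇²f(x)`.
Normalization of `w_t` does not change its direction and is left to the end. `O ξ u` is the oracle
answer `∇²F(x; ξ) u`. -/
def ojaIterate {d : ℕ} {Ξ : Type*} (O : Ξ → Vec d → Vec d) (η : ℝ) (ξ : ℕ → Ξ) (w₀ : Vec d) :
    ℕ → Counted (Vec d)
  | 0 => pure w₀
  | t + 1 => do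
    let w ← ojaIterate O η ξ w₀ t
    let h ← query (O (ξ t) w)
    pure (w - η • h)

/-- `∑_{i < m} ⟨v, ∇²F(x; ξ_i) v⟩`. -/
def hvpFormSum {d : ℕ} {Ξ : Type*} (O : Ξ → Vec d → Vec d) (ξ : ℕ → Ξ) (v : Vec d) :
    ℕ → Counted ℝ
  | 0 => pure 0
  | i + 1 => do
    let s ← hvpFormSum O ξ v i
    let h ← query (O (ξ i) v)
    pure (s + inner ℝ v h)

/-- One trial: the normalized iterate `w_s`, with `s` uniform in `{0, …, T - 1}`, is accepted if the
empirical estimate of `v^⊤ ∇²f(x) v` is at most `-3ε_H/4`. -/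
def ojaTrial {d : ℕ} {Ξ : Type*} (p : OjaParams) (εH : ℝ) (O : Ξ → Vec d → Vec d)
    (seed : TrialSeed d Ξ) : Counted (Option (Vec d)) :=
  let (g, ξ, u, ξ') := seed
  do
    let w ← ojaIterate O p.stepSize ξ g ⌊(u : ℝ) * p.steps⌋₊
    let v := normalize w
    let s ← hvpFormSum O ξ' v p.tests
    if s / p.tests ≤ -(3 * εH / 4) then pure (some v) else pure none

/-- ApproxNC-Stochastic by online Oja's algorithm at the point `x`, with access to `F` through
stochastic Hessian-vector products only. -/
def approxNCOja {d : ℕ} {Ξ : Type*} (p : OjaParams) (εH : ℝ) (F : Vec d → Ξ → ℝ) (x : Vec d)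
    (ω : ℕ → TrialSeed d Ξ) : Counted (Option (Vec d)) :=
  firstSuccess (fun j => ojaTrial p εH (fun ξ u => hvpOracle F ξ x u) (ω j)) p.trials

/-! ### Neon2^online -/

/-- Parameters of Neon2^online: step size, maximal number of steps of one trial, norm of the initial
perturbation, exit radius, number of trials, and number of samples and finite-difference length for
testing a candidate direction. -/
structure NeonParams where
  stepSize : ℝ
  steps : ℕ
  perturbation : ℝ
  exitRadius : ℝ
  trials : ℕ
  tests : ℕ
  testLength : ℝ

/-- State of the perturbed stochastic gradient iteration: the current iterate, the earlier iterates
(latest first), and whether the current iterate has left the ball of radius `r` around `x`. -/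
structure NeonState (d : ℕ) where
  current : Vec d
  past : List (Vec d)
  exited : Bool

/-- One step `y ← y - η (∇F(y; ξ) - ∇F(x; ξ))`; nothing happens after the exit. -/
def neonStep {d : ℕ} {Ξ : Type*} (G : Ξ → Vec d → Vec d) (x : Vec d) (η r : ℝ) (ξ : Ξ)
    (S : NeonState d) : Counted (NeonState d) :=
  open scoped Classical in
  if S.exited then pure S
  else do
    let a ← query (G ξ S.current)
    let b ← query (G ξ x)
    let y := S.current - η • (a - b)
    pure ⟨y, S.current :: S.past, decide (r ≤ ‖y - x‖)⟩

/-- The state after (at most) `t` steps from the starting point `y₀`. -/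
def neonRun {d : ℕ} {Ξ : Type*} (G : Ξ → Vec d → Vec d) (x : Vec d) (η r : ℝ) (ξ : ℕ → Ξ)
    (y₀ : Vec d) : ℕ → Counted (NeonState d)
  | 0 => pure ⟨y₀, [], false⟩
  | t + 1 => do
    let S ← neonRun G x η r ξ y₀ t
    neonStep G x η r (ξ t) S

/-- Neon2^online_weak: start at distance `σ` from `x` in a random direction; if the iteration exits
the ball, return the direction from `x` to a uniformly random iterate before the exit, otherwise
return `⊥`. -/
def neonWeak {d : ℕ} {Ξ : Type*} (p : NeonParams) (G : Ξ → Vec d → Vec d) (x : Vec d)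
    (g : Vec d) (ξ : ℕ → Ξ) (u : unitInterval) : Counted (Option (Vec d)) := do
  let S ← neonRun G x p.stepSize p.exitRadius ξ (x + p.perturbation • normalize g) p.steps
  if S.exited then
    pure (some (normalize (S.past.getD ⌊(u : ℝ) * S.past.length⌋₊ x - x)))
  else pure none

/-- `∑_{i < m} ⟨v', ∇F(x + v'; ξ_i) - ∇F(x; ξ_i)⟩`. -/
def gradFormSum {d : ℕ} {Ξ : Type*} (G : Ξ → Vec d → Vec d) (x : Vec d) (ξ : ℕ → Ξ)
    (v' : Vec d) : ℕ → Counted ℝ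
  | 0 => pure 0
  | i + 1 => do
    let s ← gradFormSum G x ξ v' i
    let a ← query (G (ξ i) (x + v'))
    let b ← query (G (ξ i) x)
    pure (s + inner ℝ v' (a - b))

/-- One trial: the direction `v` found by Neon2^online_weak, if any, is accepted if the
finite-difference estimate of `v^⊤ ∇²f(x) v`, with `v' = ρ v`, is at most `-3ε_H/4`. -/
def neonTrial {d : ℕ} {Ξ : Type*} (p : NeonParams) (εH : ℝ) (G : Ξ → Vec d → Vec d) (x : Vec d)
    (seed : TrialSeed d Ξ) : Counted (Option (Vec d)) :=
  let (g, ξ, u, ξ') := seed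
  do
    match ← neonWeak p G x g ξ u with
    | none => pure none
    | some v =>
      let v' := p.testLength • v
      let s ← gradFormSum G x ξ' v' p.tests
      if s / (p.tests * ‖v'‖ ^ 2) ≤ -(3 * εH / 4) then pure (some v) else pure none

/-- ApproxNC-Stochastic by Neon2^online at the point `x`, with access to `F` through stochastic
gradients only. -/
def approxNCNeon {d : ℕ} {Ξ : Type*} (p : NeonParams) (εH : ℝ) (F : Vec d → Ξ → ℝ) (x : Vec d)
    (ω : ℕ → TrialSeed d Ξ) : Counted (Option (Vec d)) :=
  firstSuccess (fun j => neonTrial p εH (gradOracle F) x (ω j)) p.trials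

/-! ### Negative curvature descent -/

/-- NCD3-Stochastic: step of size `η = √(3ε_H/L₃)` along the random sign `ζ` times the direction
`v` found by ApproxNC-Stochastic; `⊥` if there is none. -/
def ncd3 {d : ℕ} (L₃ εH : ℝ) (x : Vec d) (approxNC : Counted (Option (Vec d))) (ζ : ℝ) :
    Counted (Option (Vec d)) := do
  match ← approxNC with
  | some v => pure (some (x + (ζ * Real.sqrt (3 * εH / L₃)) • v))
  | none => pure none

/-- NCD3-Stochastic with online Oja's algorithm, as a function of its randomness. -/
def ncd3Oja {d : ℕ} {Ξ : Type*} (p : OjaParams) (L₃ εH : ℝ) (F : Vec d → Ξ → ℝ) (x : Vec d)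
    (ω : ℕ → TrialSeed d Ξ) (ζ : ℝ) : Counted (Option (Vec d)) :=
  ncd3 L₃ εH x (approxNCOja p εH F x ω) ζ

/-- NCD3-Stochastic with Neon2^online, as a function of its randomness. -/
def ncd3Neon {d : ℕ} {Ξ : Type*} (p : NeonParams) (L₃ εH : ℝ) (F : Vec d → Ξ → ℝ) (x : Vec d)
    (ω : ℕ → TrialSeed d Ξ) (ζ : ℝ) : Counted (Option (Vec d)) :=
  ncd3 L₃ εH x (approxNCNeon p εH F x ω) ζ

/-- A run `ζ ↦ run ζ` of the algorithm at `x`, with all randomness but the sign `ζ` fixed, returns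
a point `ŷ` (not `⊥`) with `𝔼_ζ [f(x) - f(ŷ)] ≥ c`. -/
def SignDecrease {d : ℕ} (f : Vec d → ℝ) (x : Vec d) (run : ℝ → Counted (Option (Vec d)))
    (c : ℝ) : Prop :=
  ∃ y : ℝ → Vec d, (∀ ζ, (run ζ).val = some (y ζ)) ∧ c ≤ ∫ ζ, (f x - f (y ζ)) ∂rademacher

end NCD3

end

/-!
Along a unit vector `v` the odd terms of the Taylor expansion of `f` cancel in the average over
the two signs, so a step of length `√(3ε/L₃)` changes `f` on average by at most `(3ε/(2L₃))
vᵀ∇²f(x)v + 3ε²/(8L₃)` (`integral_rademacher_step_le`). A curvature of at most `-ε/2` therefore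
gives the claimed decrease, and it remains to find such a direction with probability `1 - δ`, and
to control the increase in the other cases.

Both methods iterate `w ↦ w - α Γ(ξ, w)`, where `Γ(ξ, ·)` is the stochastic Hessian `A_ξ` for
Oja's algorithm and is close to `A_ξ` on the ball of radius `r` for Neon2 (`IsNearLinear`). Let
`-l < -ε` be the smallest eigenvalue of the mean `H` of `A_ξ`, with eigenvector `u`.

*A trial finds a good candidate with constant probability.* The component of the linear iterate
along `u` is the inner product of the starting point with the transposed random product applied to
`u`. The first and second moments of that vector follow from a recursion, so by Chebyshev's
inequality its norm is at least of order `(1 + αl)^n` (`measure_inner_transposedIter_le`), and a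
Gaussian starting point loses only a factor of order `√d` (`measure_slow_growth_le`). On the other
hand each step increases `log ‖w‖` by at most `-α` times the sampled Rayleigh quotient of the
current direction, up to second-order terms, and the sampled quotients differ from the exact ones
by a martingale (`sum_form_le`, `measure_noiseSum_ge`). Fast growth hence forces the average of
the exact Rayleigh quotients along the path to be close to `-l`. None of them is below `-l`, so by
Markov's inequality most iterates are good, and one of them is chosen uniformly
(`volume_bad_index_le`). For Neon2 the same argument runs up to the exit time from the ball.
Before the exit the nonlinear path stays close to the linear one, whose growth forces the exit
(`exited_of_fast_growth`), and the noise is stopped at the exit (`noiseSum_stoppedDirection`).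

*Tests.* By Hoeffding's inequality a good candidate passes its test, and a candidate of curvature
`c` above `-ε/2` passes with a probability that decays like a Gaussian in `c`. The weight
`badness` is at least `1` on such candidates and is linear in `c`; its expectation is
exponentially small for any law of the candidate (`lintegral_badness_tested_le`). This single
bound yields, by Markov's inequality, the statement with probability `1 - δ`
(`measure_not_signDecrease_le`), and it also bounds the expected increase of `f` along bad
directions (`expected_decrease`), for which `δ ≤ 1/3` suffices.

*Parameters.* With `ell = 1 + log (d/δ)`, there are `O(ell)` trials with `O(ell² L₁²/ε²)` steps
and `O(ell L₁²/ε²)` tests each (`total_calls_le`). The radius of Neon2 is so small that the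
deviation of the gradient oracle from a linear one is negligible over the whole run; it costs no
oracle calls.
-/

open MeasureTheory ProbabilityTheory
open scoped ENNReal

noncomputable section

namespace NCD3

/-! ### Fourth-order decrease along a random sign -/

section Taylor

variable {d : ℕ}

lemma nonpos_of_deriv_nonpos {g g' : ℝ → ℝ} (hg : ∀ t, HasDerivAt g (g' t) t) (h0 : g 0 ≤ 0)
    (h : ∀ t, 0 ≤ t → g' t ≤ 0) (t : ℝ) (ht : 0 ≤ t) : g t ≤ 0 := by
  have hanti : AntitoneOn g (Set.Ici 0) := by
    refine antitoneOn_of_deriv_nonpos (convex_Ici 0)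
      (fun t _ => (hg t).continuousAt.continuousWithinAt)
      (fun t _ => (hg t).differentiableAt.differentiableWithinAt) ?_
    intro t ht
    rw [interior_Ici] at ht
    rw [(hg t).deriv]
    exact h t (le_of_lt ht)
  exact (hanti (Set.mem_Ici.2 le_rfl) ht ht).trans h0

lemma hasDerivAt_iteratedFDeriv_line {f : Vec d → ℝ} {n : ℕ} (hf : ContDiff ℝ (n + 1) f)
    (x v : Vec d) (t : ℝ) :
    HasDerivAt (fun t : ℝ => iteratedFDeriv ℝ n f (x + t • v) (fun _ => v))
      (iteratedFDeriv ℝ (n + 1) f (x + t • v) (fun _ => v)) t := by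
  have h1 : Differentiable ℝ (iteratedFDeriv ℝ n f) :=
    hf.differentiable_iteratedFDeriv (by exact_mod_cast Nat.lt_succ_self n)
  have h2 : HasDerivAt (fun t : ℝ => x + t • v) v t := by
    simpa using ((hasDerivAt_id t).smul_const v).const_add x
  have h3 := ((h1 (x + t • v)).hasFDerivAt.comp_hasDerivAt t h2)
  have h4 := (ContinuousMultilinearMap.apply ℝ (fun _ : Fin n => Vec d) ℝ
    (fun _ => v)).hasFDerivAt.comp_hasDerivAt t h3
  rw [iteratedFDeriv_succ_apply_left]
  exact h4

/-- A third-order tensor is bounded on unit vectors by its Frobenius norm. -/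
lemma abs_cubicForm_le (M : Vec d [×3]→L[ℝ] ℝ) (v : Vec d) (hv : ‖v‖ = 1) :
    |M (fun _ => v)| ≤ Real.sqrt (∑ i, ∑ j, ∑ k, (M ![EuclideanSpace.single i 1,
      EuclideanSpace.single j 1, EuclideanSpace.single k 1]) ^ 2) := by
  have hexp : v = ∑ i, v i • (EuclideanSpace.single i (1 : ℝ) : Vec d) := by
    have := (EuclideanSpace.basisFun (Fin d) ℝ).sum_repr v
    simpa using this.symm
  have hM : M (fun _ => v) = ∑ r : Fin 3 → Fin d, (∏ i, v (r i)) *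
      M (fun i => EuclideanSpace.single (r i) 1) := by
    conv_lhs => rw [hexp]
    rw [ContinuousMultilinearMap.map_sum]
    refine Finset.sum_congr rfl fun r _ => ?_
    rw [ContinuousMultilinearMap.map_smul_univ, smul_eq_mul]
  have hv2 : ∑ r : Fin 3 → Fin d, (∏ i, v (r i)) ^ 2 = 1 := by
    have h1 : ∑ j, (v j) ^ 2 = 1 := by
      have := EuclideanSpace.real_norm_sq_eq v
      rw [hv] at this; simpa using this.symm
    have h2 := Finset.prod_univ_sum (fun _ : Fin 3 => (Finset.univ : Finset (Fin d)))
      (fun _ j => (v j) ^ 2)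
    simp only [h1, Finset.prod_const_one, Fintype.piFinset_univ] at h2
    rw [h2]
    exact Finset.sum_congr rfl fun r _ => by rw [Finset.prod_pow]
  let e : Fin d × Fin d × Fin d ≃ (Fin 3 → Fin d) :=
    { toFun := fun p => ![p.1, p.2.1, p.2.2]
      invFun := fun r => (r 0, r 1, r 2)
      left_inv := fun p => rfl
      right_inv := fun r => by ext i; fin_cases i <;> rfl }
  have hT : ∑ r : Fin 3 → Fin d, (M (fun i => EuclideanSpace.single (r i) 1)) ^ 2 =
      ∑ i, ∑ j, ∑ k, (M ![EuclideanSpace.single i 1,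
      EuclideanSpace.single j 1, EuclideanSpace.single k 1]) ^ 2 := by
    rw [← e.sum_comp, Fintype.sum_prod_type]
    refine Finset.sum_congr rfl fun i _ => ?_
    rw [Fintype.sum_prod_type]
    refine Finset.sum_congr rfl fun j _ => Finset.sum_congr rfl fun k _ => ?_
    congr 2
    ext l; fin_cases l <;> rfl
  rw [← hT]
  apply Real.abs_le_sqrt
  rw [hM]
  refine (Finset.sum_mul_sq_le_sq_mul_sq _ _ _).trans ?_
  rw [hv2, one_mul]

lemma hasGradientAt_toDual {f : Vec d → ℝ} (hf : Differentiable ℝ f) (y : Vec d) :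
    HasFDerivAt f (InnerProductSpace.toDual ℝ (Vec d) (gradient f y)) y :=
  (hf y).hasGradientAt.hasFDerivAt

/-- The inner product as a continuous bilinear form over `ℝ`. (`InnerProductSpace.toDual` is
semilinear, hence of the wrong type for a derivative.) -/
def innerBilin (d : ℕ) : Vec d →L[ℝ] Vec d →L[ℝ] ℝ :=
  LinearMap.mkContinuous₂ (innerₗ (Vec d)) 1 fun v w => by
    simpa using abs_real_inner_le_norm v w

@[simp] lemma innerBilin_apply (v w : Vec d) : innerBilin d v w = inner ℝ v w := rfl

lemma hasFDerivAt_toDual_gradient {f : Vec d → ℝ} (hg : Differentiable ℝ (gradient f))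
    (x : Vec d) :
    HasFDerivAt (fun y => InnerProductSpace.toDual ℝ (Vec d) (gradient f y))
      ((innerBilin d).comp (hessian f x)) x :=
  (innerBilin d).hasFDerivAt.comp x (hg x).hasFDerivAt

lemma inner_hessian_comm {f : Vec d → ℝ} (hf : Differentiable ℝ f)
    (hg : Differentiable ℝ (gradient f)) (x v w : Vec d) :
    inner ℝ (hessian f x v) w = inner ℝ v (hessian f x w) := by
  have := second_derivative_symmetric (hasGradientAt_toDual hf)
    (hasFDerivAt_toDual_gradient hg x) v w
  simp at this
  rw [this, real_inner_comm]

lemma differentiable_gradient {f : Vec d → ℝ} (hf : ContDiff ℝ 2 f) :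
    Differentiable ℝ (gradient f) := by
  have h : Differentiable ℝ (fderiv ℝ f) :=
    (hf.fderiv_right (m := 1) (by norm_num)).differentiable (by norm_num)
  exact ((InnerProductSpace.toDual ℝ (Vec d)).symm.toContinuousLinearEquiv.differentiable).comp h

lemma iteratedFDeriv_two_eq_hessian {f : Vec d → ℝ} (hf : ContDiff ℝ 2 f) (x v : Vec d) :
    iteratedFDeriv ℝ 2 f x (fun _ => v) = inner ℝ v (hessian f x v) := by
  rw [iteratedFDeriv_two_apply]
  have h2 := hasFDerivAt_toDual_gradient (differentiable_gradient hf) x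
  have h3 : (fun y => InnerProductSpace.toDual ℝ (Vec d) (gradient f y)) = fderiv ℝ f :=
    toDual_comp_gradient
  rw [h3] at h2
  rw [h2.fderiv]
  simp [real_inner_comm]

/-- The symmetric second difference of a function with Lipschitz third derivative: the odd terms
cancel, so that the error is of order four. -/
lemma symm_second_difference_le {f : Vec d → ℝ} {L : ℝ} (hf : HasLipschitzThirdDeriv L f)
    (x v : Vec d) (hv : ‖v‖ = 1) (η : ℝ) (hη : 0 ≤ η) :
    f (x + η • v) + f (x - η • v) - 2 * f x ≤
      η ^ 2 * inner ℝ v (hessian f x v) + L * η ^ 4 / 12 := by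
  obtain ⟨hC, hL⟩ := hf
  set φ : ℕ → ℝ → ℝ := fun n t => iteratedFDeriv ℝ n f (x + t • v) (fun _ => v) with hφ
  have hd : ∀ n, n ≤ 2 → ∀ t, HasDerivAt (φ n) (φ (n + 1) t) t := fun n hn t =>
    hasDerivAt_iteratedFDeriv_line (hC.of_le (by
      have : n + 1 ≤ 3 := by omega
      exact_mod_cast this)) x v t
  have hdn : ∀ n, n ≤ 2 → ∀ t, HasDerivAt (fun t => φ n (-t)) (- φ (n + 1) (-t)) t :=
      fun n hn t => by
    simpa [Function.comp_def] using (hd n hn (-t)).scomp t (hasDerivAt_neg t)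
  have h3 : ∀ t, 0 ≤ t → φ 3 t - φ 3 (-t) ≤ 2 * L * t := by
    intro t ht
    have h := abs_cubicForm_le (iteratedFDeriv ℝ 3 f (x + t • v) -
      iteratedFDeriv ℝ 3 f (x + (-t) • v)) v hv
    have h' := hL (x + t • v) (x + (-t) • v)
    simp only [thirdDeriv] at h'
    have h'' : ‖x + t • v - (x + (-t) • v)‖ = 2 * t := by
      have : x + t • v - (x + (-t) • v) = (2 * t) • v := by module
      rw [this, norm_smul, hv, mul_one, Real.norm_of_nonneg (by linarith)]
    rw [h''] at h'
    have := (le_abs_self _).trans (h.trans h')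
    simp only [_root_.sub_apply] at this
    simp only [hφ]
    linarith
  have hpow : ∀ (n : ℕ) (t : ℝ), HasDerivAt (fun t : ℝ => t ^ (n + 1)) ((n + 1 : ℝ) * t ^ n) t :=
    fun n t => by simpa using hasDerivAt_pow (n + 1) t
  have e2 : ∀ t, 0 ≤ t → φ 2 t + φ 2 (-t) - 2 * φ 2 0 - L * t ^ 2 ≤ 0 := by
    refine nonpos_of_deriv_nonpos (g' := fun t => φ 3 t + -φ 3 (-t) - L * ((1 + 1 : ℝ) * t ^ 1))
      (fun t => ?_) (by simp; linarith) ?_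
    · exact (((hd 2 le_rfl t).add (hdn 2 le_rfl t)).sub_const _).sub
        (by simpa using (hpow 1 t).const_mul L)
    · intro t ht
      have := h3 t ht
      simp only [pow_one]
      linarith
  have e1 : ∀ t, 0 ≤ t → φ 1 t - φ 1 (-t) - 2 * φ 2 0 * t - L / 3 * t ^ 3 ≤ 0 := by
    refine nonpos_of_deriv_nonpos
      (g' := fun t => φ 2 t - -φ 2 (-t) - 2 * φ 2 0 - L / 3 * ((2 + 1 : ℝ) * t ^ 2))
      (fun t => ?_) (by simp) ?_
    · exact (((hd 1 (by norm_num) t).sub (hdn 1 (by norm_num) t)).sub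
        (by simpa using (hasDerivAt_id t).const_mul (2 * φ 2 0))).sub
        (by simpa using (hpow 2 t).const_mul (L / 3))
    · intro t ht
      have := e2 t ht
      linarith
  have e0 : ∀ t, 0 ≤ t → φ 0 t + φ 0 (-t) - 2 * φ 0 0 - φ 2 0 * t ^ 2 - L / 12 * t ^ 4 ≤ 0 := by
    refine nonpos_of_deriv_nonpos
      (g' := fun t => φ 1 t + -φ 1 (-t) - φ 2 0 * ((1 + 1 : ℝ) * t ^ 1)
        - L / 12 * ((3 + 1 : ℝ) * t ^ 3))
      (fun t => ?_) (by simp; linarith) ?_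
    · exact ((((hd 0 (by norm_num) t).add (hdn 0 (by norm_num) t)).sub_const _).sub
        (by simpa using (hpow 1 t).const_mul (φ 2 0))).sub
        (by simpa using (hpow 3 t).const_mul (L / 12))
    · intro t ht
      have := e1 t ht
      simp only [pow_one]
      linarith
  have := e0 η hη
  have h20 : φ 2 0 = inner ℝ v (hessian f x v) := by
    have := iteratedFDeriv_two_eq_hessian (hC.of_le (by norm_num)) x v
    simpa [hφ] using this
  rw [h20] at this
  simp only [hφ, iteratedFDeriv_zero_apply, zero_smul, add_zero, neg_smul] at this
  rw [← sub_eq_add_neg] at this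
  linarith

lemma integral_rademacher (g : ℝ → ℝ) : ∫ ζ, g ζ ∂rademacher = (g 1 + g (-1)) / 2 := by
  unfold rademacher
  rw [integral_add_measure, integral_smul_measure, integral_smul_measure, integral_dirac,
    integral_dirac]
  · simp; ring
  · exact (integrable_dirac (by simp)).smul_measure (by simp)
  · exact (integrable_dirac (by simp)).smul_measure (by simp)

/-- The expected change of `f` for a step of length `√(3ε/L)` along a random sign of `v`. A
curvature of at most `-ε/2` along `v` suffices for a decrease by `3ε²/(8L)`. -/
lemma integral_rademacher_step_le {f : Vec d → ℝ} {L ε : ℝ} (hL : 0 < L) (hε : 0 < ε)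
    (hf : HasLipschitzThirdDeriv L f) (x v : Vec d) (hv : ‖v‖ = 1) :
    ∫ ζ, (f (x + (ζ * Real.sqrt (3 * ε / L)) • v) - f x) ∂rademacher ≤
      3 * ε / (2 * L) * inner ℝ v (hessian f x v) + 3 * ε ^ 2 / (8 * L) := by
  rw [integral_rademacher]
  have h := symm_second_difference_le hf x v hv (Real.sqrt (3 * ε / L)) (Real.sqrt_nonneg _)
  have hs : Real.sqrt (3 * ε / L) ^ 2 = 3 * ε / L := Real.sq_sqrt (by positivity)
  have hs4 : L * Real.sqrt (3 * ε / L) ^ 4 / 12 = 2 * (3 * ε ^ 2 / (8 * L)) := by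
    rw [show Real.sqrt (3 * ε / L) ^ 4 = (Real.sqrt (3 * ε / L) ^ 2) ^ 2 by ring, hs]
    field_simp; ring
  rw [hs4, hs] at h
  have e : 3 * ε / L * inner ℝ v (hessian f x v) =
    2 * (3 * ε / (2 * L) * inner ℝ v (hessian f x v)) := by field_simp
  rw [e] at h
  simp only [one_mul, neg_mul, neg_smul, ← sub_eq_add_neg]
  linarith

end Taylor

/-! ### Bottom of the spectrum and first-order expansions -/

section Spectrum

variable {d : ℕ}

/-- The junk value `0` of the infimum for an empty set of eigenvalues is excluded by `-ε < 0`. -/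
lemma exists_bottom_eigenvector {H : Vec d →L[ℝ] Vec d} {ε : ℝ} (hε : 0 < ε)
    (hs : ∀ v w, inner ℝ (H v) w = inner ℝ v (H w)) (h : lambdaMin H < -ε) :
    ∃ (l : ℝ) (u : Vec d), ε < l ∧ ‖u‖ = 1 ∧ H u = (-l) • u ∧
      ∀ v, -l * ‖v‖ ^ 2 ≤ inner ℝ v (H v) := by
  have hsym : (H : Vec d →ₗ[ℝ] Vec d).IsSymmetric := fun v w => hs v w
  unfold lambdaMin at h
  have hne : {μ : ℝ | Module.End.HasEigenvalue (H : Vec d →ₗ[ℝ] Vec d) μ}.Nonempty := by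
    by_contra hcon
    rw [Set.not_nonempty_iff_eq_empty] at hcon
    rw [hcon, Real.sInf_empty] at h
    linarith
  obtain ⟨μ, hμ, hμε⟩ := exists_lt_of_csInf_lt hne h
  obtain ⟨w, hw⟩ := Module.End.HasEigenvalue.exists_hasEigenvector hμ
  have : Nontrivial (Vec d) := ⟨⟨w, 0, hw.2⟩⟩
  have hmin := hsym.hasEigenvalue_iInf_of_finiteDimensional
  set m : ℝ := ⨅ x : {x : Vec d // x ≠ 0},
    RCLike.re (inner ℝ ((H : Vec d →ₗ[ℝ] Vec d) x) (x : Vec d)) / ‖(x : Vec d)‖ ^ 2 with hm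
  have hbdd : BddBelow (Set.range fun x : {x : Vec d // x ≠ 0} =>
      RCLike.re (inner ℝ ((H : Vec d →ₗ[ℝ] Vec d) x) (x : Vec d)) / ‖(x : Vec d)‖ ^ 2) := by
    refine ⟨-‖H‖, ?_⟩
    rintro _ ⟨⟨y, hy⟩, rfl⟩
    have hy' : 0 < ‖y‖ := norm_pos_iff.2 hy
    simp only [ContinuousLinearMap.coe_coe, RCLike.re_to_real]
    rw [le_div_iff₀ (by positivity)]
    have h1 := abs_real_inner_le_norm (H y) y
    have h2 := H.le_opNorm y
    have h3 : ‖H y‖ * ‖y‖ ≤ ‖H‖ * ‖y‖ ^ 2 := by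
      nlinarith
    have := (abs_le.1 h1).1
    linarith
  have hle : ∀ v, m * ‖v‖ ^ 2 ≤ inner ℝ v (H v) := by
    intro v
    by_cases hv : v = 0
    · simp [hv]
    · have h1 := ciInf_le hbdd ⟨v, hv⟩
      rw [← hm] at h1
      have hv' : 0 < ‖v‖ := norm_pos_iff.2 hv
      simp only [ContinuousLinearMap.coe_coe, RCLike.re_to_real] at h1
      rw [le_div_iff₀ (by positivity)] at h1
      rwa [hs] at h1
  obtain ⟨z, hz⟩ := Module.End.HasEigenvalue.exists_hasEigenvector hmin
  refine ⟨-m, ‖z‖⁻¹ • z, ?_, ?_, ?_, fun v => by simpa using hle v⟩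
  · have h1 := hle w
    have h2 : H w = μ • w := hw.apply_eq_smul
    rw [h2, inner_smul_right, real_inner_self_eq_norm_sq] at h1
    have : 0 < ‖w‖ := norm_pos_iff.2 hw.2
    have := le_of_mul_le_mul_right h1 (by positivity)
    linarith
  · rw [norm_smul, norm_inv, norm_norm, inv_mul_cancel₀ (norm_ne_zero_iff.2 hz.2)]
  · have h2 : H z = m • z := by simpa using hz.apply_eq_smul
    rw [map_smul, h2, neg_neg, smul_comm]

lemma norm_hessian_le {f : Vec d → ℝ} {L : ℝ} (hL : 0 ≤ L) (hf : IsSmooth L f) (x : Vec d) :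
    ‖hessian f x‖ ≤ L := by
  have h : LipschitzWith ⟨L, hL⟩ (gradient f) :=
    LipschitzWith.of_dist_le_mul fun y z => by
      rw [dist_eq_norm, dist_eq_norm]; exact hf.2 y z
  exact norm_fderiv_le_of_lipschitz ℝ h

lemma norm_gradient_sub_hessian_le {f : Vec d → ℝ} {L : ℝ} (hL : 0 ≤ L)
    (hf : IsHessianLipschitz L f) (x w : Vec d) :
    ‖gradient f (x + w) - gradient f x - hessian f x w‖ ≤ L * ‖w‖ ^ 2 := by
  have h := (convex_closedBall x ‖w‖).norm_image_sub_le_of_norm_hasFDerivWithin_le'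
    (f := gradient f) (f' := fun y => hessian f y) (φ := hessian f x) (C := L * ‖w‖)
    (x := x) (y := x + w)
    (fun y _ => (hf.2.1 y).hasFDerivAt.hasFDerivWithinAt)
    (fun y hy => (hf.2.2 y x).trans (mul_le_mul_of_nonneg_left (by simpa [dist_eq_norm] using hy) hL))
    (by simp) (by simp)
  simp only [add_sub_cancel_left] at h
  calc _ ≤ L * ‖w‖ * ‖w‖ := h
    _ = _ := by ring

lemma abs_sub_inner_gradient_le {f : Vec d → ℝ} {L : ℝ} (hL : 0 ≤ L)
    (hf : IsSmooth L f) (x w : Vec d) :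
    |f (x + w) - f x - inner ℝ (gradient f x) w| ≤ L * ‖w‖ ^ 2 := by
  have h := (convex_closedBall x ‖w‖).norm_image_sub_le_of_norm_hasFDerivWithin_le'
    (f := f) (f' := fun y => InnerProductSpace.toDual ℝ (Vec d) (gradient f y))
    (φ := InnerProductSpace.toDual ℝ (Vec d) (gradient f x)) (C := L * ‖w‖)
    (x := x) (y := x + w)
    (fun y _ => (hasGradientAt_toDual hf.1 y).hasFDerivWithinAt)
    (fun y hy => by
      rw [← map_sub, LinearIsometryEquiv.norm_map]
      exact (hf.2 y x).trans (mul_le_mul_of_nonneg_left (by simpa [dist_eq_norm] using hy) hL))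
    (by simp) (by simp)
  simp only [add_sub_cancel_left, InnerProductSpace.toDual_apply_apply, Real.norm_eq_abs] at h
  calc _ ≤ L * ‖w‖ * ‖w‖ := h
    _ = _ := by ring

end Spectrum

/-! ### Expectations of the stochastic derivatives -/

section Objective

/-- Differentiation under the integral sign with a uniform quadratic remainder. -/
lemma integral_of_quadratic_remainder {Ξ : Type*} [MeasurableSpace Ξ] {D : Measure Ξ}
    [IsProbabilityMeasure D] {G : ℝ → Ξ → ℝ} {φ : Ξ → ℝ} {K c : ℝ}
    (hm : ∀ t, Measurable (G t)) (hi : ∀ t, Integrable (G t) D)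
    (hr : ∀ t ξ, |G t ξ - G 0 ξ - t * φ ξ| ≤ K * t ^ 2)
    (hc : HasDerivAt (fun t => ∫ ξ, G t ξ ∂D) c 0) :
    Measurable φ ∧ Integrable φ D ∧ ∫ ξ, φ ξ ∂D = c := by
  have hmeas : Measurable φ := by
    refine measurable_of_tendsto_metrizable
      (f := fun (n : ℕ) ξ => ((n : ℝ) + 1) * (G (1 / ((n : ℝ) + 1)) ξ - G 0 ξ))
      (fun n => ((hm _).sub (hm _)).const_mul _) ?_
    rw [tendsto_pi_nhds]
    intro ξ
    rw [tendsto_iff_norm_sub_tendsto_zero]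
    refine squeeze_zero (fun n => norm_nonneg _) (fun n => ?_)
      (by simpa using tendsto_one_div_add_atTop_nhds_zero_nat.const_mul K)
    have hn : (0 : ℝ) < (n : ℝ) + 1 := by positivity
    have h := hr (1 / ((n : ℝ) + 1)) ξ
    have e : ((n : ℝ) + 1) * (G (1 / ((n : ℝ) + 1)) ξ - G 0 ξ) - φ ξ =
        ((n : ℝ) + 1) * (G (1 / ((n : ℝ) + 1)) ξ - G 0 ξ - 1 / ((n : ℝ) + 1) * φ ξ) := by
      field_simp
    rw [e, Real.norm_eq_abs, abs_mul, abs_of_pos hn]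
    calc _ ≤ ((n : ℝ) + 1) * (K * (1 / ((n : ℝ) + 1)) ^ 2) :=
          mul_le_mul_of_nonneg_left h hn.le
      _ = _ := by field_simp
  have hint : Integrable φ D := by
    refine (((hi 1).sub (hi 0)).abs.add (integrable_const K)).mono' hmeas.aestronglyMeasurable
      (Filter.Eventually.of_forall fun ξ => ?_)
    have h := hr 1 ξ
    simp only [one_mul, one_pow, mul_one] at h
    simp only [Pi.add_apply, Pi.sub_apply, Real.norm_eq_abs]
    rw [abs_sub_comm] at h
    have := abs_sub_abs_le_abs_sub (φ ξ) (G 1 ξ - G 0 ξ)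
    linarith
  refine ⟨hmeas, hint, ?_⟩
  have hd : HasDerivAt (fun t => ∫ ξ, G t ξ ∂D) (∫ ξ, φ ξ ∂D) 0 := by
    rw [hasDerivAt_iff_isLittleO]
    refine Asymptotics.IsBigO.trans_isLittleO (g := fun t : ℝ => t ^ 2) ?_ ?_
    · refine Asymptotics.IsBigO.of_bound K (Filter.Eventually.of_forall fun t => ?_)
      have e : ∫ ξ, G t ξ ∂D - ∫ ξ, G 0 ξ ∂D - (t - 0) • ∫ ξ, φ ξ ∂D =
          ∫ ξ, (G t ξ - G 0 ξ - t * φ ξ) ∂D := by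
        have h1 := integral_sub ((hi t).sub (hi 0)) (hint.const_mul t)
        have h2 := integral_sub (hi t) (hi 0)
        simp only [Pi.sub_apply] at h1
        rw [h1, h2, integral_const_mul, sub_zero, smul_eq_mul]
      rw [e]
      have := norm_integral_le_of_norm_le_const (μ := D)
        (f := fun ξ => G t ξ - G 0 ξ - t * φ ξ) (C := K * t ^ 2)
        (Filter.Eventually.of_forall fun ξ => hr t ξ)
      simpa using this
    · simpa using (Asymptotics.isLittleO_pow_pow (𝕜 := ℝ) (m := 1) (n := 2) (by norm_num))
  exact hd.unique hc

variable {d : ℕ} {Ξ : Type*} [MeasurableSpace Ξ] {D : Measure Ξ}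
  {F : Vec d → Ξ → ℝ} {f : Vec d → ℝ} {L₁ L₂ L₃ : ℝ}

lemma measurable_of_inner {g : Ξ → Vec d} (h : ∀ w, Measurable fun ξ => (inner ℝ (g ξ) w : ℝ)) :
    Measurable g := by
  have e : g = fun ξ => ∑ i, (inner ℝ (g ξ) (EuclideanSpace.basisFun (Fin d) ℝ i) : ℝ) •
      EuclideanSpace.basisFun (Fin d) ℝ i := by
    funext ξ
    conv_lhs => rw [← (EuclideanSpace.basisFun (Fin d) ℝ).sum_repr' (g ξ)]
    exact Finset.sum_congr rfl fun i _ => by rw [real_inner_comm]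
  rw [e]
  exact Finset.measurable_sum _ fun i _ => (h _).smul_const _

lemma measurable_uncurry_right {E : Type*} [NormedAddCommGroup E] [MeasurableSpace E]
    [BorelSpace E] {g : Ξ → Vec d → E}
    (hc : ∀ ξ, Continuous (g ξ)) (hm : ∀ w, Measurable fun ξ => g ξ w) :
    Measurable (Function.uncurry g) := by
  have := measurable_uncurry_of_continuous_of_measurable (u := fun w ξ => g ξ w) hc hm
  exact this.comp measurable_swap

lemma hasDerivAt_line (x v : Vec d) (t : ℝ) : HasDerivAt (fun t : ℝ => x + t • v) v t := by
  simpa using ((hasDerivAt_id t).smul_const v).const_add x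

/-! ### The random linear operator and its perturbations -/

/-- A random symmetric operator `A ξ` with mean `H`, bounded by `L`. -/
structure RandomOperator (D : Measure Ξ) (A : Ξ → Vec d →L[ℝ] Vec d) (H : Vec d →L[ℝ] Vec d)
    (L : ℝ) : Prop where
  meas : ∀ z, Measurable fun ξ => A ξ z
  norm_le : ∀ ξ, ‖A ξ‖ ≤ L
  symm : ∀ ξ v w, inner ℝ (A ξ v) w = inner ℝ v (A ξ w)
  mean : ∀ v w, ∫ ξ, inner ℝ (A ξ v) w ∂D = inner ℝ (H v) w

/-- A nonlinear oracle `Γ ξ` that agrees with the linear operator `A ξ` up to a relative error `κ`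
on the ball of radius `r`. The Hessian-vector product oracle has `κ = 0`; the oracle
`w ↦ ∇F(x + w; ξ) - ∇F(x; ξ)` has `κ = L₂ r`. -/
structure IsNearLinear (A : Ξ → Vec d →L[ℝ] Vec d) (Γ : Ξ → Vec d → Vec d) (L κ r : ℝ) :
    Prop where
  meas : Measurable (Function.uncurry Γ)
  norm_le : ∀ ξ w, ‖Γ ξ w‖ ≤ L * ‖w‖
  close : ∀ ξ w, ‖w‖ ≤ r → ‖Γ ξ w - A ξ w‖ ≤ κ * ‖w‖

lemma RandomOperator.measurable_uncurry {A : Ξ → Vec d →L[ℝ] Vec d} {H : Vec d →L[ℝ] Vec d}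
    {L : ℝ} (hA : RandomOperator D A H L) : Measurable (Function.uncurry fun ξ w => A ξ w) :=
  measurable_uncurry_right (fun ξ => (A ξ).continuous) hA.meas

lemma RandomOperator.nearLinear {A : Ξ → Vec d →L[ℝ] Vec d} {H : Vec d →L[ℝ] Vec d}
    {L κ r : ℝ} (hA : RandomOperator D A H L) (hκ : 0 ≤ κ) :
    IsNearLinear A (fun ξ w => A ξ w) L κ r where
  meas := hA.measurable_uncurry
  norm_le ξ w := (A ξ).le_of_opNorm_le (hA.norm_le ξ) w
  close ξ w _ := by simpa using mul_nonneg hκ (norm_nonneg w)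

lemma RandomOperator.abs_inner_le {A : Ξ → Vec d →L[ℝ] Vec d} {H : Vec d →L[ℝ] Vec d}
    {L : ℝ} (hA : RandomOperator D A H L) (ξ : Ξ) (v w : Vec d) :
    |inner ℝ (A ξ v) w| ≤ L * ‖v‖ * ‖w‖ :=
  (abs_real_inner_le_norm _ _).trans
    (mul_le_mul_of_nonneg_right ((A ξ).le_of_opNorm_le (hA.norm_le ξ) v) (norm_nonneg _))

variable [IsProbabilityMeasure D]

/-- Stochastic gradients are measurable, integrable and unbiased; only the values of `F` are assumed
to be so. -/
lemma IsStochasticObjective.inner_gradOracle (h : IsStochasticObjective D F f L₁ L₂ L₃)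
    (hL₁ : 0 < L₁) (y w : Vec d) :
    (Measurable fun ξ => (inner ℝ (gradOracle F ξ y) w : ℝ)) ∧
      Integrable (fun ξ => (inner ℝ (gradOracle F ξ y) w : ℝ)) D ∧
      ∫ ξ, inner ℝ (gradOracle F ξ y) w ∂D = inner ℝ (gradient f y) w := by
  refine integral_of_quadratic_remainder (G := fun t ξ => F (y + t • w) ξ) (K := L₁ * ‖w‖ ^ 2)
    (fun t => h.measurable _) (fun t => h.integrable _) (fun t ξ => ?_) ?_
  · have := abs_sub_inner_gradient_le hL₁.le (h.smooth ξ) y (t • w)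
    rw [inner_smul_right, norm_smul, mul_pow, Real.norm_eq_abs, sq_abs] at this
    simp only [zero_smul, add_zero]
    exact this.trans_eq (by ring)
  · have e : (fun t : ℝ => ∫ ξ, F (y + t • w) ξ ∂D) = fun t => f (y + t • w) := by
      funext t; rw [h.eq_integral]
    rw [e]
    have hd : Differentiable ℝ f := h.thirdDerivLipschitz.1.differentiable (by norm_num)
    have := (hasGradientAt_toDual hd (y + (0 : ℝ) • w)).comp_hasDerivAt 0 (hasDerivAt_line y w 0)
    simpa [Function.comp_def] using this

/-- Stochastic Hessian-vector products are unbiased, too. -/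
lemma IsStochasticObjective.inner_hvpOracle (h : IsStochasticObjective D F f L₁ L₂ L₃)
    (hL₁ : 0 < L₁) (hL₂ : 0 ≤ L₂) (x u w : Vec d) :
    (Measurable fun ξ => (inner ℝ (hvpOracle F ξ x u) w : ℝ)) ∧
      Integrable (fun ξ => (inner ℝ (hvpOracle F ξ x u) w : ℝ)) D ∧
      ∫ ξ, inner ℝ (hvpOracle F ξ x u) w ∂D = inner ℝ (hessian f x u) w := by
  refine integral_of_quadratic_remainder
    (G := fun t ξ => inner ℝ (gradOracle F ξ (x + t • u)) w) (K := L₂ * ‖u‖ ^ 2 * ‖w‖)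
    (fun t => (h.inner_gradOracle hL₁ _ _).1) (fun t => (h.inner_gradOracle hL₁ _ _).2.1)
    (fun t ξ => ?_) ?_
  · have h1 := norm_gradient_sub_hessian_le hL₂ (h.hessianLipschitz ξ) x (t • u)
    rw [norm_smul, mul_pow, Real.norm_eq_abs, sq_abs] at h1
    simp only [zero_smul, add_zero]
    have e : inner ℝ (gradOracle F ξ (x + t • u)) w - inner ℝ (gradOracle F ξ x) w -
        t * inner ℝ (hvpOracle F ξ x u) w =
        inner ℝ (gradient (fun z => F z ξ) (x + t • u) - gradient (fun z => F z ξ) x -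
          hessian (fun z => F z ξ) x (t • u)) w := by
      rw [inner_sub_left, inner_sub_left, map_smul, inner_smul_left]; rfl
    rw [e]
    refine (abs_real_inner_le_norm _ _).trans ?_
    calc _ ≤ L₂ * (t ^ 2 * ‖u‖ ^ 2) * ‖w‖ := mul_le_mul_of_nonneg_right h1 (norm_nonneg _)
      _ = _ := by ring
  · have e : (fun t : ℝ => ∫ ξ, inner ℝ (gradOracle F ξ (x + t • u)) w ∂D) =
        fun t => inner ℝ (gradient f (x + t • u)) w := by
      funext t; rw [(h.inner_gradOracle hL₁ _ _).2.2]
    rw [e]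
    have hd : Differentiable ℝ (gradient f) :=
      differentiable_gradient (h.thirdDerivLipschitz.1.of_le (by norm_num))
    have h1 := (hd (x + (0 : ℝ) • u)).hasFDerivAt.comp_hasDerivAt 0 (hasDerivAt_line x u 0)
    have h2 := h1.inner ℝ (hasDerivAt_const (0 : ℝ) w)
    simpa [hessian, Function.comp_def] using h2

lemma IsStochasticObjective.measurable_gradOracle (h : IsStochasticObjective D F f L₁ L₂ L₃)
    (hL₁ : 0 < L₁) : Measurable (Function.uncurry (gradOracle F)) := by
  refine measurable_uncurry_right (fun ξ => ?_)
    (fun w => measurable_of_inner fun z => (h.inner_gradOracle hL₁ _ _).1)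
  exact (h.hessianLipschitz ξ).2.1.continuous

lemma IsStochasticObjective.randomOperator (h : IsStochasticObjective D F f L₁ L₂ L₃)
    (hL₁ : 0 < L₁) (hL₂ : 0 ≤ L₂) (x : Vec d) :
    RandomOperator D (fun ξ => hessian (fun z => F z ξ) x) (hessian f x) L₁ where
  meas z := measurable_of_inner fun w => (h.inner_hvpOracle hL₁ hL₂ x z w).1
  norm_le ξ := norm_hessian_le hL₁.le (h.smooth ξ) x
  symm ξ v w := inner_hessian_comm (h.smooth ξ).1 (h.hessianLipschitz ξ).2.1 x v w
  mean v w := (h.inner_hvpOracle hL₁ hL₂ x v w).2.2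

lemma IsStochasticObjective.nearLinear_grad (h : IsStochasticObjective D F f L₁ L₂ L₃)
    (hL₁ : 0 < L₁) (hL₂ : 0 ≤ L₂) (x : Vec d) {κ r : ℝ} (hκ : L₂ * r ≤ κ) :
    IsNearLinear (fun ξ => hessian (fun z => F z ξ) x)
      (fun ξ w => gradOracle F ξ (x + w) - gradOracle F ξ x) L₁ κ r where
  meas := by
    have h1 := h.measurable_gradOracle hL₁
    exact (h1.comp (measurable_fst.prodMk (measurable_snd.const_add x))).sub
      (h1.comp (measurable_fst.prodMk measurable_const))
  norm_le ξ w := by simpa [gradOracle] using (h.smooth ξ).2 (x + w) x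
  close ξ w hw := by
    refine (norm_gradient_sub_hessian_le hL₂ (h.hessianLipschitz ξ) x w).trans ?_
    have : L₂ * ‖w‖ ≤ κ := (mul_le_mul_of_nonneg_left hw hL₂).trans hκ
    nlinarith [norm_nonneg w]

lemma RandomOperator.integrable_inner {A : Ξ → Vec d →L[ℝ] Vec d} {H : Vec d →L[ℝ] Vec d}
    {L : ℝ} (hA : RandomOperator D A H L) (v w : Vec d) :
    Integrable (fun ξ => (inner ℝ (A ξ v) w : ℝ)) D :=
  Integrable.of_bound ((hA.meas v).inner_const).aestronglyMeasurable (L * ‖v‖ * ‖w‖)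
    (Filter.Eventually.of_forall fun ξ => hA.abs_inner_le ξ v w)

lemma RandomOperator.abs_mean_le {A : Ξ → Vec d →L[ℝ] Vec d} {H : Vec d →L[ℝ] Vec d}
    {L : ℝ} (hA : RandomOperator D A H L) (v w : Vec d) :
    |inner ℝ (H v) w| ≤ L * ‖v‖ * ‖w‖ := by
  rw [← hA.mean]
  have := norm_integral_le_of_norm_le_const (μ := D)
    (f := fun ξ => (inner ℝ (A ξ v) w : ℝ)) (C := L * ‖v‖ * ‖w‖)
    (Filter.Eventually.of_forall fun ξ => hA.abs_inner_le ξ v w)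
  simpa using this

end Objective

/-! ### Resampling one coordinate of an i.i.d. sequence -/

section Resampling

variable {Ξ : Type*} [MeasurableSpace Ξ] (D : Measure Ξ) [IsProbabilityMeasure D]

lemma measurable_update_coord (n : ℕ) :
    Measurable fun p : (ℕ → Ξ) × Ξ => Function.update p.1 n p.2 := by
  rw [measurable_pi_iff]
  intro i
  by_cases h : i = n
  · subst h; simpa using measurable_snd
  · simpa [Function.update_of_ne h, Function.comp_def] using
      (measurable_pi_apply i).comp measurable_fst

/-- Replacing one coordinate of an i.i.d. sequence by an independent copy does not change its
law. -/
lemma measurePreserving_update (n : ℕ) :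
    MeasurePreserving (fun p : (ℕ → Ξ) × Ξ => Function.update p.1 n p.2)
      ((Measure.infinitePi fun _ : ℕ => D).prod D) (Measure.infinitePi fun _ : ℕ => D) := by
  refine ⟨measurable_update_coord n, ?_⟩
  refine Measure.eq_infinitePi _ fun s t ht => ?_
  rw [Measure.map_apply (measurable_update_coord n) (.pi s.countable_toSet fun i _ => ht i)]
  by_cases hn : n ∈ s
  · have e : (fun p : (ℕ → Ξ) × Ξ => Function.update p.1 n p.2) ⁻¹' ((s : Set ℕ).pi t) =
        (((s.erase n : Finset ℕ) : Set ℕ).pi t) ×ˢ t n := by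
      ext p
      simp only [Set.mem_preimage, Set.mem_pi, Set.mem_prod, Finset.coe_erase, Set.mem_sdiff,
        Finset.mem_coe, Set.mem_singleton_iff]
      constructor
      · intro h
        refine ⟨fun i hi => ?_, by simpa using h n hn⟩
        simpa [Function.update_of_ne hi.2] using h i hi.1
      · rintro ⟨h1, h2⟩ i hi
        by_cases h : i = n
        · subst h; simpa using h2
        · simpa [Function.update_of_ne h] using h1 i ⟨hi, h⟩
    rw [e, Measure.prod_prod, Measure.infinitePi_pi _ (fun i _ => ht i), mul_comm,
      Finset.mul_prod_erase s (fun i => D (t i)) hn]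
  · have e : (fun p : (ℕ → Ξ) × Ξ => Function.update p.1 n p.2) ⁻¹' ((s : Set ℕ).pi t) =
        ((s : Set ℕ).pi t) ×ˢ Set.univ := by
      ext p
      simp only [Set.mem_preimage, Set.mem_pi, Set.mem_prod, Finset.mem_coe, Set.mem_univ, and_true]
      refine forall₂_congr fun i hi => ?_
      rw [Function.update_of_ne (by rintro rfl; exact hn hi)]
    rw [e, Measure.prod_prod, Measure.infinitePi_pi _ (fun i _ => ht i), measure_univ, mul_one]

variable {D}

lemma integral_resample {Φ : (ℕ → Ξ) → ℝ} (hm : Measurable Φ)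
    (hi : Integrable Φ (Measure.infinitePi fun _ : ℕ => D)) (n : ℕ) :
    ∫ ξ, Φ ξ ∂(Measure.infinitePi fun _ : ℕ => D) =
      ∫ ξ, ∫ s, Φ (Function.update ξ n s) ∂D ∂(Measure.infinitePi fun _ : ℕ => D) := by
  have hp := measurePreserving_update D n
  rw [← hp.map_eq, integral_map hp.measurable.aemeasurable hm.aestronglyMeasurable, hp.map_eq]
  exact integral_prod _ (hp.integrable_comp_of_integrable hi)

lemma integral_resample_symm {Φ : (ℕ → Ξ) → ℝ} (hm : Measurable Φ)
    (hi : Integrable Φ (Measure.infinitePi fun _ : ℕ => D)) (n : ℕ) :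
    ∫ ξ, Φ ξ ∂(Measure.infinitePi fun _ : ℕ => D) =
      ∫ s, ∫ ξ, Φ (Function.update ξ n s) ∂(Measure.infinitePi fun _ : ℕ => D) ∂D := by
  have hp := measurePreserving_update D n
  rw [← hp.map_eq, integral_map hp.measurable.aemeasurable hm.aestronglyMeasurable, hp.map_eq]
  exact integral_prod_symm _ (hp.integrable_comp_of_integrable hi)

end Resampling

/-! ### The iteration and its transpose -/

section Iteration

variable {d : ℕ} {Ξ : Type*}

/-- The iteration `w_{t+1} = w_t - α Γ(ξ_t, w_t)`. -/
def iter (Γ : Ξ → Vec d → Vec d) (α : ℝ) (ξ : ℕ → Ξ) (w₀ : Vec d) : ℕ → Vec d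
  | 0 => w₀
  | t + 1 => iter Γ α ξ w₀ t - α • Γ (ξ t) (iter Γ α ξ w₀ t)

/-- The transposed product `(I - α A_{ξ_0}) ⋯ (I - α A_{ξ_{n-1}}) z`. -/
def transposedIter (A : Ξ → Vec d →L[ℝ] Vec d) (α : ℝ) (ξ : ℕ → Ξ) : ℕ → Vec d → Vec d
  | 0, z => z
  | n + 1, z => transposedIter A α ξ n (z - α • A (ξ n) z)

lemma iter_congr {Γ : Ξ → Vec d → Vec d} {α : ℝ} {ξ ξ' : ℕ → Ξ} {w₀ : Vec d} {n : ℕ}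
    (h : ∀ i < n, ξ i = ξ' i) : iter Γ α ξ w₀ n = iter Γ α ξ' w₀ n := by
  induction n with
  | zero => rfl
  | succ n ih =>
    simp only [iter]
    rw [ih fun i hi => h i (by omega), h n (by omega)]

lemma transposedIter_congr {A : Ξ → Vec d →L[ℝ] Vec d} {α : ℝ} {ξ ξ' : ℕ → Ξ} {n : ℕ}
    (h : ∀ i < n, ξ i = ξ' i) (z : Vec d) :
    transposedIter A α ξ n z = transposedIter A α ξ' n z := by
  induction n generalizing z with
  | zero => rfl
  | succ n ih =>
    simp only [transposedIter]
    rw [ih (fun i hi => h i (by omega)), h n (by omega)]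

lemma transposedIter_update {A : Ξ → Vec d →L[ℝ] Vec d} {α : ℝ} (ξ : ℕ → Ξ) (n : ℕ) (s : Ξ)
    (z : Vec d) : transposedIter A α (Function.update ξ n s) n z = transposedIter A α ξ n z :=
  transposedIter_congr (fun _ hi => Function.update_of_ne hi.ne _ _) z

lemma transposedIter_succ_update {A : Ξ → Vec d →L[ℝ] Vec d} {α : ℝ} (ξ : ℕ → Ξ) (n : ℕ) (s : Ξ)
    (z : Vec d) : transposedIter A α (Function.update ξ n s) (n + 1) z =
      transposedIter A α ξ n (z - α • A s z) := by
  simp only [transposedIter, Function.update_self, transposedIter_update]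

variable [MeasurableSpace Ξ]

lemma measurable_iter {Γ : Ξ → Vec d → Vec d} (hΓ : Measurable (Function.uncurry Γ)) (α : ℝ)
    (n : ℕ) : Measurable fun p : Vec d × (ℕ → Ξ) => iter Γ α p.2 p.1 n := by
  induction n with
  | zero => exact measurable_fst
  | succ n ih =>
    simp only [iter]
    refine ih.sub (Measurable.const_smul ?_ α)
    exact hΓ.comp (((measurable_pi_apply n).comp measurable_snd).prodMk ih)

variable {D : Measure Ξ} {A : Ξ → Vec d →L[ℝ] Vec d} {H : Vec d →L[ℝ] Vec d} {L : ℝ}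

lemma measurable_transposedIter (hA : RandomOperator D A H L) (α : ℝ) (n : ℕ) :
    Measurable fun p : (ℕ → Ξ) × Vec d => transposedIter A α p.1 n p.2 := by
  induction n with
  | zero => exact measurable_snd
  | succ n ih =>
    simp only [transposedIter]
    refine ih.comp (measurable_fst.prodMk (measurable_snd.sub (Measurable.const_smul ?_ α)))
    have h : Measurable fun p : (ℕ → Ξ) × Vec d => (p.1 n, p.2) :=
      ((measurable_pi_apply n).comp measurable_fst).prodMk measurable_snd
    exact hA.measurable_uncurry.comp h

lemma measurable_transposedIter_left (hA : RandomOperator D A H L) (α : ℝ) (n : ℕ) (z : Vec d) :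
    Measurable fun ξ => transposedIter A α ξ n z :=
  (measurable_transposedIter hA α n).comp (measurable_id.prodMk measurable_const)

/-- The iterate in direction `u` equals the starting point in the direction of the transposed
product applied to `u`. -/
lemma inner_iter_eq (hA : RandomOperator D A H L) (α : ℝ) (ξ : ℕ → Ξ) (g : Vec d) (n : ℕ)
    (u : Vec d) :
    inner ℝ u (iter (fun ξ w => A ξ w) α ξ g n) = inner ℝ (transposedIter A α ξ n u) g := by
  induction n generalizing u with
  | zero => rfl
  | succ n ih =>
    simp only [iter, transposedIter]
    rw [← ih, inner_sub_left, inner_sub_right, inner_smul_left, inner_smul_right,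
      hA.symm]
    rfl

lemma norm_sub_smul_le (hA : RandomOperator D A H L) {α : ℝ} (hα : 0 ≤ α) (ξ : Ξ) (z : Vec d) :
    ‖z - α • A ξ z‖ ≤ (1 + α * L) * ‖z‖ := by
  refine (norm_sub_le _ _).trans ?_
  rw [norm_smul, Real.norm_of_nonneg hα]
  have := mul_le_mul_of_nonneg_left ((A ξ).le_of_opNorm_le (hA.norm_le ξ) z) hα
  linarith

lemma norm_transposedIter_le (hA : RandomOperator D A H L) {α : ℝ} (hα : 0 ≤ α) (hL : 0 ≤ L)
    (ξ : ℕ → Ξ) (n : ℕ) (z : Vec d) :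
    ‖transposedIter A α ξ n z‖ ≤ (1 + α * L) ^ n * ‖z‖ := by
  induction n generalizing z with
  | zero => simp [transposedIter]
  | succ n ih =>
    simp only [transposedIter]
    refine (ih _).trans ?_
    rw [pow_succ, mul_assoc]
    exact mul_le_mul_of_nonneg_left (norm_sub_smul_le hA hα _ z) (by positivity)

variable [IsProbabilityMeasure D]

lemma integrable_inner_transposedIter (hA : RandomOperator D A H L) {α : ℝ} (hα : 0 ≤ α)
    (hL : 0 ≤ L) (n : ℕ) (u z : Vec d) :
    Integrable (fun ξ => (inner ℝ u (transposedIter A α ξ n z) : ℝ))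
      (Measure.infinitePi fun _ : ℕ => D) := by
  refine Integrable.of_bound
    ((measurable_transposedIter_left hA α n z).const_inner).aestronglyMeasurable
    (‖u‖ * ((1 + α * L) ^ n * ‖z‖)) (Filter.Eventually.of_forall fun ξ => ?_)
  exact (abs_real_inner_le_norm _ _).trans (mul_le_mul_of_nonneg_left
    (norm_transposedIter_le hA hα hL ξ n z) (norm_nonneg _))

lemma integrable_norm_sq_transposedIter (hA : RandomOperator D A H L) {α : ℝ} (hα : 0 ≤ α)
    (hL : 0 ≤ L) (n : ℕ) (z : Vec d) :
    Integrable (fun ξ => ‖transposedIter A α ξ n z‖ ^ 2)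
      (Measure.infinitePi fun _ : ℕ => D) := by
  refine Integrable.of_bound
    ((measurable_transposedIter_left hA α n z).norm.pow_const 2).aestronglyMeasurable
    (((1 + α * L) ^ n * ‖z‖) ^ 2) (Filter.Eventually.of_forall fun ξ => ?_)
  rw [Real.norm_of_nonneg (by positivity)]
  exact pow_le_pow_left₀ (norm_nonneg _) (norm_transposedIter_le hA hα hL ξ n z) 2

/-- On an eigenvector of the mean operator the transposed product has the expected growth. -/
lemma integral_inner_transposedIter (hA : RandomOperator D A H L) {α l : ℝ} (hα : 0 ≤ α)
    (hL : 0 ≤ L) {u : Vec d} (hH : ∀ v w, inner ℝ (H v) w = inner ℝ v (H w))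
    (hu : H u = (-l) • u) (n : ℕ) (z : Vec d) :
    ∫ ξ, inner ℝ u (transposedIter A α ξ n z) ∂(Measure.infinitePi fun _ : ℕ => D) =
      (1 + α * l) ^ n * inner ℝ u z := by
  induction n generalizing z with
  | zero => simp [transposedIter]
  | succ n ih =>
    rw [integral_resample_symm ((measurable_transposedIter_left hA α (n + 1) z).const_inner)
      (integrable_inner_transposedIter hA hα hL (n + 1) u z) n]
    simp only [transposedIter_succ_update, ih, inner_sub_right, inner_smul_right]
    have hi : Integrable (fun s => (inner ℝ u (A s z) : ℝ)) D := by
      simpa only [real_inner_comm] using hA.integrable_inner z u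
    have hm : ∫ s, inner ℝ u (A s z) ∂D = -l * inner ℝ u z := by
      have := hA.mean z u
      rw [hH, hu, inner_smul_right, real_inner_comm] at this
      rw [← this]
      exact integral_congr_ae (Filter.Eventually.of_forall fun s => real_inner_comm _ _)
    rw [integral_const_mul, integral_sub (integrable_const _) (hi.const_mul α),
      integral_const_mul, hm]
    simp
    ring

lemma integral_norm_sq_step_le (hA : RandomOperator D A H L) {α l : ℝ} (hα : 0 ≤ α)
    (hH : ∀ v, -l * ‖v‖ ^ 2 ≤ inner ℝ v (H v)) (z : Vec d) :
    ∫ s, ‖z - α • A s z‖ ^ 2 ∂D ≤ (1 + 2 * α * l + α ^ 2 * L ^ 2) * ‖z‖ ^ 2 := by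
  have hi := hA.integrable_inner z z
  have hb : ∀ s, ‖z - α • A s z‖ ^ 2 ≤
      ‖z‖ ^ 2 - 2 * α * inner ℝ (A s z) z + α ^ 2 * L ^ 2 * ‖z‖ ^ 2 := by
    intro s
    rw [norm_sub_sq_real, inner_smul_right, norm_smul, Real.norm_of_nonneg hα, real_inner_comm]
    have := pow_le_pow_left₀ (norm_nonneg _) ((A s).le_of_opNorm_le (hA.norm_le s) z) 2
    nlinarith [sq_nonneg α]
  have hi2 : Integrable (fun s => ‖z‖ ^ 2 - 2 * α * inner ℝ (A s z) z + α ^ 2 * L ^ 2 * ‖z‖ ^ 2) D :=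
    ((integrable_const _).sub (hi.const_mul _)).add (integrable_const _)
  refine (integral_mono_of_nonneg (Filter.Eventually.of_forall fun s => by positivity) hi2
    (Filter.Eventually.of_forall hb)).trans ?_
  have h1 : ∫ s, (‖z‖ ^ 2 - 2 * α * inner ℝ (A s z) z + α ^ 2 * L ^ 2 * ‖z‖ ^ 2) ∂D =
      ‖z‖ ^ 2 - 2 * α * inner ℝ (H z) z + α ^ 2 * L ^ 2 * ‖z‖ ^ 2 := by
    have hi3 : Integrable (fun s => ‖z‖ ^ 2 - 2 * α * inner ℝ (A s z) z) D :=
      (integrable_const _).sub (hi.const_mul _)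
    rw [integral_add hi3 (integrable_const _),
      integral_sub (integrable_const _) (hi.const_mul _), integral_const_mul, hA.mean]
    simp
  rw [h1]
  have := hH z
  rw [real_inner_comm] at this
  nlinarith

/-- Second moments of the transposed product. Its last factor acts first and is independent of the
others, and it multiplies the second moment by at most `1 + 2αl + α²L²`. -/
lemma integral_norm_sq_transposedIter_le (hA : RandomOperator D A H L) {α l : ℝ} (hα : 0 ≤ α)
    (hL : 0 ≤ L) (hl : 0 ≤ l) (hH : ∀ v, -l * ‖v‖ ^ 2 ≤ inner ℝ v (H v)) (n : ℕ) (z : Vec d) :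
    ∫ ξ, ‖transposedIter A α ξ n z‖ ^ 2 ∂(Measure.infinitePi fun _ : ℕ => D) ≤
      (1 + 2 * α * l + α ^ 2 * L ^ 2) ^ n * ‖z‖ ^ 2 := by
  induction n generalizing z with
  | zero => simp [transposedIter]
  | succ n ih =>
    have hm := (measurable_transposedIter_left hA α (n + 1) z).norm.pow_const 2
    have hint := integrable_norm_sq_transposedIter hA hα hL (n + 1) z
    rw [integral_resample_symm hm hint n]
    simp only [transposedIter_succ_update]
    have hstep : Measurable fun s => z - α • A s z := ((hA.meas z).const_smul α).const_sub z
    have hi : Integrable (fun s => (1 + 2 * α * l + α ^ 2 * L ^ 2) ^ n * ‖z - α • A s z‖ ^ 2) D := by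
      refine Integrable.const_mul ?_ _
      refine Integrable.of_bound (hstep.norm.pow_const 2).aestronglyMeasurable
        (((1 + α * L) * ‖z‖) ^ 2) (Filter.Eventually.of_forall fun s => ?_)
      rw [Real.norm_of_nonneg (by positivity)]
      exact pow_le_pow_left₀ (norm_nonneg _) (norm_sub_smul_le hA hα s z) 2
    refine (integral_mono_of_nonneg (Filter.Eventually.of_forall fun s =>
      integral_nonneg fun _ => by positivity) hi
      (Filter.Eventually.of_forall fun s => ih _)).trans ?_
    rw [integral_const_mul, pow_succ (1 + 2 * α * l + α ^ 2 * L ^ 2) n,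
      mul_assoc ((1 + 2 * α * l + α ^ 2 * L ^ 2) ^ n)]
    exact mul_le_mul_of_nonneg_left (integral_norm_sq_step_le hA hα hH z) (by positivity)

/-- Chebyshev's inequality for the component of the transposed product along the bottom
eigenvector: the relative variance is at most `(1 + α²L²)^n - 1`. -/
lemma measure_inner_transposedIter_le (hA : RandomOperator D A H L) {α l : ℝ} (hα : 0 ≤ α)
    (hL : 0 ≤ L) (hl : 0 ≤ l) {u : Vec d} (hHs : ∀ v w, inner ℝ (H v) w = inner ℝ v (H w))
    (hu : H u = (-l) • u) (hu1 : ‖u‖ = 1) (hH : ∀ v, -l * ‖v‖ ^ 2 ≤ inner ℝ v (H v)) (n : ℕ)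
    (hn : α ^ 2 * L ^ 2 * n ≤ 1 / 200) :
    (Measure.infinitePi fun _ : ℕ => D)
      {ξ | (inner ℝ u (transposedIter A α ξ n u) : ℝ) ≤ (1 + α * l) ^ n / 2} ≤
      ENNReal.ofReal (1 / 40) := by
  set ν := Measure.infinitePi fun _ : ℕ => D with hν
  set X : (ℕ → Ξ) → ℝ := fun ξ => inner ℝ u (transposedIter A α ξ n u) with hX
  set μ : ℝ := (1 + α * l) ^ n with hμ
  have hαl : 0 ≤ α * l := by positivity
  have hμ0 : 0 < μ := by positivity
  have hXm : Measurable X := (measurable_transposedIter_left hA α n u).const_inner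
  have hXi : Integrable X ν := integrable_inner_transposedIter hA hα hL n u u
  have hXe : ∫ ξ, X ξ ∂ν = μ := by
    rw [hX, integral_inner_transposedIter hA hα hL hHs hu n u, real_inner_self_eq_norm_sq, hu1]
    simp [hμ]
  have hQi := integrable_norm_sq_transposedIter hA hα hL n u
  have hX2b : ∀ ξ, X ξ ^ 2 ≤ ‖transposedIter A α ξ n u‖ ^ 2 := by
    intro ξ
    have := abs_real_inner_le_norm u (transposedIter A α ξ n u)
    rw [hu1, one_mul] at this
    exact sq_le_sq' (by have := (abs_le.1 this).1; linarith) (abs_le.1 this).2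
  have hX2i : Integrable (fun ξ => X ξ ^ 2) ν :=
    hQi.mono' (hXm.pow_const 2).aestronglyMeasurable (Filter.Eventually.of_forall fun ξ => by
      rw [Real.norm_of_nonneg (by positivity)]; exact hX2b ξ)
  have hX2 : ∫ ξ, X ξ ^ 2 ∂ν ≤ μ ^ 2 * Real.exp (1 / 200) := by
    refine (integral_mono hX2i hQi hX2b).trans
      ((integral_norm_sq_transposedIter_le hA hα hL hl hH n u).trans ?_)
    rw [hu1, one_pow, mul_one]
    have h1 : (1 + 2 * α * l + α ^ 2 * L ^ 2) ≤ (1 + α * l) ^ 2 * Real.exp (α ^ 2 * L ^ 2) := by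
      have := Real.add_one_le_exp (α ^ 2 * L ^ 2)
      have h2 : (1 + α * l) ^ 2 * (α ^ 2 * L ^ 2 + 1) ≤ (1 + α * l) ^ 2 * Real.exp (α ^ 2 * L ^ 2) :=
        mul_le_mul_of_nonneg_left this (by positivity)
      have h3 : 0 ≤ α ^ 2 * L ^ 2 := by positivity
      nlinarith [mul_nonneg hαl h3, mul_nonneg (sq_nonneg (α * l)) h3]
    calc (1 + 2 * α * l + α ^ 2 * L ^ 2) ^ n
        ≤ ((1 + α * l) ^ 2 * Real.exp (α ^ 2 * L ^ 2)) ^ n := by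
          refine pow_le_pow_left₀ ?_ h1 n
          nlinarith [sq_nonneg (α * L)]
      _ = μ ^ 2 * Real.exp (α ^ 2 * L ^ 2 * n) := by
          rw [mul_pow, ← pow_mul, mul_comm 2 n, pow_mul, ← Real.exp_nat_mul, mul_comm (n : ℝ)]
      _ ≤ _ := by gcongr
  have hvar : ∫ ξ, (X ξ - μ) ^ 2 ∂ν ≤ μ ^ 2 * (1 / 160) := by
    have e : ∀ ξ, (X ξ - μ) ^ 2 = X ξ ^ 2 - 2 * μ * X ξ + μ ^ 2 := fun ξ => by ring
    simp only [e]
    have hi3 : Integrable (fun ξ => X ξ ^ 2 - 2 * μ * X ξ) ν := hX2i.sub (hXi.const_mul _)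
    rw [integral_add hi3 (integrable_const _),
      integral_sub hX2i (hXi.const_mul _), integral_const_mul, hXe]
    have hexp : Real.exp (1 / 200) ≤ 1 + 1 / 160 := by
      have := Real.exp_bound_div_one_sub_of_interval' (x := 1 / 200) (by norm_num) (by norm_num)
      norm_num at this ⊢
      linarith
    simp
    nlinarith [sq_nonneg μ, mul_le_mul_of_nonneg_left hexp (sq_nonneg μ)]
  have hsub : {ξ | X ξ ≤ μ / 2} ⊆ {ξ | μ ^ 2 / 4 ≤ (X ξ - μ) ^ 2} := by
    intro ξ (hξ : X ξ ≤ μ / 2)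
    show μ ^ 2 / 4 ≤ (X ξ - μ) ^ 2
    nlinarith
  have hi : Integrable (fun ξ => (X ξ - μ) ^ 2) ν := by
    have e : (fun ξ => (X ξ - μ) ^ 2) = fun ξ => X ξ ^ 2 - 2 * μ * X ξ + μ ^ 2 := by
      funext ξ; ring
    rw [e]
    exact (hX2i.sub (hXi.const_mul _)).add (integrable_const _)
  have hmarkov := mul_meas_ge_le_integral_of_nonneg (μ := ν)
    (Filter.Eventually.of_forall fun ξ => sq_nonneg (X ξ - μ)) hi (μ ^ 2 / 4)
  have hreal : ν.real {ξ | μ ^ 2 / 4 ≤ (X ξ - μ) ^ 2} ≤ 1 / 40 := by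
    have h := hmarkov.trans hvar
    have : 0 < μ ^ 2 := by positivity
    nlinarith
  refine (measure_mono hsub).trans ?_
  rw [← ENNReal.ofReal_toReal (measure_ne_top ν _)]
  exact ENNReal.ofReal_le_ofReal hreal

end Iteration

/-! ### Union bounds on product spaces -/

section Product

variable {α β : Type*} [MeasurableSpace α] [MeasurableSpace β] {μ : Measure α} {ν : Measure β}

lemma lintegral_le_add_of_le_on_compl [IsProbabilityMeasure μ] {g : α → ℝ≥0∞} {B : Set α} {q : ℝ≥0∞}
    (h1 : ∀ a, g a ≤ 1) (h : ∀ a ∉ B, g a ≤ q) : ∫⁻ a, g a ∂μ ≤ μ B + q := by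
  calc ∫⁻ a, g a ∂μ ≤ ∫⁻ a, (B.indicator (fun _ => 1) a + q) ∂μ := by
        refine lintegral_mono fun a => ?_
        by_cases ha : a ∈ B
        · simpa [ha] using (h1 a).trans le_self_add
        · simpa [ha] using h a ha
    _ = ∫⁻ a, B.indicator (fun _ => 1) a ∂μ + q := by
        rw [lintegral_add_right _ measurable_const]; simp
    _ ≤ μ B + q := by
        gcongr
        simpa using lintegral_indicator_const_le (μ := μ) B 1

lemma prod_measure_le_add [IsProbabilityMeasure μ] [IsProbabilityMeasure ν] {N : Set (α × β)}
    (hN : MeasurableSet N) {B : Set α} {q : ℝ≥0∞} (h : ∀ a ∉ B, ν {b | (a, b) ∈ N} ≤ q) :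
    (μ.prod ν) N ≤ μ B + q := by
  rw [Measure.prod_apply hN]
  exact lintegral_le_add_of_le_on_compl (fun a => prob_le_one) h

lemma prod_measure_le_add_symm [IsProbabilityMeasure μ] [IsProbabilityMeasure ν] {N : Set (α × β)}
    (hN : MeasurableSet N) {B : Set β} {q : ℝ≥0∞} (h : ∀ b ∉ B, μ {a | (a, b) ∈ N} ≤ q) :
    (μ.prod ν) N ≤ ν B + q := by
  rw [Measure.prod_apply_symm hN]
  exact lintegral_le_add_of_le_on_compl (fun a => prob_le_one) h

end Product

/-! ### Growth of the linear iteration from a Gaussian starting point -/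

section Gaussian

variable {d : ℕ}

lemma norm_innerBilin (z : Vec d) : ‖innerBilin d z‖ = ‖z‖ := by
  have : innerBilin d z = InnerProductSpace.toDual ℝ (Vec d) z := by ext w; simp
  rw [this, LinearIsometryEquiv.norm_map]

lemma map_inner_stdGaussian (z : Vec d) (hz : ‖z‖ = 1) :
    (stdGaussian (Vec d)).map (fun g => (inner ℝ z g : ℝ)) = gaussianReal 0 1 := by
  have h := IsGaussian.map_eq_gaussianReal (μ := stdGaussian (Vec d)) (innerBilin d z)
  rw [integral_strongDual_stdGaussian, variance_dual_stdGaussian, norm_innerBilin, hz] at h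
  rw [one_pow, Real.toNNReal_one] at h
  exact h

lemma gaussianReal_abs_le (a : ℝ) :
    gaussianReal 0 1 {x | |x| ≤ a} ≤ ENNReal.ofReal a := by
  rw [gaussianReal_apply _ one_ne_zero]
  have hb : ∀ x, gaussianPDF 0 1 x ≤ ENNReal.ofReal (1 / 2) := by
    intro x
    refine ENNReal.ofReal_le_ofReal ?_
    rw [gaussianPDFReal_def]
    simp only [NNReal.coe_one, mul_one, sub_zero]
    have h1 : Real.exp (-x ^ 2 / 2) ≤ 1 := Real.exp_le_one_iff.2 (by nlinarith [sq_nonneg x])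
    have h2 : (2 : ℝ) ≤ Real.sqrt (2 * Real.pi) :=
      Real.le_sqrt_of_sq_le (by nlinarith [Real.pi_gt_three])
    have h3 : (Real.sqrt (2 * Real.pi))⁻¹ ≤ 1 / 2 := by
      rw [inv_eq_one_div]; exact one_div_le_one_div_of_le (by norm_num) h2
    calc _ ≤ (1 / 2 : ℝ) * 1 := mul_le_mul h3 h1 (Real.exp_nonneg _) (by norm_num)
      _ = 1 / 2 := by norm_num
  calc _ ≤ ∫⁻ x in {x : ℝ | |x| ≤ a}, ENNReal.ofReal (1 / 2) := lintegral_mono fun x => hb x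
    _ = ENNReal.ofReal (1 / 2) * volume (Set.Icc (-a) a) := by
        rw [setLIntegral_const]
        congr 2
        ext x; simp [abs_le]
    _ = ENNReal.ofReal a := by
        rw [Real.volume_Icc, ← ENNReal.ofReal_mul (by norm_num)]
        congr 1; ring

/-- A Gaussian vector is not nearly orthogonal to a given vector. -/
lemma stdGaussian_abs_inner_le (z : Vec d) (hz : z ≠ 0) (a : ℝ) :
    stdGaussian (Vec d) {g | |(inner ℝ z g : ℝ)| ≤ a * ‖z‖} ≤ ENNReal.ofReal a := by
  have hz' : 0 < ‖z‖ := norm_pos_iff.2 hz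
  have h1 : ‖‖z‖⁻¹ • z‖ = 1 := by
    rw [norm_smul, norm_inv, norm_norm, inv_mul_cancel₀ hz'.ne']
  have hm : Measurable fun g : Vec d => (inner ℝ (‖z‖⁻¹ • z) g : ℝ) := by fun_prop
  have hs : MeasurableSet {x : ℝ | |x| ≤ a} := measurableSet_le (by fun_prop) (by fun_prop)
  have h2 := gaussianReal_abs_le a
  rw [← map_inner_stdGaussian _ h1, Measure.map_apply hm hs] at h2
  convert h2 using 2
  ext g
  simp only [Set.mem_ofPred_eq, Set.mem_preimage, inner_smul_left, abs_mul]
  simp only [map_inv₀, conj_trivial, abs_inv, abs_norm]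
  rw [inv_mul_le_iff₀ hz', mul_comm]

lemma integral_norm_sq_stdGaussian :
    Integrable (fun g : Vec d => ‖g‖ ^ 2) (stdGaussian (Vec d)) ∧
      ∫ g, ‖g‖ ^ 2 ∂(stdGaussian (Vec d)) = d := by
  have hn : ∀ g : Vec d, ‖g‖ ^ 2 =
      ∑ i, (innerBilin d (EuclideanSpace.basisFun (Fin d) ℝ i) g) ^ 2 := by
    intro g
    rw [← (EuclideanSpace.basisFun (Fin d) ℝ).sum_sq_inner_right g]
    rfl
  have hi : ∀ i : Fin d, Integrable
      (fun g => (innerBilin d (EuclideanSpace.basisFun (Fin d) ℝ i) g) ^ 2)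
      (stdGaussian (Vec d)) := fun i =>
    (IsGaussian.memLp_dual (stdGaussian (Vec d)) _ 2 (by simp)).integrable_sq
  simp only [hn]
  refine ⟨integrable_finsetSum _ fun i _ => hi i, ?_⟩
  rw [integral_finsetSum _ fun i _ => hi i]
  have h1 : ∀ i : Fin d, ∫ g, (innerBilin d (EuclideanSpace.basisFun (Fin d) ℝ i) g) ^ 2
      ∂(stdGaussian (Vec d)) = 1 := by
    intro i
    have h := variance_dual_stdGaussian (innerBilin d (EuclideanSpace.basisFun (Fin d) ℝ i))
    rw [variance_of_integral_eq_zero (ContinuousLinearMap.continuous _).aemeasurable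
      (integral_strongDual_stdGaussian _), norm_innerBilin] at h
    simpa using h
  rw [Finset.sum_congr rfl fun i _ => h1 i]
  simp

lemma stdGaussian_norm_sq_ge (hd : 1 ≤ d) :
    stdGaussian (Vec d) {g | 20 * (d : ℝ) ≤ ‖g‖ ^ 2} ≤ ENNReal.ofReal (1 / 20) := by
  obtain ⟨hi, he⟩ := integral_norm_sq_stdGaussian (d := d)
  have h := mul_meas_ge_le_integral_of_nonneg (μ := stdGaussian (Vec d))
    (Filter.Eventually.of_forall fun g => sq_nonneg ‖g‖) hi (20 * (d : ℝ))
  rw [he] at h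
  have hd' : (1 : ℝ) ≤ d := by exact_mod_cast hd
  have hreal : (stdGaussian (Vec d)).real {g | 20 * (d : ℝ) ≤ ‖g‖ ^ 2} ≤ 1 / 20 := by
    nlinarith
  rw [← ENNReal.ofReal_toReal (measure_ne_top (stdGaussian (Vec d)) _)]
  exact ENNReal.ofReal_le_ofReal hreal

variable {Ξ : Type*} [MeasurableSpace Ξ] {D : Measure Ξ} [IsProbabilityMeasure D]
  {A : Ξ → Vec d →L[ℝ] Vec d} {H : Vec d →L[ℝ] Vec d} {L : ℝ}

/-- From a Gaussian starting point the linear iteration grows, with high probability, almost as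
fast as the mean operator allows, up to a factor of order `√d`. -/
lemma measure_slow_growth_le (hd : 1 ≤ d) (hA : RandomOperator D A H L) {α l : ℝ} (hα : 0 ≤ α)
    (hL : 0 ≤ L) (hl : 0 ≤ l) {u : Vec d} (hHs : ∀ v w, inner ℝ (H v) w = inner ℝ v (H w))
    (hu : H u = (-l) • u) (hu1 : ‖u‖ = 1) (hH : ∀ v, -l * ‖v‖ ^ 2 ≤ inner ℝ v (H v)) (n : ℕ)
    (hn : α ^ 2 * L ^ 2 * n ≤ 1 / 200) :
    ((stdGaussian (Vec d)).prod (Measure.infinitePi fun _ : ℕ => D))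
      {p | ‖p.1‖ = 0 ∨ ‖iter (fun ξ w => A ξ w) α p.2 p.1 n‖ <
        (1 + α * l) ^ n * ‖p.1‖ / (200 * Real.sqrt d)} ≤ ENNReal.ofReal (1 / 8) := by
  have hcheb := measure_inner_transposedIter_le hA hα hL hl hHs hu hu1 hH n hn
  have hd' : (1 : ℝ) ≤ d := by exact_mod_cast hd
  have hit := measurable_iter hA.measurable_uncurry α n
  have hmeas : MeasurableSet {p : Vec d × (ℕ → Ξ) | ‖p.1‖ = 0 ∨
      ‖iter (fun ξ w => A ξ w) α p.2 p.1 n‖ <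
        (1 + α * l) ^ n * ‖p.1‖ / (200 * Real.sqrt d)} :=
    (measurableSet_eq_fun (by fun_prop) (by fun_prop)).union
      (measurableSet_lt hit.norm (by fun_prop))
  refine (prod_measure_le_add_symm hmeas (q := ENNReal.ofReal (1 / 20) + ENNReal.ofReal (1 / 20))
    (B := {ξ | (inner ℝ u (transposedIter A α ξ n u) : ℝ) ≤ (1 + α * l) ^ n / 2}) ?_).trans ?_
  · intro ξ hξ
    set z := transposedIter A α ξ n u with hz
    have hμ : 0 < (1 + α * l) ^ n := by positivity
    have hξ' : (1 + α * l) ^ n / 2 < inner ℝ u z := not_le.1 hξ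
    have hzn : (1 + α * l) ^ n / 2 < ‖z‖ := by
      have := (le_abs_self _).trans (abs_real_inner_le_norm u z)
      rw [hu1, one_mul] at this
      linarith
    have hz0 : z ≠ 0 := norm_pos_iff.1 (by linarith)
    refine (measure_mono ?_).trans ((measure_union_le _ _).trans
      (add_le_add (stdGaussian_abs_inner_le z hz0 (1 / 20))
        (stdGaussian_norm_sq_ge hd)))
    intro g hg
    by_contra hcon
    simp only [Set.mem_union, Set.mem_ofPred_eq, not_or, not_le] at hcon
    obtain ⟨h1, h2⟩ := hcon
    have h3 : |(inner ℝ z g : ℝ)| ≤ ‖iter (fun ξ w => A ξ w) α ξ g n‖ := by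
      rw [hz, ← inner_iter_eq hA α ξ g n u]
      have := abs_real_inner_le_norm u (iter (fun ξ w => A ξ w) α ξ g n)
      rwa [hu1, one_mul] at this
    have hsd : 0 < Real.sqrt d := Real.sqrt_pos.2 (by linarith)
    have hg5 : ‖g‖ ≤ 5 * Real.sqrt d := by
      refine abs_le_of_sq_le_sq' ?_ (by positivity) |>.2
      rw [mul_pow, Real.sq_sqrt (by linarith)]
      nlinarith
    rcases hg with hg | hg
    · have : g = 0 := norm_eq_zero.1 hg
      rw [this, inner_zero_right, abs_zero] at h1
      nlinarith [norm_nonneg z]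
    · rw [lt_div_iff₀ (by positivity)] at hg
      have h4 : (1 + α * l) ^ n / 40 < ‖iter (fun ξ w => A ξ w) α ξ g n‖ := by
        linarith
      have h5 := mul_le_mul_of_nonneg_left hg5 hμ.le
      have h6 := mul_lt_mul_of_pos_right h4 hsd
      dsimp only at hg
      nlinarith
  · refine (add_le_add hcheb le_rfl).trans (le_of_eq ?_)
    rw [← ENNReal.ofReal_add (by norm_num) (by norm_num),
      ← ENNReal.ofReal_add (by norm_num) (by norm_num)]
    norm_num

end Gaussian

/-! ### The martingale of Rayleigh quotients -/

section Martingale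

variable {d : ℕ} {Ξ : Type*} [MeasurableSpace Ξ] {D : Measure Ξ}
  {A : Ξ → Vec d →L[ℝ] Vec d} {H : Vec d →L[ℝ] Vec d} {L : ℝ}

/-- The deviation of the sampled from the exact quadratic form. -/
def formNoise (A : Ξ → Vec d →L[ℝ] Vec d) (H : Vec d →L[ℝ] Vec d) (s : Ξ) (v : Vec d) : ℝ :=
  inner ℝ (A s v) v - inner ℝ (H v) v

lemma measurable_formNoise (hA : RandomOperator D A H L) {Ω : Type*} [MeasurableSpace Ω]
    {f : Ω → Ξ} {g : Ω → Vec d} (hf : Measurable f) (hg : Measurable g) :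
    Measurable fun ω => formNoise A H (f ω) (g ω) := by
  have h : Measurable fun ω => A (f ω) (g ω) := hA.measurable_uncurry.comp (hf.prodMk hg)
  exact (h.inner hg).sub ((H.measurable.comp hg).inner hg)

variable [IsProbabilityMeasure D]

lemma abs_formNoise_le (hA : RandomOperator D A H L) (hL : 0 ≤ L) (s : Ξ) {v : Vec d}
    (hv : ‖v‖ ≤ 1) : |formNoise A H s v| ≤ 2 * L := by
  have h1 := hA.abs_inner_le s v v
  have h2 := hA.abs_mean_le v v
  have h3 : L * ‖v‖ * ‖v‖ ≤ L := by
    have : ‖v‖ * ‖v‖ ≤ 1 := by nlinarith [norm_nonneg v]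
    nlinarith
  have := abs_sub (inner ℝ (A s v) v : ℝ) (inner ℝ (H v) v)
  unfold formNoise
  linarith

lemma integral_formNoise (hA : RandomOperator D A H L) (v : Vec d) :
    ∫ s, formNoise A H s v ∂D = 0 := by
  unfold formNoise
  rw [integral_sub (hA.integrable_inner v v) (integrable_const _), hA.mean]
  simp

lemma integral_formNoise_sq_le (hA : RandomOperator D A H L) (hL : 0 ≤ L) {v : Vec d}
    (hv : ‖v‖ ≤ 1) : ∫ s, formNoise A H s v ^ 2 ∂D ≤ L ^ 2 := by
  have hi := hA.integrable_inner v v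
  have hb : ∀ s, (inner ℝ (A s v) v : ℝ) ^ 2 ≤ L ^ 2 := by
    intro s
    have h1 := hA.abs_inner_le s v v
    have h3 : L * ‖v‖ * ‖v‖ ≤ L := by
      have : ‖v‖ * ‖v‖ ≤ 1 := by nlinarith [norm_nonneg v]
      nlinarith
    exact sq_le_sq' (by have := (abs_le.1 h1).1; linarith) ((abs_le.1 h1).2.trans h3)
  have hi2 : Integrable (fun s => (inner ℝ (A s v) v : ℝ) ^ 2) D :=
    Integrable.of_bound (((hA.meas v).inner_const).pow_const 2).aestronglyMeasurable (L ^ 2)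
      (Filter.Eventually.of_forall fun s => by
        rw [Real.norm_of_nonneg (sq_nonneg _)]; exact hb s)
  have e : ∀ s, formNoise A H s v ^ 2 = (inner ℝ (A s v) v : ℝ) ^ 2
      - 2 * inner ℝ (H v) v * inner ℝ (A s v) v + (inner ℝ (H v) v : ℝ) ^ 2 := by
    intro s; unfold formNoise; ring
  simp only [e]
  have hi3 : Integrable (fun s => (inner ℝ (A s v) v : ℝ) ^ 2
      - 2 * inner ℝ (H v) v * inner ℝ (A s v) v) D := hi2.sub (hi.const_mul _)
  rw [integral_add hi3 (integrable_const _), integral_sub hi2 (hi.const_mul _),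
    integral_const_mul, hA.mean]
  have h4 : ∫ s, (inner ℝ (A s v) v : ℝ) ^ 2 ∂D ≤ L ^ 2 := by
    simpa using integral_mono hi2 (integrable_const (L ^ 2)) hb
  simp
  nlinarith [sq_nonneg (inner ℝ (H v) v : ℝ)]

/-- A sequence of vectors of the unit ball, the `t`-th of which depends only on the first `t`
samples. -/
structure IsPredictable (v : ℕ → (ℕ → Ξ) → Vec d) : Prop where
  meas : ∀ t, Measurable (v t)
  norm_le : ∀ t ξ, ‖v t ξ‖ ≤ 1
  congr : ∀ t ξ ξ', (∀ i < t, ξ i = ξ' i) → v t ξ = v t ξ'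

/-- The sum of the noise along a predictable sequence. -/
def noiseSum (A : Ξ → Vec d →L[ℝ] Vec d) (H : Vec d →L[ℝ] Vec d) (v : ℕ → (ℕ → Ξ) → Vec d)
    (n : ℕ) (ξ : ℕ → Ξ) : ℝ :=
  ∑ t ∈ Finset.range n, formNoise A H (ξ t) (v t ξ)

lemma measurable_noiseSum (hA : RandomOperator D A H L) {v : ℕ → (ℕ → Ξ) → Vec d}
    (hv : ∀ t, Measurable (v t)) (n : ℕ) :
    Measurable fun ξ => noiseSum A H v n ξ := by
  unfold noiseSum
  refine Finset.measurable_sum _ fun t _ => ?_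
  exact measurable_formNoise hA (measurable_pi_apply t) (hv t)

lemma abs_noiseSum_le (hA : RandomOperator D A H L) (hL : 0 ≤ L) {v : ℕ → (ℕ → Ξ) → Vec d}
    (hv : IsPredictable v) (n : ℕ) (ξ : ℕ → Ξ) : |noiseSum A H v n ξ| ≤ n * (2 * L) := by
  unfold noiseSum
  refine (Finset.abs_sum_le_sum_abs _ _).trans ((Finset.sum_le_sum fun t _ =>
    abs_formNoise_le hA hL (ξ t) (hv.norm_le t ξ)).trans ?_)
  simp

lemma noiseSum_succ_update {v : ℕ → (ℕ → Ξ) → Vec d} (hv : IsPredictable v) (n : ℕ)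
    (ξ : ℕ → Ξ) (s : Ξ) : noiseSum A H v (n + 1) (Function.update ξ n s) =
      noiseSum A H v n ξ + formNoise A H s (v n ξ) := by
  unfold noiseSum
  rw [Finset.sum_range_succ, Function.update_self]
  have e : ∀ t ≤ n, v t (Function.update ξ n s) = v t ξ := fun t ht =>
    hv.congr t _ _ fun i hi => Function.update_of_ne (by omega) _ _
  rw [e n le_rfl]
  congr 1
  refine Finset.sum_congr rfl fun t ht => ?_
  have ht' := Finset.mem_range.1 ht
  rw [e t ht'.le, Function.update_of_ne ht'.ne]

/-- Along a predictable sequence the noise terms are orthogonal. -/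
lemma integral_noiseSum_sq_le (hA : RandomOperator D A H L) (hL : 0 ≤ L)
    {v : ℕ → (ℕ → Ξ) → Vec d} (hv : IsPredictable v) (n : ℕ) :
    ∫ ξ, noiseSum A H v n ξ ^ 2 ∂(Measure.infinitePi fun _ : ℕ => D) ≤ n * L ^ 2 := by
  have hint : ∀ n, Integrable (fun ξ => noiseSum A H v n ξ ^ 2)
      (Measure.infinitePi fun _ : ℕ => D) := by
    intro n
    refine Integrable.of_bound
      ((measurable_noiseSum hA hv.meas n).pow_const 2).aestronglyMeasurable
      ((n * (2 * L)) ^ 2) (Filter.Eventually.of_forall fun ξ => ?_)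
    rw [Real.norm_of_nonneg (sq_nonneg _)]
    exact sq_le_sq.2 ((abs_noiseSum_le hA hL hv n ξ).trans (le_abs_self _))
  induction n with
  | zero => simp [noiseSum]
  | succ n ih =>
    rw [integral_resample ((measurable_noiseSum hA hv.meas (n + 1)).pow_const 2) (hint (n + 1)) n]
    simp only [noiseSum_succ_update hv]
    have hstep : ∀ ξ, ∫ s, (noiseSum A H v n ξ + formNoise A H s (v n ξ)) ^ 2 ∂D ≤
        noiseSum A H v n ξ ^ 2 + L ^ 2 := by
      intro ξ
      have hm : Measurable fun s => formNoise A H s (v n ξ) :=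
        measurable_formNoise hA measurable_id measurable_const
      have h1 : Integrable (fun s => formNoise A H s (v n ξ)) D :=
        Integrable.of_bound hm.aestronglyMeasurable (2 * L)
          (Filter.Eventually.of_forall fun s => abs_formNoise_le hA hL s (hv.norm_le n ξ))
      have h2 : Integrable (fun s => formNoise A H s (v n ξ) ^ 2) D :=
        Integrable.of_bound (hm.pow_const 2).aestronglyMeasurable ((2 * L) ^ 2)
          (Filter.Eventually.of_forall fun s => by
            rw [Real.norm_of_nonneg (sq_nonneg _)]
            exact sq_le_sq.2 ((abs_formNoise_le hA hL s (hv.norm_le n ξ)).trans (le_abs_self _)))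
      have e : ∀ s, (noiseSum A H v n ξ + formNoise A H s (v n ξ)) ^ 2 =
          formNoise A H s (v n ξ) ^ 2 + 2 * noiseSum A H v n ξ * formNoise A H s (v n ξ) +
            noiseSum A H v n ξ ^ 2 := fun s => by ring
      simp only [e]
      have h3 : Integrable (fun s => formNoise A H s (v n ξ) ^ 2 +
          2 * noiseSum A H v n ξ * formNoise A H s (v n ξ)) D := h2.add (h1.const_mul _)
      rw [integral_add h3 (integrable_const _), integral_add h2 (h1.const_mul _),
        integral_const_mul, integral_formNoise hA]
      have := integral_formNoise_sq_le hA hL (hv.norm_le n ξ)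
      simp
      linarith
    refine (integral_mono_of_nonneg (Filter.Eventually.of_forall fun ξ =>
      integral_nonneg fun _ => sq_nonneg _) ((hint n).add (integrable_const (L ^ 2)))
      (Filter.Eventually.of_forall hstep)).trans ?_
    have := integral_add (hint n) (integrable_const (μ := Measure.infinitePi fun _ : ℕ => D) (L ^ 2))
    simp only [Pi.add_apply]
    rw [this]
    push_cast
    simp
    linarith

lemma measure_noiseSum_ge (hA : RandomOperator D A H L) (hL : 0 ≤ L)
    {v : ℕ → (ℕ → Ξ) → Vec d} (hv : IsPredictable v) (n : ℕ) {θ : ℝ} (hθ : 0 < θ)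
    (hn : 100 * (n * L ^ 2) ≤ θ ^ 2) :
    (Measure.infinitePi fun _ : ℕ => D) {ξ | θ ≤ |noiseSum A H v n ξ|} ≤
      ENNReal.ofReal (1 / 100) := by
  set ν := Measure.infinitePi fun _ : ℕ => D
  have hi : Integrable (fun ξ => noiseSum A H v n ξ ^ 2) ν := by
    refine Integrable.of_bound
      ((measurable_noiseSum hA hv.meas n).pow_const 2).aestronglyMeasurable
      ((n * (2 * L)) ^ 2) (Filter.Eventually.of_forall fun ξ => ?_)
    rw [Real.norm_of_nonneg (sq_nonneg _)]
    exact sq_le_sq.2 ((abs_noiseSum_le hA hL hv n ξ).trans (le_abs_self _))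
  have h := (mul_meas_ge_le_integral_of_nonneg (μ := ν)
    (Filter.Eventually.of_forall fun ξ => sq_nonneg (noiseSum A H v n ξ)) hi (θ ^ 2)).trans
    (integral_noiseSum_sq_le hA hL hv n)
  have hθ2 : 0 < θ ^ 2 := by positivity
  have hreal : ν.real {ξ | θ ^ 2 ≤ noiseSum A H v n ξ ^ 2} ≤ 1 / 100 := by
    nlinarith
  have hsub : {ξ | θ ≤ |noiseSum A H v n ξ|} ⊆ {ξ | θ ^ 2 ≤ noiseSum A H v n ξ ^ 2} := by
    intro ξ (hξ : θ ≤ _)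
    show θ ^ 2 ≤ noiseSum A H v n ξ ^ 2
    rw [← sq_abs (noiseSum A H v n ξ)]
    exact pow_le_pow_left₀ hθ.le hξ 2
  refine (measure_mono hsub).trans ?_
  rw [← ENNReal.ofReal_toReal (measure_ne_top ν _)]
  exact ENNReal.ofReal_le_ofReal hreal

end Martingale

/-! ### Pathwise estimates for the iteration -/

section Pathwise

variable {d : ℕ}

lemma norm_normalize {w : Vec d} (hw : w ≠ 0) : ‖normalize w‖ = 1 := by
  unfold normalize
  rw [norm_smul, norm_inv, norm_norm, inv_mul_cancel₀ (norm_ne_zero_iff.2 hw)]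

@[simp] lemma normalize_zero : normalize (0 : Vec d) = 0 := by simp [normalize]

lemma norm_normalize_le (w : Vec d) : ‖normalize w‖ ≤ 1 := by
  by_cases h : w = 0
  · simp [h]
  · exact (norm_normalize h).le

lemma norm_smul_normalize (w : Vec d) : ‖w‖ • normalize w = w := by
  by_cases h : w = 0
  · simp [h]
  · unfold normalize
    rw [smul_smul, mul_inv_cancel₀ (norm_ne_zero_iff.2 h), one_smul]

lemma measurable_normalize : Measurable (normalize : Vec d → Vec d) := by
  unfold normalize
  fun_prop

variable {Ξ : Type*} {A : Ξ → Vec d →L[ℝ] Vec d} {H : Vec d →L[ℝ] Vec d}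

lemma iter_smul (α : ℝ) (ξ : ℕ → Ξ) (c : ℝ) (g : Vec d) (n : ℕ) :
    iter (fun ξ w => A ξ w) α ξ (c • g) n = c • iter (fun ξ w => A ξ w) α ξ g n := by
  induction n with
  | zero => rfl
  | succ n ih =>
    simp only [iter]
    rw [ih, map_smul, smul_sub, smul_comm α c]

variable [MeasurableSpace Ξ] {Γ : Ξ → Vec d → Vec d} {L κ r : ℝ}

lemma iter_ne_zero (hΓ : IsNearLinear A Γ L κ r) {α : ℝ} (hα : 0 ≤ α) (hαL : α * L < 1)
    (ξ : ℕ → Ξ) {w₀ : Vec d} (hw : w₀ ≠ 0) (n : ℕ) : iter Γ α ξ w₀ n ≠ 0 := by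
  induction n with
  | zero => exact hw
  | succ n ih =>
    simp only [iter]
    set w := iter Γ α ξ w₀ n
    have h1 : ‖α • Γ (ξ n) w‖ ≤ α * L * ‖w‖ := by
      rw [norm_smul, Real.norm_of_nonneg hα, mul_assoc]
      exact mul_le_mul_of_nonneg_left (hΓ.norm_le _ _) hα
    have h2 := norm_sub_norm_le w (α • Γ (ξ n) w)
    have h3 : 0 < ‖w‖ := norm_pos_iff.2 ih
    exact norm_pos_iff.1 (by nlinarith)

/-- One step decreases the logarithm of the norm by at least `α` times the sampled Rayleigh
quotient, up to errors of second order and the nonlinearity. -/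
lemma log_norm_step_le (hΓ : IsNearLinear A Γ L κ r) {α : ℝ} (hα : 0 < α) (hαL : α * L < 1)
    (s : Ξ) {w : Vec d} (hw : w ≠ 0) (hr : ‖w‖ ≤ r) :
    α * inner ℝ (A s (normalize w)) (normalize w) ≤
      Real.log ‖w‖ - Real.log ‖w - α • Γ s w‖ + α ^ 2 * L ^ 2 / 2 + α * κ := by
  have hw' : 0 < ‖w‖ := norm_pos_iff.2 hw
  have hw2 : 0 < ‖w - α • Γ s w‖ :=
    norm_pos_iff.2 (iter_ne_zero hΓ hα.le hαL (fun _ => s) hw 1)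
  have h1 : ‖w - α • Γ s w‖ ^ 2 =
      ‖w‖ ^ 2 - 2 * α * inner ℝ w (Γ s w) + α ^ 2 * ‖Γ s w‖ ^ 2 := by
    rw [norm_sub_sq_real, inner_smul_right, norm_smul, Real.norm_of_nonneg hα.le]; ring
  have h2 : ‖Γ s w‖ ^ 2 ≤ L ^ 2 * ‖w‖ ^ 2 := by
    rw [← mul_pow]; exact pow_le_pow_left₀ (norm_nonneg _) (hΓ.norm_le s w) 2
  have h3 : inner ℝ w (A s w) - κ * ‖w‖ ^ 2 ≤ inner ℝ w (Γ s w) := by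
    have e : (inner ℝ w (Γ s w) : ℝ) = inner ℝ w (A s w) + inner ℝ w (Γ s w - A s w) := by
      rw [inner_sub_right]; ring
    have h4 := (abs_le.1 (abs_real_inner_le_norm w (Γ s w - A s w))).1
    have h5 := mul_le_mul_of_nonneg_left (hΓ.close s w hr) hw'.le
    rw [e]; nlinarith
  have h4 : (inner ℝ w (A s w) : ℝ) =
      ‖w‖ ^ 2 * inner ℝ (A s (normalize w)) (normalize w) := by
    conv_lhs => rw [← norm_smul_normalize w]
    rw [map_smul, inner_smul_left, inner_smul_right, real_inner_comm]
    simp; ring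
  set p : ℝ := inner ℝ (A s (normalize w)) (normalize w)
  have h5 : ‖w - α • Γ s w‖ ^ 2 / ‖w‖ ^ 2 - 1 ≤ -2 * α * p + 2 * α * κ + α ^ 2 * L ^ 2 := by
    rw [div_sub_one (by positivity), div_le_iff₀ (by positivity), h1]
    rw [h4] at h3
    nlinarith [mul_le_mul_of_nonneg_left h3 hα.le, mul_le_mul_of_nonneg_left h2 (sq_nonneg α)]
  have h6 := Real.log_le_sub_one_of_pos (show 0 < ‖w - α • Γ s w‖ ^ 2 / ‖w‖ ^ 2 by positivity)
  rw [Real.log_div (by positivity) (by positivity), Real.log_pow, Real.log_pow] at h6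
  push_cast at h6
  linarith

/-- The Rayleigh quotients along the path telescope to the growth of the logarithm of the norm, up
to errors of second order, the nonlinearity and the martingale noise. -/
lemma sum_form_le (hΓ : IsNearLinear A Γ L κ r) {α : ℝ} (hα : 0 < α) (hαL : α * L < 1)
    (ξ : ℕ → Ξ) {w₀ : Vec d} (hw : w₀ ≠ 0) (n : ℕ) (hr : ∀ t < n, ‖iter Γ α ξ w₀ t‖ ≤ r) :
    ∑ t ∈ Finset.range n, (inner ℝ (H (normalize (iter Γ α ξ w₀ t)))
        (normalize (iter Γ α ξ w₀ t)) : ℝ) ≤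
      (Real.log ‖w₀‖ - Real.log ‖iter Γ α ξ w₀ n‖) / α + n * (α * L ^ 2 / 2 + κ) +
        |∑ t ∈ Finset.range n, formNoise A H (ξ t) (normalize (iter Γ α ξ w₀ t))| := by
  have h1 : ∑ t ∈ Finset.range n, α * (inner ℝ (A (ξ t) (normalize (iter Γ α ξ w₀ t)))
      (normalize (iter Γ α ξ w₀ t)) : ℝ) ≤
      Real.log ‖w₀‖ - Real.log ‖iter Γ α ξ w₀ n‖ + n * (α ^ 2 * L ^ 2 / 2 + α * κ) := by
    have hs : ∑ t ∈ Finset.range n, ((Real.log ‖iter Γ α ξ w₀ t‖ -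
        Real.log ‖iter Γ α ξ w₀ (t + 1)‖) + (α ^ 2 * L ^ 2 / 2 + α * κ)) =
        Real.log ‖w₀‖ - Real.log ‖iter Γ α ξ w₀ n‖ + n * (α ^ 2 * L ^ 2 / 2 + α * κ) := by
      rw [Finset.sum_add_distrib,
        Finset.sum_range_sub' (fun t => Real.log ‖iter Γ α ξ w₀ t‖)]
      simp [iter]
      ring
    rw [← hs]
    refine Finset.sum_le_sum fun t ht => ?_
    have := log_norm_step_le hΓ hα hαL (ξ t) (iter_ne_zero hΓ hα.le hαL ξ hw t)
      (hr t (Finset.mem_range.1 ht))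
    simp only [iter]
    linarith
  rw [← Finset.mul_sum] at h1
  have h2 : ∑ t ∈ Finset.range n, (inner ℝ (A (ξ t) (normalize (iter Γ α ξ w₀ t)))
      (normalize (iter Γ α ξ w₀ t)) : ℝ) ≤
      (Real.log ‖w₀‖ - Real.log ‖iter Γ α ξ w₀ n‖) / α + n * (α * L ^ 2 / 2 + κ) := by
    have e : (Real.log ‖w₀‖ - Real.log ‖iter Γ α ξ w₀ n‖) / α + n * (α * L ^ 2 / 2 + κ) =
      (Real.log ‖w₀‖ - Real.log ‖iter Γ α ξ w₀ n‖ + n * (α ^ 2 * L ^ 2 / 2 + α * κ)) / α := by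
      field_simp
    rw [e, le_div_iff₀ hα]
    linarith
  have h3 : ∑ t ∈ Finset.range n, formNoise A H (ξ t) (normalize (iter Γ α ξ w₀ t)) =
      ∑ t ∈ Finset.range n, (inner ℝ (A (ξ t) (normalize (iter Γ α ξ w₀ t)))
        (normalize (iter Γ α ξ w₀ t)) : ℝ) -
      ∑ t ∈ Finset.range n, (inner ℝ (H (normalize (iter Γ α ξ w₀ t)))
        (normalize (iter Γ α ξ w₀ t)) : ℝ) := by
    rw [← Finset.sum_sub_distrib]; rfl
  have h4 := neg_abs_le (∑ t ∈ Finset.range n, formNoise A H (ξ t)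
    (normalize (iter Γ α ξ w₀ t)))
  linarith

/-- As long as it stays in the ball, the nonlinear iteration stays close to the linear one. -/
lemma norm_iter_sub_linear_le (hΓ : IsNearLinear A Γ L κ r) (hA : ∀ ξ, ‖A ξ‖ ≤ L) {α : ℝ}
    (hα : 0 ≤ α) (hL : 0 ≤ L) (hκ : 0 ≤ κ) (h0 : 0 ≤ r) (ξ : ℕ → Ξ) (w₀ : Vec d) (n : ℕ)
    (hr : ∀ t < n, ‖iter Γ α ξ w₀ t‖ ≤ r) :
    ‖iter Γ α ξ w₀ n - iter (fun ξ w => A ξ w) α ξ w₀ n‖ ≤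
      α * κ * r * (n * (1 + α * L) ^ n) := by
  induction n with
  | zero => simp [iter]
  | succ n ih =>
    have ih := ih fun t ht => hr t (by omega)
    simp only [iter]
    set w := iter Γ α ξ w₀ n
    set z := iter (fun ξ w => A ξ w) α ξ w₀ n
    have e : w - α • Γ (ξ n) w - (z - α • A (ξ n) z) =
        (w - z) - α • A (ξ n) (w - z) - α • (Γ (ξ n) w - A (ξ n) w) := by
      rw [map_sub]; module
    have hw : ‖w‖ ≤ r := hr n (by omega)
    have h1 : ‖α • A (ξ n) (w - z)‖ ≤ α * L * ‖w - z‖ := by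
      rw [norm_smul, Real.norm_of_nonneg hα, mul_assoc]
      exact mul_le_mul_of_nonneg_left ((A (ξ n)).le_of_opNorm_le (hA _) _) hα
    have h2 : ‖α • (Γ (ξ n) w - A (ξ n) w)‖ ≤ α * κ * r := by
      rw [norm_smul, Real.norm_of_nonneg hα, mul_assoc]
      exact mul_le_mul_of_nonneg_left ((hΓ.close _ _ hw).trans
        (mul_le_mul_of_nonneg_left hw hκ)) hα
    rw [e]
    have hαL : 0 ≤ α * L := by positivity
    have hp : 1 ≤ (1 + α * L) ^ (n + 1) := one_le_pow₀ (by linarith)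
    calc _ ≤ ‖w - z‖ + ‖α • A (ξ n) (w - z)‖ + ‖α • (Γ (ξ n) w - A (ξ n) w)‖ :=
          (norm_sub_le _ _).trans (add_le_add (norm_sub_le _ _) le_rfl)
      _ ≤ (1 + α * L) * ‖w - z‖ + α * κ * r := by linarith
      _ ≤ (1 + α * L) * (α * κ * r * (n * (1 + α * L) ^ n)) + α * κ * r * (1 + α * L) ^ (n + 1) := by
          have h3 : 0 ≤ α * κ * r := by positivity
          exact add_le_add (mul_le_mul_of_nonneg_left ih (by linarith))
            (le_mul_of_one_le_right h3 hp)
      _ = _ := by push_cast; ring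

end Pathwise

/-! ### Uniform choice of an iterate -/

section UniformIndex

lemma card_filter_lt_le {n : ℕ} {p : ℕ → ℝ} {l : ℝ} (hl : 0 < l) (hp : ∀ t < n, -l ≤ p t)
    (hs : ∑ t ∈ Finset.range n, p t ≤ -(49 / 50) * l * n) :
    (((Finset.range n).filter fun t => -(9 / 10) * l < p t).card : ℝ) ≤ n / 5 := by
  have h1 : ∑ t ∈ (Finset.range n).filter (fun t => -(9 / 10) * l < p t), l / 10 ≤
      ∑ t ∈ Finset.range n, (p t + l) := by
    refine (Finset.sum_le_sum fun t ht => ?_).trans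
      (Finset.sum_le_sum_of_subset_of_nonneg (Finset.filter_subset _ _) fun t ht _ => ?_)
    · have := (Finset.mem_filter.1 ht).2
      linarith
    · have := hp t (Finset.mem_range.1 ht)
      linarith
  rw [Finset.sum_const, nsmul_eq_mul, Finset.sum_add_distrib] at h1
  simp only [Finset.sum_const, Finset.card_range, nsmul_eq_mul] at h1
  have h2 : l * (((Finset.range n).filter fun t => -(9 / 10) * l < p t).card : ℝ) ≤ l * (n / 5) := by
    linarith
  exact le_of_mul_le_mul_left h2 hl

lemma volume_floor_mem_le {n : ℕ} (hn : 0 < n) (S : Finset ℕ) :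
    (volume : Measure unitInterval) {u | ⌊(u : ℝ) * n⌋₊ ∈ S ∨ n ≤ ⌊(u : ℝ) * n⌋₊} ≤
      ENNReal.ofReal (S.card / n) := by
  have hn' : (0 : ℝ) < n := by exact_mod_cast hn
  have e : (volume : Measure unitInterval) {u | ⌊(u : ℝ) * n⌋₊ ∈ S ∨ n ≤ ⌊(u : ℝ) * n⌋₊} =
      (volume : Measure ℝ) (Subtype.val '' {u : unitInterval |
        ⌊(u : ℝ) * n⌋₊ ∈ S ∨ n ≤ ⌊(u : ℝ) * n⌋₊}) :=
    (MeasurableEmbedding.subtype_coe measurableSet_Icc).comap_apply _ _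
  rw [e]
  have hsub : (Subtype.val '' {u : unitInterval | ⌊(u : ℝ) * n⌋₊ ∈ S ∨ n ≤ ⌊(u : ℝ) * n⌋₊}) ⊆
      (⋃ k ∈ S, Set.Ico ((k : ℝ) / n) (((k : ℝ) + 1) / n)) ∪ {1} := by
    rintro _ ⟨u, hu, rfl⟩
    have hu0 : 0 ≤ (u : ℝ) * n := mul_nonneg u.2.1 hn'.le
    rcases hu with hu | hu
    · left
      refine Set.mem_biUnion hu ⟨?_, ?_⟩
      · rw [div_le_iff₀ hn']; exact Nat.floor_le hu0
      · rw [lt_div_iff₀ hn']; exact Nat.lt_floor_add_one _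
    · right
      have h1 : (n : ℝ) ≤ (u : ℝ) * n := (Nat.cast_le.2 hu).trans (Nat.floor_le hu0)
      have h2 : (1 : ℝ) ≤ u := by
        by_contra hcon
        push Not at hcon
        nlinarith
      exact le_antisymm u.2.2 h2
  refine (measure_mono hsub).trans ((measure_union_le _ _).trans ?_)
  rw [Real.volume_singleton, add_zero]
  refine (measure_biUnion_finset_le _ _).trans ?_
  have e2 : ∀ k : ℕ, (volume : Measure ℝ) (Set.Ico ((k : ℝ) / n) (((k : ℝ) + 1) / n)) =
      ENNReal.ofReal (1 / n) := by
    intro k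
    rw [Real.volume_Ico]
    congr 1
    field_simp
    ring
  simp only [e2, Finset.sum_const, nsmul_eq_mul]
  rw [← ENNReal.ofReal_natCast, ← ENNReal.ofReal_mul (by positivity)]
  exact ENNReal.ofReal_le_ofReal (le_of_eq (by ring))

/-- If the average of the Rayleigh quotients along the path is close to the bottom `-l` of the
spectrum, then by Markov's inequality so is the Rayleigh quotient of most iterates. -/
lemma volume_bad_index_le {n : ℕ} (hn : 0 < n) {p : ℕ → ℝ} {l : ℝ} (hl : 0 < l)
    (hp : ∀ t < n, -l ≤ p t) (hs : ∑ t ∈ Finset.range n, p t ≤ -(49 / 50) * l * n) :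
    (volume : Measure unitInterval)
      {u | ¬ (⌊(u : ℝ) * n⌋₊ < n ∧ p ⌊(u : ℝ) * n⌋₊ ≤ -(9 / 10) * l)} ≤
      ENNReal.ofReal (1 / 5) := by
  have hn' : (0 : ℝ) < n := by exact_mod_cast hn
  refine (measure_mono ?_).trans ((volume_floor_mem_le hn
    ((Finset.range n).filter fun t => -(9 / 10) * l < p t)).trans
    (ENNReal.ofReal_le_ofReal ?_))
  · intro u hu
    by_cases h : n ≤ ⌊(u : ℝ) * n⌋₊
    · exact Or.inr h
    · left
      push Not at h
      rw [Finset.mem_filter, Finset.mem_range]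
      refine ⟨h, ?_⟩
      by_contra hcon
      exact hu ⟨h, not_lt.1 hcon⟩
  · rw [div_le_iff₀ hn']
    have := card_filter_lt_le hl hp hs
    linarith

end UniformIndex

/-! ### Testing a candidate direction -/

section Testing

variable {d : ℕ} {Ξ : Type*} [MeasurableSpace Ξ] {D : Measure Ξ} [IsProbabilityMeasure D]

/-- Hoeffding's inequality for the empirical mean, upper tail. -/
lemma measure_average_ge_le {Y : Ξ → ℝ} (hY : Measurable Y) {L : ℝ} (hL : 0 < L)
    (hb : ∀ s, |Y s| ≤ L) {m : ℕ} (hm : 0 < m) {a : ℝ} (ha : 0 ≤ a) :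
    (Measure.infinitePi fun _ : ℕ => D)
      {ξ | ∫ s, Y s ∂D + a ≤ (∑ i ∈ Finset.range m, Y (ξ i)) / m} ≤
      ENNReal.ofReal (Real.exp (-(m * a ^ 2 / (2 * L ^ 2)))) := by
  set ν := Measure.infinitePi fun _ : ℕ => D with hν
  have hm' : (0 : ℝ) < m := by exact_mod_cast hm
  have hsub0 : HasSubgaussianMGF (fun s => Y s - ∫ s, Y s ∂D) ((‖L - -L‖₊ / 2) ^ 2) D :=
    hasSubgaussianMGF_of_mem_Icc hY.aemeasurable
      (Filter.Eventually.of_forall fun s => abs_le.1 (hb s))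
  have hind : iIndepFun (fun (i : ℕ) (ξ : ℕ → Ξ) => Y (ξ i) - ∫ s, Y s ∂D) ν :=
    iIndepFun_infinitePi (P := fun _ : ℕ => D) (X := fun _ s => Y s - ∫ s, Y s ∂D)
      (fun _ => hY.sub_const _)
  have hsub : ∀ i < m, HasSubgaussianMGF (fun ξ : ℕ → Ξ => Y (ξ i) - ∫ s, Y s ∂D)
      ((‖L - -L‖₊ / 2) ^ 2) ν := by
    intro i _
    have hp := measurePreserving_eval_infinitePi (fun _ : ℕ => D) i
    refine HasSubgaussianMGF.of_map (Y := fun ξ : ℕ → Ξ => ξ i) (X := fun s => Y s - ∫ s, Y s ∂D)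
      hp.measurable.aemeasurable ?_
    have : ν.map (fun ξ : ℕ → Ξ => ξ i) = D := hp.map_eq
    rwa [this]
  have h := HasSubgaussianMGF.measure_sum_range_ge_le_of_iIndepFun hind hsub
    (ε := m * a) (by positivity)
  have hc : (((‖L - -L‖₊ / 2) ^ 2 : NNReal) : ℝ) = L ^ 2 := by
    push_cast
    rw [Real.norm_of_nonneg (by linarith)]
    ring
  have he : -(m * a) ^ 2 / (2 * m * (((‖L - -L‖₊ / 2) ^ 2 : NNReal) : ℝ)) =
      -(m * a ^ 2 / (2 * L ^ 2)) := by
    rw [hc]; field_simp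
  rw [he] at h
  have hset : {ξ : ℕ → Ξ | ∫ s, Y s ∂D + a ≤ (∑ i ∈ Finset.range m, Y (ξ i)) / m} =
      {ξ | m * a ≤ ∑ i ∈ Finset.range m, (Y (ξ i) - ∫ s, Y s ∂D)} := by
    ext ξ
    simp only [Set.mem_ofPred_eq]
    rw [le_div_iff₀ hm', Finset.sum_sub_distrib]
    simp only [Finset.sum_const, Finset.card_range, nsmul_eq_mul]
    constructor <;> intro h <;> linarith
  rw [hset, ← ENNReal.ofReal_toReal (measure_ne_top ν _)]
  exact ENNReal.ofReal_le_ofReal h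

/-- Hoeffding's inequality for the empirical mean, lower tail. -/
lemma measure_average_le_le {Y : Ξ → ℝ} (hY : Measurable Y) {L : ℝ} (hL : 0 < L)
    (hb : ∀ s, |Y s| ≤ L) {m : ℕ} (hm : 0 < m) {a : ℝ} (ha : 0 ≤ a) :
    (Measure.infinitePi fun _ : ℕ => D)
      {ξ | (∑ i ∈ Finset.range m, Y (ξ i)) / m ≤ ∫ s, Y s ∂D - a} ≤
      ENNReal.ofReal (Real.exp (-(m * a ^ 2 / (2 * L ^ 2)))) := by
  have h := measure_average_ge_le (D := D) (Y := fun s => -Y s) hY.neg hL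
    (fun s => by rw [abs_neg]; exact hb s) hm ha
  convert h using 2
  ext ξ
  simp only [Set.mem_ofPred_eq, integral_neg, Finset.sum_neg_distrib, neg_div]
  constructor <;> intro h <;> linarith

/-- The finite-difference estimate of `vᵀ ∇²F(x; s) v` with length `ρ`. -/
def testStat (Γ : Ξ → Vec d → Vec d) (ρ : ℝ) (s : Ξ) (v : Vec d) : ℝ :=
  inner ℝ (ρ • v) (Γ s (ρ • v)) / ρ ^ 2

/-- A nonzero candidate passes the test. The value `0` encodes the absence of a candidate. -/
def Accepts (Γ : Ξ → Vec d → Vec d) (ρ ε : ℝ) (m : ℕ) (ξ : ℕ → Ξ) (v : Vec d) : Prop :=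
  v ≠ 0 ∧ (∑ i ∈ Finset.range m, testStat Γ ρ (ξ i) v) / m ≤ -(3 * ε / 4)

open scoped Classical in
/-- The outcome of a trial: the candidate if it passes the test, and `0` otherwise. -/
def tested (Γ : Ξ → Vec d → Vec d) (ρ ε : ℝ) (m : ℕ) (ξ : ℕ → Ξ) (v : Vec d) : Vec d :=
  if Accepts Γ ρ ε m ξ v then v else 0

open scoped Classical in
/-- A weight on the outcomes of a trial. It is at least `1` on directions of insufficient negative
curvature, and grows with the curvature so as to control the expected increase of the objective
that these directions cause. -/
def badness (H : Vec d →L[ℝ] Vec d) (ε : ℝ) (v : Vec d) : ℝ≥0∞ :=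
  if v = 0 ∨ inner ℝ v (H v) ≤ -(ε / 2) then 0
  else ENNReal.ofReal (1 + (inner ℝ v (H v) + ε / 2) / ε)

@[simp] lemma badness_zero (H : Vec d →L[ℝ] Vec d) (ε : ℝ) : badness H ε 0 = 0 := by
  simp [badness]

lemma measurable_badness (H : Vec d →L[ℝ] Vec d) (ε : ℝ) : Measurable (badness H ε) := by
  unfold badness
  have h : Measurable fun v : Vec d => (inner ℝ v (H v) : ℝ) := by fun_prop
  exact Measurable.ite ((measurableSet_eq_fun measurable_id measurable_const).union
    (measurableSet_le h measurable_const)) measurable_const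
    (((h.add_const _).div_const _).const_add _).ennreal_ofReal

variable {A : Ξ → Vec d →L[ℝ] Vec d} {H : Vec d →L[ℝ] Vec d} {Γ : Ξ → Vec d → Vec d}
  {L κ r ρ ε : ℝ} {m : ℕ}

lemma measurable_testStat (hΓ : Measurable (Function.uncurry Γ)) (ρ : ℝ) {Ω : Type*}
    [MeasurableSpace Ω] {f : Ω → Ξ} {g : Ω → Vec d} (hf : Measurable f) (hg : Measurable g) :
    Measurable fun ω => testStat Γ ρ (f ω) (g ω) := by
  have hg' : Measurable fun ω => ρ • g ω := hg.const_smul ρ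
  have h : Measurable fun ω => Γ (f ω) (ρ • g ω) := hΓ.comp (hf.prodMk hg')
  exact (hg'.inner h).div_const _

lemma measurable_tested (hΓ : Measurable (Function.uncurry Γ)) (ρ ε : ℝ) (m : ℕ) {Ω : Type*}
    [MeasurableSpace Ω] {f : Ω → (ℕ → Ξ)} {g : Ω → Vec d} (hf : Measurable f)
    (hg : Measurable g) : Measurable fun ω => tested Γ ρ ε m (f ω) (g ω) := by
  unfold tested Accepts
  refine Measurable.ite (MeasurableSet.inter ?_ ?_) hg measurable_const
  · exact (measurableSet_eq_fun hg measurable_const).compl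
  · have h : Measurable fun ω => ∑ i ∈ Finset.range m, testStat Γ ρ (f ω i) (g ω) :=
      Finset.measurable_sum _ fun i _ =>
        measurable_testStat hΓ ρ ((measurable_pi_apply i).comp hf) hg
    exact measurableSet_le (h.div_const _) measurable_const

lemma tested_ne_zero {Ξ : Type*} {Γ : Ξ → Vec d → Vec d} {ξ : ℕ → Ξ} {v : Vec d} :
    tested Γ ρ ε m ξ v ≠ 0 ↔ Accepts Γ ρ ε m ξ v := by
  unfold tested
  split_ifs with h
  · exact ⟨fun _ => h, fun h => h.1⟩
  · simp [h]

lemma abs_testStat_le (hΓ : IsNearLinear A Γ L κ r) (hρ : 0 < ρ) (s : Ξ) {v : Vec d}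
    (hv : ‖v‖ = 1) : |testStat Γ ρ s v| ≤ L := by
  unfold testStat
  have hn : ‖ρ • v‖ = ρ := by rw [norm_smul, hv, mul_one, Real.norm_of_nonneg hρ.le]
  rw [abs_div, abs_of_pos (by positivity : 0 < ρ ^ 2), div_le_iff₀ (by positivity)]
  refine (abs_real_inner_le_norm _ _).trans ?_
  have h := hΓ.norm_le s (ρ • v)
  rw [hn] at h ⊢
  nlinarith

lemma abs_testStat_sub_le (hΓ : IsNearLinear A Γ L κ r) (hρ : 0 < ρ) (hρr : ρ ≤ r) (s : Ξ)
    {v : Vec d} (hv : ‖v‖ = 1) : |testStat Γ ρ s v - inner ℝ (A s v) v| ≤ κ := by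
  have hn : ‖ρ • v‖ = ρ := by rw [norm_smul, hv, mul_one, Real.norm_of_nonneg hρ.le]
  have e : testStat Γ ρ s v - inner ℝ (A s v) v =
      inner ℝ (ρ • v) (Γ s (ρ • v) - A s (ρ • v)) / ρ ^ 2 := by
    unfold testStat
    rw [inner_sub_right, map_smul, inner_smul_left _ (ρ • A s v), inner_smul_right v (A s v) ρ,
      real_inner_comm v]
    simp only [conj_trivial]
    field_simp
  rw [e, abs_div, abs_of_pos (by positivity : 0 < ρ ^ 2), div_le_iff₀ (by positivity)]
  refine (abs_real_inner_le_norm _ _).trans ?_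
  have h := hΓ.close s (ρ • v) (by rw [hn]; exact hρr)
  rw [hn] at h ⊢
  nlinarith

lemma abs_integral_testStat_sub_le (hA : RandomOperator D A H L) (hΓ : IsNearLinear A Γ L κ r)
    (hρ : 0 < ρ) (hρr : ρ ≤ r) {v : Vec d} (hv : ‖v‖ = 1) :
    |∫ s, testStat Γ ρ s v ∂D - inner ℝ v (H v)| ≤ κ := by
  have hi : Integrable (fun s => testStat Γ ρ s v) D :=
    Integrable.of_bound (measurable_testStat hΓ.meas ρ measurable_id
      measurable_const).aestronglyMeasurable L
      (Filter.Eventually.of_forall fun s => abs_testStat_le hΓ hρ s hv)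
  rw [real_inner_comm (H v) v, ← hA.mean, ← integral_sub hi (hA.integrable_inner v v)]
  have := norm_integral_le_of_norm_le_const (μ := D)
    (f := fun s => testStat Γ ρ s v - inner ℝ (A s v) v) (C := κ)
    (Filter.Eventually.of_forall fun s => abs_testStat_sub_le hΓ hρ hρr s hv)
  simpa using this

/-- A direction of strong negative curvature passes the test with high probability. -/
lemma measure_reject_le (hA : RandomOperator D A H L) (hΓ : IsNearLinear A Γ L κ r)
    (hL : 0 < L) (hε : 0 < ε) (hρ : 0 < ρ) (hρr : ρ ≤ r) (hκ : κ ≤ ε / 20) (hm : 0 < m)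
    (hM : 500 ≤ m * ε ^ 2 / (2 * L ^ 2)) {v : Vec d} (hv : ‖v‖ = 1)
    (hgood : inner ℝ v (H v) ≤ -(9 / 10) * ε) :
    (Measure.infinitePi fun _ : ℕ => D) {ξ | tested Γ ρ ε m ξ v = 0} ≤
      ENNReal.ofReal (1 / 100) := by
  have hmean := (abs_le.1 (abs_integral_testStat_sub_le hA hΓ hρ hρr hv)).2
  have hmeas : Measurable fun s => testStat Γ ρ s v :=
    measurable_testStat hΓ.meas ρ measurable_id measurable_const
  refine (measure_mono ?_).trans ((measure_average_ge_le (D := D) hmeas hL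
    (fun s => abs_testStat_le hΓ hρ s hv) hm (a := ε / 10) (by positivity)).trans
    (ENNReal.ofReal_le_ofReal ?_))
  · intro ξ (hξ : tested Γ ρ ε m ξ v = 0)
    have h1 : ¬ Accepts Γ ρ ε m ξ v := fun h => (tested_ne_zero.2 h) hξ
    have hv0 : v ≠ 0 := by rintro rfl; simp at hv
    have h2 : -(3 * ε / 4) < (∑ i ∈ Finset.range m, testStat Γ ρ (ξ i) v) / m := by
      by_contra hcon
      exact h1 ⟨hv0, not_lt.1 hcon⟩
    show ∫ s, testStat Γ ρ s v ∂D + ε / 10 ≤ _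
    linarith
  · have e : m * (ε / 10) ^ 2 / (2 * L ^ 2) = m * ε ^ 2 / (2 * L ^ 2) / 100 := by ring
    rw [e]
    have h1 : Real.exp (-(m * ε ^ 2 / (2 * L ^ 2) / 100)) ≤ Real.exp (-5) :=
      Real.exp_le_exp.2 (by linarith)
    have h2 : Real.exp (-5) ≤ 1 / 100 := by
      rw [Real.exp_neg, one_div]
      refine inv_anti₀ (by norm_num) ?_
      have h3 : (2.7 : ℝ) ^ 5 ≤ Real.exp 5 := by
        have := Real.exp_one_gt_d9
        calc (2.7 : ℝ) ^ 5 ≤ Real.exp 1 ^ 5 := pow_le_pow_left₀ (by norm_num) (by linarith) 5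
          _ = Real.exp 5 := by rw [← Real.exp_nat_mul]; norm_num
      norm_num at h3
      linarith
    linarith

/-- The larger the curvature along a candidate is, the less likely it is to pass the test, so that
the expected badness of the outcome is small whatever the candidate. -/
lemma lintegral_badness_tested_le (hA : RandomOperator D A H L) (hΓ : IsNearLinear A Γ L κ r)
    (hL : 0 < L) (hε : 0 < ε) (hρ : 0 < ρ) (hρr : ρ ≤ r) (hκ : κ ≤ ε / 20) (hm : 0 < m)
    {M : ℝ} (hM0 : 500 ≤ M) (hM : M ≤ m * ε ^ 2 / (2 * L ^ 2)) {v : Vec d}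
    (hv : v = 0 ∨ ‖v‖ = 1) :
    ∫⁻ ξ, badness H ε (tested Γ ρ ε m ξ v) ∂(Measure.infinitePi fun _ : ℕ => D) ≤
      ENNReal.ofReal (Real.exp (-(M / 25))) := by
  set ν := Measure.infinitePi fun _ : ℕ => D with hν
  by_cases hbad : v = 0 ∨ inner ℝ v (H v) ≤ -(ε / 2)
  · have : ∀ ξ, badness H ε (tested Γ ρ ε m ξ v) = 0 := by
      intro ξ
      unfold tested
      split_ifs
      · simp only [badness, if_pos hbad]
      · simp
    simp [this]
  push Not at hbad
  have hv1 : ‖v‖ = 1 := hv.resolve_left hbad.1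
  set b : ℝ := (inner ℝ v (H v) + ε / 2) / ε with hb
  have hb0 : 0 < b := div_pos (by linarith [hbad.2]) hε
  have hx : inner ℝ v (H v) = ε * b - ε / 2 := by rw [hb]; field_simp; ring
  have hle : ∀ ξ, badness H ε (tested Γ ρ ε m ξ v) ≤
      {ξ : ℕ → Ξ | Accepts Γ ρ ε m ξ v}.indicator (fun _ => ENNReal.ofReal (1 + b)) ξ := by
    intro ξ
    by_cases h : Accepts Γ ρ ε m ξ v
    · rw [Set.indicator_of_mem (show ξ ∈ {ξ : ℕ → Ξ | Accepts Γ ρ ε m ξ v} from h)]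
      unfold tested
      rw [if_pos h, badness, if_neg (by push Not; exact hbad)]
    · unfold tested
      rw [if_neg h]; simp
  have hmean := (abs_le.1 (abs_integral_testStat_sub_le hA hΓ hρ hρr hv1)).1
  have hmeas : Measurable fun s => testStat Γ ρ s v :=
    measurable_testStat hΓ.meas ρ measurable_id measurable_const
  have hacc : ν {ξ | Accepts Γ ρ ε m ξ v} ≤
      ENNReal.ofReal (Real.exp (-(m * (ε * (b + 1 / 5)) ^ 2 / (2 * L ^ 2)))) := by
    refine (measure_mono ?_).trans (measure_average_le_le (D := D) hmeas hL
      (fun s => abs_testStat_le hΓ hρ s hv1) hm (a := ε * (b + 1 / 5)) (by positivity))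
    intro ξ (hξ : Accepts Γ ρ ε m ξ v)
    have := hξ.2
    show _ ≤ ∫ s, testStat Γ ρ s v ∂D - ε * (b + 1 / 5)
    rw [hx] at hmean
    linarith
  calc ∫⁻ ξ, badness H ε (tested Γ ρ ε m ξ v) ∂ν
      ≤ ENNReal.ofReal (1 + b) * ν {ξ | Accepts Γ ρ ε m ξ v} :=
        (lintegral_mono hle).trans (lintegral_indicator_const_le _ _)
    _ ≤ ENNReal.ofReal (1 + b) *
        ENNReal.ofReal (Real.exp (-(m * (ε * (b + 1 / 5)) ^ 2 / (2 * L ^ 2)))) := by gcongr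
    _ ≤ ENNReal.ofReal (Real.exp (-(M / 25))) := by
        rw [← ENNReal.ofReal_mul (by linarith)]
        refine ENNReal.ofReal_le_ofReal ?_
        have h1 : 1 + b ≤ Real.exp b := by linarith [Real.add_one_le_exp b]
        refine (mul_le_mul_of_nonneg_right h1 (Real.exp_nonneg _)).trans ?_
        rw [← Real.exp_add]
        refine Real.exp_le_exp.2 ?_
        have e : m * (ε * (b + 1 / 5)) ^ 2 / (2 * L ^ 2) =
          m * ε ^ 2 / (2 * L ^ 2) * (b + 1 / 5) ^ 2 := by ring
        rw [e]
        have h2 : M * (b + 1 / 5) ^ 2 ≤ m * ε ^ 2 / (2 * L ^ 2) * (b + 1 / 5) ^ 2 :=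
          mul_le_mul_of_nonneg_right hM (sq_nonneg _)
        nlinarith [mul_nonneg (by linarith : (0 : ℝ) ≤ M) (sq_nonneg b),
          mul_le_mul_of_nonneg_right hM0 hb0.le]

end Testing

/-! ### One trial -/

section Trial

variable {d : ℕ} {Ξ : Type*} [MeasurableSpace Ξ] {D : Measure Ξ} [IsProbabilityMeasure D]
  {A : Ξ → Vec d →L[ℝ] Vec d} {H : Vec d →L[ℝ] Vec d} {Γ : Ξ → Vec d → Vec d}
  {L κ r ρ ε : ℝ} {m : ℕ}

/-- The outcome of the trial that proposes the candidate `cand g ξ u`. -/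
def trialOutcome (Γ : Ξ → Vec d → Vec d) (ρ ε : ℝ) (m : ℕ)
    (cand : Vec d → (ℕ → Ξ) → unitInterval → Vec d) (seed : TrialSeed d Ξ) : Vec d :=
  tested Γ ρ ε m seed.2.2.2 (cand seed.1 seed.2.1 seed.2.2.1)

variable {cand : Vec d → (ℕ → Ξ) → unitInterval → Vec d}

lemma measurable_trialOutcome (hΓ : Measurable (Function.uncurry Γ))
    (hc : Measurable fun q : Vec d × (ℕ → Ξ) × unitInterval => cand q.1 q.2.1 q.2.2) :
    Measurable (trialOutcome Γ ρ ε m cand) := by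
  have h1 : Measurable fun s : TrialSeed d Ξ => (s.1, s.2.1, s.2.2.1) := by fun_prop
  exact measurable_tested hΓ ρ ε m (by fun_prop) (hc.comp h1)

/-- If the candidate is good with constant probability, a trial succeeds with probability at least
one half. -/
lemma trialLaw_outcome_eq_zero_le (hA : RandomOperator D A H L) (hΓ : IsNearLinear A Γ L κ r)
    (hL : 0 < L) (hε : 0 < ε) (hρ : 0 < ρ) (hρr : ρ ≤ r) (hκ : κ ≤ ε / 20) (hm : 0 < m)
    (hM : 500 ≤ m * ε ^ 2 / (2 * L ^ 2))
    (hc : Measurable fun q : Vec d × (ℕ → Ξ) × unitInterval => cand q.1 q.2.1 q.2.2)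
    {B : Set (Vec d × (ℕ → Ξ))}
    (hB : ((stdGaussian (Vec d)).prod (Measure.infinitePi fun _ : ℕ => D)) B ≤
      ENNReal.ofReal (27 / 200))
    (hgood : ∀ p ∉ B, (volume : Measure unitInterval)
      {u | ¬ (‖cand p.1 p.2 u‖ = 1 ∧
        inner ℝ (cand p.1 p.2 u) (H (cand p.1 p.2 u)) ≤ -(9 / 10) * ε)} ≤
        ENNReal.ofReal (1 / 5)) :
    trialLaw d D {s | trialOutcome Γ ρ ε m cand s = 0} ≤ ENNReal.ofReal (1 / 2) := by
  have hN : MeasurableSet {s | trialOutcome Γ ρ ε m cand s = 0} :=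
    measurableSet_eq_fun (measurable_trialOutcome hΓ.meas hc) measurable_const
  have hassoc := measurePreserving_prodAssoc (stdGaussian (Vec d))
    (Measure.infinitePi fun _ : ℕ => D)
    ((volume : Measure unitInterval).prod (Measure.infinitePi fun _ : ℕ => D))
  have hN' := hassoc.measurable hN
  have e : trialLaw d D {s | trialOutcome Γ ρ ε m cand s = 0} = _ :=
    (hassoc.measure_preimage hN.nullMeasurableSet).symm
  rw [e]
  refine (prod_measure_le_add hN' (B := B)
    (q := ENNReal.ofReal (1 / 5) + ENNReal.ofReal (1 / 100)) ?_).trans ?_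
  · intro p hp
    have hN2 : MeasurableSet {b : unitInterval × (ℕ → Ξ) |
        (p, b) ∈ MeasurableEquiv.prodAssoc ⁻¹' {s | trialOutcome Γ ρ ε m cand s = 0}} :=
      measurable_prodMk_left hN'
    refine (prod_measure_le_add hN2 (q := ENNReal.ofReal (1 / 100)) ?_).trans
      (add_le_add (hgood p hp) le_rfl)
    intro u hu
    have hu' : ‖cand p.1 p.2 u‖ = 1 ∧
        inner ℝ (cand p.1 p.2 u) (H (cand p.1 p.2 u)) ≤ -(9 / 10) * ε := by
      by_contra hcon; exact hu hcon
    exact measure_reject_le hA hΓ hL hε hρ hρr hκ hm hM hu'.1 hu'.2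
  · refine (add_le_add hB le_rfl).trans ?_
    rw [← ENNReal.ofReal_add (by norm_num) (by norm_num),
      ← ENNReal.ofReal_add (by norm_num) (by norm_num)]
    exact ENNReal.ofReal_le_ofReal (by norm_num)

lemma lintegral_le_of_forall_le {Ω : Type*} [MeasurableSpace Ω] {μ : Measure Ω}
    [IsProbabilityMeasure μ] {h : Ω → ℝ≥0∞} {c : ℝ≥0∞} (hh : ∀ ω, h ω ≤ c) :
    ∫⁻ ω, h ω ∂μ ≤ c := by
  simpa using lintegral_mono (μ := μ) hh

lemma lintegral_badness_trialOutcome_le (hA : RandomOperator D A H L)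
    (hΓ : IsNearLinear A Γ L κ r) (hL : 0 < L) (hε : 0 < ε) (hρ : 0 < ρ) (hρr : ρ ≤ r)
    (hκ : κ ≤ ε / 20) (hm : 0 < m) {M : ℝ} (hM0 : 500 ≤ M) (hM : M ≤ m * ε ^ 2 / (2 * L ^ 2))
    (hc : Measurable fun q : Vec d × (ℕ → Ξ) × unitInterval => cand q.1 q.2.1 q.2.2)
    (hunit : ∀ g ξ u, cand g ξ u = 0 ∨ ‖cand g ξ u‖ = 1) :
    ∫⁻ s, badness H ε (trialOutcome Γ ρ ε m cand s) ∂(trialLaw d D) ≤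
      ENNReal.ofReal (Real.exp (-(M / 25))) := by
  have hmeas : Measurable fun s => badness H ε (trialOutcome Γ ρ ε m cand s) :=
    (measurable_badness H ε).comp (measurable_trialOutcome hΓ.meas hc)
  unfold trialLaw
  rw [lintegral_prod _ hmeas.aemeasurable]
  refine lintegral_le_of_forall_le fun g => ?_
  have hm1 : Measurable fun b : (ℕ → Ξ) × unitInterval × (ℕ → Ξ) =>
    badness H ε (trialOutcome Γ ρ ε m cand (g, b)) := hmeas.comp measurable_prodMk_left
  rw [lintegral_prod _ hm1.aemeasurable]
  refine lintegral_le_of_forall_le fun ξ => ?_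
  have hm2 : Measurable fun b : unitInterval × (ℕ → Ξ) =>
    badness H ε (trialOutcome Γ ρ ε m cand (g, ξ, b)) := hm1.comp measurable_prodMk_left
  rw [lintegral_prod _ hm2.aemeasurable]
  refine lintegral_le_of_forall_le fun u => ?_
  exact lintegral_badness_tested_le hA hΓ hL hε hρ hρr hκ hm hM0 hM (hunit g ξ u)

end Trial

/-! ### Unfolding the counted computations -/

section Counting

universe u

variable {α β : Type u}

@[simp] lemma val_pure (a : α) : (pure a : Counted α).val = a := rfl
@[simp] lemma calls_pure (a : α) : (pure a : Counted α).calls = 0 := rfl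
@[simp] lemma val_bind (a : Counted α) (f : α → Counted β) : (a >>= f).val = (f a.val).val := rfl
@[simp] lemma calls_bind (a : Counted α) (f : α → Counted β) :
    (a >>= f).calls = a.calls + (f a.val).calls := rfl

lemma firstSuccess_calls_le {trial : ℕ → Counted (Option α)} {c : ℕ}
    (h : ∀ j, (trial j).calls ≤ c) (J : ℕ) : (firstSuccess trial J).calls ≤ J * c := by
  induction J with
  | zero => simp [firstSuccess]
  | succ J ih =>
    have h2 := h J
    simp only [firstSuccess, calls_bind]
    rw [Nat.add_mul, one_mul]
    refine add_le_add ih ?_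
    rcases (firstSuccess trial J).val with _ | v
    · exact h2
    · exact Nat.zero_le _

variable {d : ℕ}

lemma ncd3_calls (L₃ ε : ℝ) (x : Vec d) (a : Counted (Option (Vec d))) (ζ : ℝ) :
    (ncd3 L₃ ε x a ζ).calls = a.calls := by
  simp only [ncd3, calls_bind]
  rcases a.val with _ | v <;> rfl

lemma ncd3_val (L₃ ε : ℝ) (x : Vec d) (a : Counted (Option (Vec d))) (ζ : ℝ) :
    (ncd3 L₃ ε x a ζ).val = a.val.map fun v => x + (ζ * Real.sqrt (3 * ε / L₃)) • v := by
  simp only [ncd3, val_bind]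
  rcases a.val with _ | v <;> rfl

end Counting

/-! ### Independent trials -/

section Trials

variable {d : ℕ} {Ω : Type*}

open scoped Classical in
/-- The optional vector that `v` encodes: `0` stands for `none`. -/
def toOption (v : Vec d) : Option (Vec d) := if v = 0 then none else some v

open scoped Classical in
/-- The first nonzero outcome among the first `J` trials, and `0` if there is none. -/
def firstNonzero (T : Ω → Vec d) (ω : ℕ → Ω) : ℕ → Vec d
  | 0 => 0
  | J + 1 => if firstNonzero T ω J = 0 then T (ω J) else firstNonzero T ω J

lemma firstSuccess_val {T : Ω → Vec d} {ω : ℕ → Ω} {trial : ℕ → Counted (Option (Vec d))}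
    (h : ∀ j, (trial j).val = toOption (T (ω j))) (J : ℕ) :
    (firstSuccess trial J).val = toOption (firstNonzero T ω J) := by
  induction J with
  | zero => simp [firstSuccess, firstNonzero, toOption]
  | succ J ih =>
    simp only [firstSuccess, val_bind, firstNonzero]
    rw [ih]
    by_cases hz : firstNonzero T ω J = 0
    · simp [toOption, hz] at h ⊢
      exact h J
    · simp [toOption, hz]

lemma firstNonzero_eq_zero_iff {T : Ω → Vec d} {ω : ℕ → Ω} (J : ℕ) :
    firstNonzero T ω J = 0 ↔ ∀ j < J, T (ω j) = 0 := by
  induction J with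
  | zero => simp [firstNonzero]
  | succ J ih =>
    simp only [firstNonzero, Nat.forall_lt_succ_right]
    rw [← ih]
    by_cases hz : firstNonzero T ω J = 0 <;> simp [hz]

lemma firstNonzero_unit {T : Ω → Vec d} (hT : ∀ ω, T ω = 0 ∨ ‖T ω‖ = 1) (ω : ℕ → Ω) (J : ℕ) :
    firstNonzero T ω J = 0 ∨ ‖firstNonzero T ω J‖ = 1 := by
  induction J with
  | zero => simp [firstNonzero]
  | succ J ih =>
    simp only [firstNonzero]
    split_ifs
    · exact hT _
    · exact ih

lemma badness_firstNonzero_succ_le (H : Vec d →L[ℝ] Vec d) (ε : ℝ) (T : Ω → Vec d) (ω : ℕ → Ω)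
    (J : ℕ) : badness H ε (firstNonzero T ω (J + 1)) ≤
      badness H ε (firstNonzero T ω J) + badness H ε (T (ω J)) := by
  simp only [firstNonzero]
  split_ifs
  · exact le_add_self
  · exact le_self_add

variable [MeasurableSpace Ω] {P : Measure Ω} [IsProbabilityMeasure P]

lemma measurable_firstNonzero {T : Ω → Vec d} (hT : Measurable T) (J : ℕ) :
    Measurable fun ω => firstNonzero T ω J := by
  induction J with
  | zero => exact measurable_const
  | succ J ih =>
    simp only [firstNonzero]
    exact Measurable.ite (measurableSet_eq_fun ih measurable_const)
      (hT.comp (measurable_pi_apply J)) ih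

lemma measure_firstNonzero_eq_zero {T : Ω → Vec d} (hT : Measurable T) (J : ℕ) :
    (Measure.infinitePi fun _ : ℕ => P) {ω | firstNonzero T ω J = 0} = P {ω | T ω = 0} ^ J := by
  have e : {ω : ℕ → Ω | firstNonzero T ω J = 0} =
      ((Finset.range J : Finset ℕ) : Set ℕ).pi fun _ => {ω | T ω = 0} := by
    ext ω
    simp [firstNonzero_eq_zero_iff, Set.mem_pi]
  rw [e, Measure.infinitePi_pi _ fun _ _ => measurableSet_eq_fun hT measurable_const]
  simp

lemma lintegral_badness_firstNonzero_le (H : Vec d →L[ℝ] Vec d) (ε : ℝ) {T : Ω → Vec d}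
    (hT : Measurable T) (J : ℕ) :
    ∫⁻ ω, badness H ε (firstNonzero T ω J) ∂(Measure.infinitePi fun _ : ℕ => P) ≤
      J * ∫⁻ ω, badness H ε (T ω) ∂P := by
  induction J with
  | zero => simp [firstNonzero]
  | succ J ih =>
    have hb := (measurable_badness H ε).comp hT
    refine (lintegral_mono fun ω => badness_firstNonzero_succ_le H ε T ω J).trans ?_
    have hm : Measurable fun ω => badness H ε (firstNonzero T ω J) :=
      (measurable_badness H ε).comp (measurable_firstNonzero hT J)
    rw [lintegral_add_left hm]
    have e : ∫⁻ ω : ℕ → Ω, badness H ε (T (ω J)) ∂(Measure.infinitePi fun _ : ℕ => P) =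
        ∫⁻ ω, badness H ε (T ω) ∂P :=
      (measurePreserving_eval_infinitePi (fun _ : ℕ => P) J).lintegral_comp hb
    rw [e, Nat.cast_succ, add_mul, one_mul]
    exact add_le_add ih le_rfl

end Trials

/-! ### Decrease of the objective -/

section Decrease

variable {d : ℕ} {S : Type*} [MeasurableSpace S] {μ : Measure S}
  {f : Vec d → ℝ} {L₃ ε δ : ℝ} {x : Vec d} {V : S → Vec d}
  {run : S → ℝ → Counted (Option (Vec d))}

/-- A unit vector of badness less than `1` has curvature at most `-ε/2`. -/
lemma signDecrease_of_badness_lt_one (hL : 0 < L₃) (hε : 0 < ε) (hf : HasLipschitzThirdDeriv L₃ f)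
    {v : Vec d} (hv : ‖v‖ = 1) (hb : badness (hessian f x) ε v < 1)
    {run : ℝ → Counted (Option (Vec d))}
    (hrun : ∀ ζ, (run ζ).val = (toOption v).map fun v => x + (ζ * Real.sqrt (3 * ε / L₃)) • v) :
    SignDecrease f x run (3 * ε ^ 2 / (8 * L₃)) := by
  have hv0 : v ≠ 0 := by rintro rfl; simp at hv
  refine ⟨fun ζ => x + (ζ * Real.sqrt (3 * ε / L₃)) • v, fun ζ => ?_, ?_⟩
  · rw [hrun, toOption, if_neg hv0]; rfl
  · have hc : inner ℝ v (hessian f x v) ≤ -(ε / 2) := by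
      by_contra hcon
      rw [badness, if_neg (by push Not at hcon ⊢; exact ⟨hv0, hcon⟩)] at hb
      have h1 : (0 : ℝ) ≤ (inner ℝ v (hessian f x v) + ε / 2) / ε :=
        div_nonneg (by linarith [not_le.1 hcon]) hε.le
      rw [← ENNReal.ofReal_one, ENNReal.ofReal_lt_ofReal_iff one_pos] at hb
      linarith
    have h := integral_rademacher_step_le hL hε hf x v hv
    have e : ∫ ζ, (f x - f (x + (ζ * Real.sqrt (3 * ε / L₃)) • v)) ∂rademacher =
        -∫ ζ, (f (x + (ζ * Real.sqrt (3 * ε / L₃)) • v) - f x) ∂rademacher := by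
      rw [← integral_neg]; simp
    rw [e]
    have h2 : 3 * ε / (2 * L₃) * inner ℝ v (hessian f x v) ≤ 3 * ε / (2 * L₃) * -(ε / 2) :=
      mul_le_mul_of_nonneg_left hc (by positivity)
    have e2 : 3 * ε / (2 * L₃) * -(ε / 2) = -(2 * (3 * ε ^ 2 / (8 * L₃))) := by
      field_simp; ring
    linarith

lemma measure_not_signDecrease_le (hL : 0 < L₃) (hε : 0 < ε) (hδ : 0 < δ)
    (hf : HasLipschitzThirdDeriv L₃ f) (hV : Measurable V) (hunit : ∀ ω, V ω = 0 ∨ ‖V ω‖ = 1)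
    (hrun : ∀ ω ζ, (run ω ζ).val =
      (toOption (V ω)).map fun v => x + (ζ * Real.sqrt (3 * ε / L₃)) • v)
    (h0 : μ {ω | V ω = 0} ≤ ENNReal.ofReal (δ / 2))
    (hb : ∫⁻ ω, badness (hessian f x) ε (V ω) ∂μ ≤ ENNReal.ofReal (δ / 24)) :
    μ {ω | ¬ SignDecrease f x (run ω) (3 * ε ^ 2 / (8 * L₃))} ≤ ENNReal.ofReal δ := by
  have hmark := mul_meas_ge_le_lintegral (μ := μ)
    ((measurable_badness (hessian f x) ε).comp hV) 1
  rw [one_mul] at hmark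
  have hsub : {ω | ¬ SignDecrease f x (run ω) (3 * ε ^ 2 / (8 * L₃))} ⊆
      {ω | V ω = 0} ∪ {ω | 1 ≤ (badness (hessian f x) ε ∘ V) ω} := by
    intro ω hω
    by_contra hcon
    simp only [Set.mem_union, Set.mem_ofPred_eq, not_or, not_le] at hcon
    exact hω (signDecrease_of_badness_lt_one hL hε hf ((hunit ω).resolve_left hcon.1) hcon.2
      (hrun ω))
  refine (measure_mono hsub).trans ((measure_union_le _ _).trans
    ((add_le_add h0 (hmark.trans hb)).trans ?_))
  rw [← ENNReal.ofReal_add (by positivity) (by positivity)]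
  exact ENNReal.ofReal_le_ofReal (by linarith)

variable [IsProbabilityMeasure μ]

lemma getD_map_toOption (v : Vec d) (c : ℝ) :
    ((toOption v).map fun v => x + c • v).getD x = x + c • v := by
  unfold toOption
  split_ifs with h <;> simp [h]

lemma integrable_step (hf : Continuous f) (hV : Measurable V)
    (hunit : ∀ ω, V ω = 0 ∨ ‖V ω‖ = 1) (η : ℝ) (hη : 0 ≤ η) :
    Integrable (fun q : S × ℝ => f (x + (q.2 * η) • V q.1) - f x) (μ.prod rademacher) := by
  obtain ⟨C, hC⟩ := (isCompact_closedBall x η).exists_bound_of_continuousOn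
    (f := fun y => f y - f x) (hf.sub continuous_const).continuousOn
  have hm : Measurable fun q : S × ℝ => f (x + (q.2 * η) • V q.1) - f x := by
    have h1 : Measurable fun q : S × ℝ => V q.1 := hV.comp measurable_fst
    have h2 : Measurable fun q : S × ℝ => x + (q.2 * η) • V q.1 :=
      ((measurable_snd.mul_const η).smul h1).const_add x
    exact (hf.measurable.comp h2).sub_const _
  refine Integrable.of_bound hm.aestronglyMeasurable C ?_
  have hr : ∀ᵐ ζ ∂rademacher, |ζ| = 1 := by
    have hs : MeasurableSet {ζ : ℝ | |ζ| = 1} :=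
      measurableSet_eq_fun (by fun_prop) measurable_const
    unfold rademacher
    rw [ae_add_measure_iff]
    constructor <;> refine Measure.ae_smul_measure ?_ _ <;> rw [ae_dirac_iff hs] <;> simp
  have hr2 : ∀ᵐ q ∂(μ.prod rademacher), |(q : S × ℝ).2| = 1 :=
    Measure.quasiMeasurePreserving_snd.ae hr
  filter_upwards [hr2] with q hq
  refine hC _ ?_
  rw [Metric.mem_closedBall, dist_eq_norm, add_sub_cancel_left, norm_smul, Real.norm_eq_abs,
    abs_mul, hq, one_mul, abs_of_nonneg hη]
  rcases hunit q.1 with h | h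
  · rw [h, norm_zero, mul_zero]; exact hη
  · rw [h, mul_one]

/-- The expected change of the objective in terms of the failure indicator and of the badness:
the slope of the badness in the curvature matches that of the fourth-order expansion. -/
lemma integral_step_le (hL : 0 < L₃) (hε : 0 < ε) (hf : HasLipschitzThirdDeriv L₃ f)
    {v : Vec d} (hv : v = 0 ∨ ‖v‖ = 1) :
    ∫ ζ, (f (x + (ζ * Real.sqrt (3 * ε / L₃)) • v) - f x) ∂rademacher ≤
      3 * ε ^ 2 / (8 * L₃) * (({0} : Set (Vec d)).indicator (fun _ => (1 : ℝ)) v - 1) +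
        3 * ε ^ 2 / (2 * L₃) * (badness (hessian f x) ε v).toReal := by
  by_cases h0 : v = 0
  · simp [h0]
  have h := integral_rademacher_step_le hL hε hf x v (hv.resolve_left h0)
  rw [Set.indicator_of_notMem (by simpa using h0)]
  refine h.trans ?_
  by_cases hc : inner ℝ v (hessian f x v) ≤ -(ε / 2)
  · rw [badness, if_pos (Or.inr hc)]
    have h2 : 3 * ε / (2 * L₃) * inner ℝ v (hessian f x v) ≤ 3 * ε / (2 * L₃) * -(ε / 2) :=
      mul_le_mul_of_nonneg_left hc (by positivity)
    have e2 : 3 * ε / (2 * L₃) * -(ε / 2) = -(2 * (3 * ε ^ 2 / (8 * L₃))) := by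
      field_simp; ring
    simp
    linarith
  · rw [badness, if_neg (by push Not at hc ⊢; exact ⟨h0, hc⟩)]
    have h1 : (0 : ℝ) ≤ (inner ℝ v (hessian f x v) + ε / 2) / ε :=
      div_nonneg (by linarith [not_le.1 hc]) hε.le
    rw [ENNReal.toReal_ofReal (by linarith)]
    have e : 3 * ε / (2 * L₃) * inner ℝ v (hessian f x v) + 3 * ε ^ 2 / (8 * L₃) =
        3 * ε ^ 2 / (8 * L₃) * (0 - 1) +
        3 * ε ^ 2 / (2 * L₃) * ((inner ℝ v (hessian f x v) + ε / 2) / ε) := by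
      field_simp; ring
    rw [e]
    have : 0 ≤ 3 * ε ^ 2 / (2 * L₃) := by positivity
    nlinarith

/-- The badness already accounts for the increase along bad directions, so `δ ≤ 1/3` is enough: with
`c = ε²/(8L₃)` the expected change is at most `3c (1/6 - 1) + 12c/72 ≤ -c`. -/
lemma expected_decrease (hL : 0 < L₃) (hε : 0 < ε) (hδ3 : δ ≤ 1 / 3)
    (hf : HasLipschitzThirdDeriv L₃ f) (hV : Measurable V) (hunit : ∀ ω, V ω = 0 ∨ ‖V ω‖ = 1)
    (hrun : ∀ ω ζ, (run ω ζ).val =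
      (toOption (V ω)).map fun v => x + (ζ * Real.sqrt (3 * ε / L₃)) • v)
    (h0 : μ {ω | V ω = 0} ≤ ENNReal.ofReal (δ / 2))
    (hb : ∫⁻ ω, badness (hessian f x) ε (V ω) ∂μ ≤ ENNReal.ofReal (δ / 24)) :
    Integrable (fun q : S × ℝ => f ((run q.1 q.2).val.getD x) - f x) (μ.prod rademacher) ∧
      ∫ q : S × ℝ, (f ((run q.1 q.2).val.getD x) - f x) ∂(μ.prod rademacher) ≤
        -(ε ^ 2 / (8 * L₃)) := by
  simp only [hrun, getD_map_toOption]
  have hint := integrable_step (μ := μ) (x := x) hf.1.continuous hV hunit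
    (Real.sqrt (3 * ε / L₃)) (Real.sqrt_nonneg _)
  refine ⟨hint, ?_⟩
  rw [integral_prod _ hint]
  have hm := (measurable_badness (hessian f x) ε).comp hV
  have hfin : ∫⁻ ω, badness (hessian f x) ε (V ω) ∂μ ≠ ⊤ :=
    (hb.trans_lt ENNReal.ofReal_lt_top).ne
  have hi1 : Integrable (fun ω => (badness (hessian f x) ε (V ω)).toReal) μ :=
    integrable_toReal_of_lintegral_ne_top hm.aemeasurable hfin
  have hset : MeasurableSet {ω | V ω = 0} := measurableSet_eq_fun hV measurable_const
  have hi2 : Integrable (fun ω => ({0} : Set (Vec d)).indicator (fun _ => (1 : ℝ)) (V ω)) μ :=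
    Integrable.of_bound (((measurable_const.indicator (measurableSet_singleton 0)).comp
      hV).aestronglyMeasurable) 1 (Filter.Eventually.of_forall fun ω => by
        by_cases h : V ω = 0 <;> simp [h])
  have hi3 : Integrable (fun ω => 3 * ε ^ 2 / (8 * L₃) *
      (({0} : Set (Vec d)).indicator (fun _ => (1 : ℝ)) (V ω) - 1)) μ :=
    (hi2.sub (integrable_const 1)).const_mul _
  refine (integral_mono (hint.integral_prod_left) (hi3.add (hi1.const_mul (3 * ε ^ 2 / (2 * L₃))))
    fun ω => integral_step_le hL hε hf (hunit ω)).trans ?_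
  have e1 : ∫ ω, ({0} : Set (Vec d)).indicator (fun _ => (1 : ℝ)) (V ω) ∂μ =
      μ.real {ω | V ω = 0} := by
    have : (fun ω => ({0} : Set (Vec d)).indicator (fun _ => (1 : ℝ)) (V ω)) =
        {ω | V ω = 0}.indicator (fun _ => (1 : ℝ)) := by
      funext ω
      by_cases h : V ω = 0 <;> simp [h]
    rw [this, integral_indicator_const _ hset]
    simp
  have e2 : ∫ ω, (badness (hessian f x) ε (V ω)).toReal ∂μ =
      (∫⁻ ω, badness (hessian f x) ε (V ω) ∂μ).toReal :=
    integral_toReal hm.aemeasurable (ae_lt_top hm hfin)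
  rw [integral_add' hi3 (hi1.const_mul _), integral_const_mul, integral_const_mul,
    integral_sub hi2 (integrable_const 1), e1, e2]
  have b1 : μ.real {ω | V ω = 0} ≤ 1 / 6 := by
    refine ENNReal.toReal_le_of_le_ofReal (by norm_num) (h0.trans (ENNReal.ofReal_le_ofReal ?_))
    linarith
  have b2 : (∫⁻ ω, badness (hessian f x) ε (V ω) ∂μ).toReal ≤ 1 / 72 := by
    refine ENNReal.toReal_le_of_le_ofReal (by norm_num) (hb.trans (ENNReal.ofReal_le_ofReal ?_))
    linarith
  have e3 : 3 * ε ^ 2 / (8 * L₃) = 3 * (ε ^ 2 / (8 * L₃)) := by ring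
  have e4 : 3 * ε ^ 2 / (2 * L₃) = 12 * (ε ^ 2 / (8 * L₃)) := by field_simp; ring
  rw [e3, e4]
  have hpos : 0 ≤ ε ^ 2 / (8 * L₃) := by positivity
  simp
  nlinarith [mul_le_mul_of_nonneg_left b1 hpos, mul_le_mul_of_nonneg_left b2 hpos]

end Decrease

/-! ### Good candidates: the linear iteration -/

section LinearCandidate

lemma measurable_comp_nat {Ω E : Type*} [MeasurableSpace Ω] [MeasurableSpace E] {W : ℕ → Ω → E}
    {N : Ω → ℕ} (hW : ∀ n, Measurable (W n)) (hN : Measurable N) :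
    Measurable fun ω => W (N ω) ω := by
  have h : Measurable fun p : ℕ × Ω => W p.1 p.2 := measurable_from_prod_countable_right hW
  exact h.comp (hN.prodMk measurable_id)

lemma le_log_one_add {y : ℝ} (hy : 0 ≤ y) (hy1 : y ≤ 1 / 1000) :
    999 / 1000 * y ≤ Real.log (1 + y) := by
  have h := Real.one_sub_inv_le_log_of_pos (show 0 < 1 + y by linarith)
  refine le_trans ?_ h
  have e : 1 - (1 + y)⁻¹ = y / (1 + y) := by field_simp; ring
  rw [e, le_div_iff₀ (by linarith)]
  nlinarith

variable {d : ℕ} {Ξ : Type*} [MeasurableSpace Ξ] {D : Measure Ξ} [IsProbabilityMeasure D]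
  {A : Ξ → Vec d →L[ℝ] Vec d} {H : Vec d →L[ℝ] Vec d} {Γ : Ξ → Vec d → Vec d}
  {L κ r α ε l ell : ℝ} {u : Vec d}

/-- Chebyshev's inequality for the noise, with the starting point averaged out. -/
lemma prod_measure_noiseSum_ge (hA : RandomOperator D A H L) (hL : 0 ≤ L)
    {v : Vec d → ℕ → (ℕ → Ξ) → Vec d} (hv : ∀ g, IsPredictable (v g))
    (hm : ∀ t, Measurable fun p : Vec d × (ℕ → Ξ) => v p.1 t p.2) (n : ℕ) {θ : ℝ} (hθ : 0 < θ)
    (hn : 100 * (n * L ^ 2) ≤ θ ^ 2) :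
    ((stdGaussian (Vec d)).prod (Measure.infinitePi fun _ : ℕ => D))
      {p | θ ≤ |noiseSum A H (v p.1) n p.2|} ≤ ENNReal.ofReal (1 / 100) := by
  have hmeas : Measurable fun p : Vec d × (ℕ → Ξ) => noiseSum A H (v p.1) n p.2 := by
    unfold noiseSum
    exact Finset.measurable_sum _ fun t _ =>
      measurable_formNoise hA ((measurable_pi_apply t).comp measurable_snd) (hm t)
  have hset : MeasurableSet {p : Vec d × (ℕ → Ξ) | θ ≤ |noiseSum A H (v p.1) n p.2|} :=
    measurableSet_le measurable_const hmeas.abs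
  refine (prod_measure_le_add hset (B := ∅) (q := ENNReal.ofReal (1 / 100)) fun g _ => ?_).trans
    (by simp)
  exact measure_noiseSum_ge hA hL (hv g) n hθ hn

/-- A random one of the first `T` directions of the linear iteration. -/
def linearCandidate (Γ : Ξ → Vec d → Vec d) (α : ℝ) (T : ℕ) (g : Vec d) (ξ : ℕ → Ξ)
    (u : unitInterval) : Vec d :=
  normalize (iter Γ α ξ g ⌊(u : ℝ) * T⌋₊)

lemma measurable_linearCandidate (hΓ : Measurable (Function.uncurry Γ)) (α : ℝ) (T : ℕ) :
    Measurable fun q : Vec d × (ℕ → Ξ) × unitInterval =>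
      linearCandidate Γ α T q.1 q.2.1 q.2.2 := by
  unfold linearCandidate
  refine measurable_normalize.comp (measurable_comp_nat
    (W := fun n (q : Vec d × (ℕ → Ξ) × unitInterval) => iter Γ α q.2.1 q.1 n)
    (N := fun q => ⌊(q.2.2 : ℝ) * T⌋₊) (fun n => ?_) ?_)
  · exact (measurable_iter hΓ α n).comp (measurable_fst.prodMk (measurable_fst.comp measurable_snd))
  · exact Nat.measurable_floor.comp
      ((measurable_subtype_coe.comp (measurable_snd.comp measurable_snd)).mul_const _)

lemma isPredictable_normalize_iter (hΓ : Measurable (Function.uncurry Γ)) (α : ℝ) (g : Vec d) :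
    IsPredictable fun t ξ => normalize (iter Γ α ξ g t) where
  meas t := measurable_normalize.comp
    ((measurable_iter hΓ α t).comp (measurable_const.prodMk measurable_id))
  norm_le t ξ := norm_normalize_le _
  congr t ξ ξ' h := by rw [iter_congr h]

/-- On the event of fast growth and small noise, the average Rayleigh quotient along the linear
iteration is close to the bottom of the spectrum. -/
lemma exists_bad_set_linear (hd : 1 ≤ d) (hA : RandomOperator D A H L) (hε : 0 < ε)
    (hεL : ε < L) (hεl : ε < l) (hlL : l ≤ L)
    (hHs : ∀ v w, inner ℝ (H v) w = inner ℝ v (H w)) (hu : H u = (-l) • u) (hu1 : ‖u‖ = 1)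
    (hH : ∀ v, -l * ‖v‖ ^ 2 ≤ inner ℝ v (H v)) (hell : 1 ≤ ell)
    (hlog : Real.log (200 * Real.sqrt d) ≤ 7 * ell) (hα : 0 < α)
    (hα1 : α * L ^ 2 * ell = ε / 400000) (hα2 : α * L ≤ 1 / 1000) {T : ℕ}
    (hT1 : 1010 * ell ≤ α * ε * T) (hT2 : α * ε * T ≤ 1010 * ell + 1) :
    ∃ B : Set (Vec d × (ℕ → Ξ)),
      ((stdGaussian (Vec d)).prod (Measure.infinitePi fun _ : ℕ => D)) B ≤
        ENNReal.ofReal (27 / 200) ∧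
      ∀ p ∉ B, (volume : Measure unitInterval)
        {u | ¬ (‖linearCandidate (fun ξ w => A ξ w) α T p.1 p.2 u‖ = 1 ∧
          inner ℝ (linearCandidate (fun ξ w => A ξ w) α T p.1 p.2 u)
            (H (linearCandidate (fun ξ w => A ξ w) α T p.1 p.2 u)) ≤ -(9 / 10) * ε)} ≤
          ENNReal.ofReal (1 / 5) := by
  have hl : 0 < l := hε.trans hεl
  have hL : 0 < L := hε.trans hεL
  have hT0 : (0 : ℝ) < T := by
    have : 0 < α * ε * T := by linarith
    exact pos_of_mul_pos_right this (by positivity)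
  have hTn : 0 < T := by exact_mod_cast hT0
  have hαL2 : α * L ^ 2 ≤ ε / 400000 := by
    have h0 : 0 ≤ α * L ^ 2 := by positivity
    nlinarith
  have hαl : α * l ≤ 1 / 1000 := (mul_le_mul_of_nonneg_left hlL hα.le).trans hα2
  -- the second-order terms accumulated over `T` steps
  have hn : α ^ 2 * L ^ 2 * T ≤ 1 / 200 := by
    have h1 : α * L ^ 2 * (α * ε * T) ≤ α * L ^ 2 * (1011 * ell) :=
      mul_le_mul_of_nonneg_left (by linarith) (by positivity)
    have h2 : ε * (α ^ 2 * L ^ 2 * T) ≤ ε * (1 / 200) := by nlinarith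
    exact le_of_mul_le_mul_left h2 hε
  have hθ : 100 * (T * L ^ 2) ≤ (l * T / 100) ^ 2 := by
    have h1 : α * L ^ 2 * (1010 * ell) ≤ α * L ^ 2 * (α * ε * T) :=
      mul_le_mul_of_nonneg_left hT1 (by positivity)
    have h2 : 1010 * (ε / 400000) ≤ ε * (α ^ 2 * L ^ 2 * T) := by nlinarith
    have h3 : 1010 * ell * (1010 * ell) ≤ α * ε * T * (α * ε * T) :=
      mul_le_mul hT1 hT1 (by positivity) (by positivity)
    have h4 : (10 : ℝ) ^ 6 * L ^ 2 * α ^ 2 ≤ α ^ 2 * ε ^ 2 * T := by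
      have h5 : (10 : ℝ) ^ 6 * L ^ 2 * α = 10 ^ 6 * (α * L ^ 2) := by ring
      have h6 : (10 : ℝ) ^ 6 * (α * L ^ 2) ≤ ε * (α * ε * T) := by
        have : (10 : ℝ) ^ 6 * (α * L ^ 2) ≤ 5 / 2 * ε := by linarith
        have h7 : ε * 1010 ≤ ε * (α * ε * T) :=
          mul_le_mul_of_nonneg_left (by linarith) hε.le
        linarith
      nlinarith
    have h5 : (10 : ℝ) ^ 6 * L ^ 2 ≤ ε ^ 2 * T := by
      have : α ^ 2 * ((10 : ℝ) ^ 6 * L ^ 2) ≤ α ^ 2 * (ε ^ 2 * T) := by linarith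
      exact le_of_mul_le_mul_left this (by positivity)
    have h6 : ε ^ 2 * T ≤ l ^ 2 * T :=
      mul_le_mul_of_nonneg_right (pow_le_pow_left₀ hε.le hεl.le 2) hT0.le
    have h7 : T * ((10 : ℝ) ^ 6 * L ^ 2) ≤ T * (l ^ 2 * T) :=
      mul_le_mul_of_nonneg_left (h5.trans h6) hT0.le
    nlinarith
  -- slow growth has probability at most `1/8`, large noise at most `1/100`
  have hgrow := measure_slow_growth_le hd hA hα.le hL.le hl.le hHs hu hu1 hH T hn
  have hnoise := prod_measure_noiseSum_ge hA hL.le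
    (v := fun g t ξ => normalize (iter (fun ξ w => A ξ w) α ξ g t))
    (fun g => isPredictable_normalize_iter hA.measurable_uncurry α g)
    (fun t => measurable_normalize.comp (measurable_iter hA.measurable_uncurry α t)) T
    (θ := l * T / 100) (by positivity) hθ
  refine ⟨_ ∪ _, (measure_union_le _ _).trans ((add_le_add hgrow hnoise).trans ?_), ?_⟩
  · rw [← ENNReal.ofReal_add (by norm_num) (by norm_num)]
    exact ENNReal.ofReal_le_ofReal (by norm_num)
  rintro ⟨g, ξ⟩ hp
  simp only [Set.mem_union, Set.mem_ofPred_eq, not_or, not_lt, not_le] at hp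
  obtain ⟨⟨hg, hgr⟩, hns⟩ := hp
  have hg0 : g ≠ 0 := fun h => hg (by simp [h])
  have hg' : 0 < ‖g‖ := norm_pos_iff.2 hg0
  set w : ℕ → Vec d := iter (fun ξ w => A ξ w) α ξ g with hw
  have hΓ := hA.nearLinear (κ := 0) (r := ∑ t ∈ Finset.range T, ‖w t‖) le_rfl
  have hwne : ∀ t, w t ≠ 0 := fun t => iter_ne_zero hΓ hα.le (by linarith) ξ hg0 t
  have hsum := sum_form_le (H := H) hΓ hα (by linarith) ξ hg0 T fun t ht =>
    Finset.single_le_sum (f := fun t => ‖w t‖) (fun _ _ => norm_nonneg _) (Finset.mem_range.2 ht)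
  have hsd : 0 < Real.sqrt d := Real.sqrt_pos.2 (by exact_mod_cast hd)
  have hgl : T * Real.log (1 + α * l) + Real.log ‖g‖ - Real.log (200 * Real.sqrt d) ≤
      Real.log ‖w T‖ := by
    have h := Real.log_le_log (by positivity) hgr
    rwa [Real.log_div (by positivity) (by positivity), Real.log_mul (by positivity) (by positivity),
      Real.log_pow] at h
  have hlog1 := le_log_one_add (by positivity) hαl
  have hmain : ∑ t ∈ Finset.range T, (inner ℝ (normalize (w t)) (H (normalize (w t))) : ℝ) ≤
      -(49 / 50) * l * T := by
    have h1 : (Real.log ‖g‖ - Real.log ‖w T‖) / α ≤ -(992 / 1000) * l * T := by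
      rw [div_le_iff₀ hα]
      have h2 : (T : ℝ) * (999 / 1000 * (α * l)) ≤ T * Real.log (1 + α * l) :=
        mul_le_mul_of_nonneg_left hlog1 hT0.le
      have h3 : α * ε * T ≤ α * l * T := by gcongr
      nlinarith
    have h2 : (T : ℝ) * (α * L ^ 2 / 2 + 0) ≤ T * (l / 800000) :=
      mul_le_mul_of_nonneg_left (by linarith) hT0.le
    simp only [real_inner_comm (H _)] at hsum ⊢
    unfold noiseSum at hns
    nlinarith
  have hp : ∀ t < T, -l ≤ (inner ℝ (normalize (w t)) (H (normalize (w t))) : ℝ) := by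
    intro t _
    have := hH (normalize (w t))
    rwa [norm_normalize (hwne t), one_pow, mul_one] at this
  refine (measure_mono ?_).trans (volume_bad_index_le hTn hl hp hmain)
  intro v hv hcon
  refine hv ⟨norm_normalize (hwne _), hcon.2.trans ?_⟩
  linarith

end LinearCandidate

/-! ### Good candidates: the nonlinear iteration stopped at its exit from a ball -/

section StoppedCandidate

variable {d : ℕ} {Ξ : Type*}

/-- The path `w` has left the ball of radius `r` at one of the times `1, …, t`. -/
def Exited (r : ℝ) (w : ℕ → Vec d) (t : ℕ) : Prop := ∃ s < t, r ≤ ‖w (s + 1)‖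

open scoped Classical in
/-- The number of steps made by time `t` if the path `w` is stopped at its exit. -/
def stepCount (r : ℝ) (w : ℕ → Vec d) : ℕ → ℕ
  | 0 => 0
  | t + 1 => if Exited r w t then stepCount r w t else t + 1

lemma exited_succ {r : ℝ} {w : ℕ → Vec d} {t : ℕ} :
    Exited r w (t + 1) ↔ Exited r w t ∨ r ≤ ‖w (t + 1)‖ := by
  unfold Exited
  constructor
  · rintro ⟨s, hs, h⟩
    rcases Nat.lt_succ_iff_lt_or_eq.1 hs with h' | rfl
    · exact Or.inl ⟨s, h', h⟩
    · exact Or.inr h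
  · rintro (⟨s, hs, h⟩ | h)
    · exact ⟨s, by omega, h⟩
    · exact ⟨t, by omega, h⟩

lemma stepCount_of_not_exited {r : ℝ} {w : ℕ → Vec d} {t : ℕ} (h : ¬ Exited r w t) :
    stepCount r w t = t := by
  cases t with
  | zero => rfl
  | succ t =>
    rw [exited_succ, not_or] at h
    simp [stepCount, h.1]

lemma stepCount_of_exited {r : ℝ} {w : ℕ → Vec d} {t : ℕ} (h : Exited r w t) :
    ∃ s < t, stepCount r w t = s + 1 ∧ r ≤ ‖w (s + 1)‖ ∧ ¬ Exited r w s := by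
  induction t with
  | zero => obtain ⟨s, hs, _⟩ := h; omega
  | succ t ih =>
    by_cases ht : Exited r w t
    · obtain ⟨s, hs, h1, h2⟩ := ih ht
      exact ⟨s, by omega, by simp [stepCount, ht, h1], h2⟩
    · refine ⟨t, by omega, by simp [stepCount, ht], ?_, ht⟩
      exact (exited_succ.1 h).resolve_left ht

open scoped Classical in
/-- A random one of the directions before the exit of the path from the ball; `0` if there is no
exit within `T` steps. The iterates are numbered backwards, as in the list of past iterates. -/
def stoppedCandidate (r : ℝ) (w : ℕ → Vec d) (T : ℕ) (u : unitInterval) : Vec d :=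
  if Exited r w T ∧ ⌊(u : ℝ) * stepCount r w T⌋₊ < stepCount r w T then
    normalize (w (stepCount r w T - 1 - ⌊(u : ℝ) * stepCount r w T⌋₊))
  else 0

lemma stoppedCandidate_unit (r : ℝ) (w : ℕ → Vec d) (T : ℕ) (u : unitInterval) :
    stoppedCandidate r w T u = 0 ∨ ‖stoppedCandidate r w T u‖ = 1 := by
  unfold stoppedCandidate
  split_ifs
  · by_cases h : w (stepCount r w T - 1 - ⌊(u : ℝ) * stepCount r w T⌋₊) = 0
    · left; rw [h, normalize_zero]
    · right; exact norm_normalize h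
  · exact Or.inl rfl

lemma measurableSet_exited {Ω : Type*} [MeasurableSpace Ω] {w : Ω → ℕ → Vec d}
    (hw : ∀ t, Measurable fun ω => w ω t) (r : ℝ) (t : ℕ) :
    MeasurableSet {ω | Exited r (w ω) t} := by
  have : {ω | Exited r (w ω) t} = ⋃ s ∈ Finset.range t, {ω | r ≤ ‖w ω (s + 1)‖} := by
    ext ω; simp [Exited]
  rw [this]
  exact Finset.measurableSet_biUnion _ fun s _ => measurableSet_le measurable_const (hw _).norm

lemma measurable_stepCount {Ω : Type*} [MeasurableSpace Ω] {w : Ω → ℕ → Vec d}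
    (hw : ∀ t, Measurable fun ω => w ω t) (r : ℝ) (t : ℕ) :
    Measurable fun ω => stepCount r (w ω) t := by
  induction t with
  | zero => exact measurable_const
  | succ t ih =>
    simp only [stepCount]
    exact Measurable.ite (measurableSet_exited hw r t) ih measurable_const

lemma measurable_stoppedCandidate {Ω : Type*} [MeasurableSpace Ω] {w : Ω → ℕ → Vec d}
    {u : Ω → unitInterval} (hw : ∀ t, Measurable fun ω => w ω t) (hu : Measurable u) (r : ℝ)
    (T : ℕ) : Measurable fun ω => stoppedCandidate r (w ω) T (u ω) := by
  have hτ := measurable_stepCount hw r T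
  have hi : Measurable fun ω => ⌊(u ω : ℝ) * stepCount r (w ω) T⌋₊ :=
    Nat.measurable_floor.comp ((measurable_subtype_coe.comp hu).mul
      ((measurable_of_countable (fun n : ℕ => (n : ℝ))).comp hτ))
  unfold stoppedCandidate
  refine Measurable.ite ((measurableSet_exited hw r T).inter (measurableSet_lt hi hτ)) ?_
    measurable_const
  exact measurable_normalize.comp (measurable_comp_nat (W := fun n ω => w ω n) hw
    ((hτ.sub_const 1).sub hi))

open scoped Classical in
/-- The directions of the path, set to `0` once it has left the ball. -/
def stoppedDirection (r : ℝ) (w : ℕ → Vec d) (t : ℕ) : Vec d :=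
  if Exited r w t then 0 else normalize (w t)

variable {A : Ξ → Vec d →L[ℝ] Vec d} {H : Vec d →L[ℝ] Vec d} {Γ : Ξ → Vec d → Vec d}
  {L κ r σ α ε l ell : ℝ} {u : Vec d}

lemma Exited.mono {r : ℝ} {w : ℕ → Vec d} {s t : ℕ} (h : Exited r w s) (hst : s ≤ t) :
    Exited r w t := by
  obtain ⟨i, hi, h⟩ := h
  exact ⟨i, by omega, h⟩

lemma norm_lt_of_not_exited {r : ℝ} {w : ℕ → Vec d} {t : ℕ} (h0 : ‖w 0‖ < r)
    (h : ¬ Exited r w t) {s : ℕ} (hs : s ≤ t) : ‖w s‖ < r := by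
  cases s with
  | zero => exact h0
  | succ s =>
    by_contra hcon
    exact h ⟨s, by omega, not_lt.1 hcon⟩

/-- After the exit the stopped directions vanish, so that the noise up to the fixed time `n` is the
noise up to the exit. -/
lemma noiseSum_stoppedDirection {w : (ℕ → Ξ) → ℕ → Vec d} {ξ : ℕ → Ξ} {n s : ℕ} (hsn : s < n)
    (hr : r ≤ ‖w ξ (s + 1)‖) (hs : ¬ Exited r (w ξ) s) :
    noiseSum A H (fun t ξ => stoppedDirection r (w ξ) t) n ξ =
      ∑ t ∈ Finset.range (s + 1), formNoise A H (ξ t) (normalize (w ξ t)) := by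
  unfold noiseSum
  have hsub : Finset.range (s + 1) ⊆ Finset.range n := Finset.range_subset_range.2 (by omega)
  rw [← Finset.sum_subset hsub]
  · refine Finset.sum_congr rfl fun t ht => ?_
    have ht' : t ≤ s := Nat.lt_succ_iff.1 (Finset.mem_range.1 ht)
    have e : stoppedDirection r (w ξ) t = normalize (w ξ t) :=
      if_neg fun h => hs (h.mono ht')
    exact congrArg _ e
  · intro t _ ht
    have ht' : s < t := by
      rw [Finset.mem_range] at ht; omega
    have he : Exited r (w ξ) t := ⟨s, ht', hr⟩
    have e : stoppedDirection r (w ξ) t = 0 := if_pos he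
    refine (congrArg (formNoise A H (ξ t)) e).trans ?_
    simp [formNoise]

variable [MeasurableSpace Ξ] {D : Measure Ξ}

/-- Inside the ball the nonlinear iteration stays within `r` of the linear one, which by time `n`
has norm at least `2r`. -/
lemma exited_of_fast_growth (hΓ : IsNearLinear A Γ L κ r) (hA : RandomOperator D A H L)
    (hα : 0 < α) (hL : 0 < L) (hκ : 0 ≤ κ) (hσ : 0 < σ) (hr : r = σ * Real.exp (1000 * ell))
    (hell : 1 ≤ ell) {n T : ℕ} (hnT : n ≤ T) (hκT : κ * (α * T * (1 + α * L) ^ T) < 1)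
    {ξ : ℕ → Ξ} {w₀ : Vec d} (hw₀ : ‖w₀‖ = σ)
    (hgrow : 2 * r ≤ ‖iter (fun ξ w => A ξ w) α ξ w₀ n‖) :
    Exited r (iter Γ α ξ w₀) n := by
  by_contra hne
  have hσr : σ < r := by
    rw [hr]
    exact lt_mul_of_one_lt_right hσ (Real.one_lt_exp_iff.2 (by linarith))
  have h0 : ‖iter Γ α ξ w₀ 0‖ < r := by simpa [iter, hw₀] using hσr
  have hr0 : 0 < r := hσ.trans hσr
  have h1 := norm_iter_sub_linear_le hΓ hA.norm_le hα.le hL.le hκ hr0.le ξ w₀ n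
    fun t ht => (norm_lt_of_not_exited h0 hne ht.le).le
  have h2 := norm_lt_of_not_exited h0 hne le_rfl
  have h3 : α * κ * r * (n * (1 + α * L) ^ n) ≤ r * (κ * (α * T * (1 + α * L) ^ T)) := by
    have h4 : (n : ℝ) * (1 + α * L) ^ n ≤ T * (1 + α * L) ^ T := by
      have : 1 ≤ 1 + α * L := by nlinarith [mul_pos hα hL]
      gcongr
    calc _ ≤ α * κ * r * (T * (1 + α * L) ^ T) := by gcongr
      _ = _ := by ring
  have h5 : r * (κ * (α * T * (1 + α * L) ^ T)) < r * 1 := mul_lt_mul_of_pos_left hκT hr0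
  have h6 := norm_sub_norm_le (iter (fun ξ w => A ξ w) α ξ w₀ n) (iter Γ α ξ w₀ n)
  rw [norm_sub_rev] at h6
  linarith

lemma measurable_iter_normalize (hΓ : Measurable (Function.uncurry Γ)) (α σ : ℝ) (t : ℕ) :
    Measurable fun p : Vec d × (ℕ → Ξ) => iter Γ α p.2 (σ • normalize p.1) t :=
  (measurable_iter hΓ α t).comp
    (((measurable_normalize.comp measurable_fst).const_smul σ).prodMk measurable_snd)

lemma measurable_stoppedDirection {Ω : Type*} [MeasurableSpace Ω] {w : Ω → ℕ → Vec d}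
    (hw : ∀ t, Measurable fun ω => w ω t) (r : ℝ) (t : ℕ) :
    Measurable fun ω => stoppedDirection r (w ω) t := by
  unfold stoppedDirection
  exact Measurable.ite (measurableSet_exited hw r t) measurable_const
    (measurable_normalize.comp (hw t))

lemma norm_stoppedDirection_le (r : ℝ) (w : ℕ → Vec d) (t : ℕ) : ‖stoppedDirection r w t‖ ≤ 1 := by
  unfold stoppedDirection
  split_ifs
  · rw [norm_zero]; exact zero_le_one
  · exact norm_normalize_le _

lemma isPredictable_stoppedDirection (hΓ : Measurable (Function.uncurry Γ)) (α r : ℝ)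
    (w₀ : Vec d) : IsPredictable fun t ξ => stoppedDirection r (iter Γ α ξ w₀) t where
  meas t := by
    have h : ∀ t, Measurable fun ξ => iter Γ α ξ w₀ t := fun t =>
      (measurable_iter hΓ α t).comp (measurable_const.prodMk measurable_id)
    exact measurable_stoppedDirection h r t
  norm_le t ξ := norm_stoppedDirection_le r _ t
  congr t ξ ξ' h := by
    have e : ∀ s ≤ t, iter Γ α ξ w₀ s = iter Γ α ξ' w₀ s :=
      fun s hs => iter_congr fun i hi => h i (by omega)
    have e2 : Exited r (iter Γ α ξ w₀) t ↔ Exited r (iter Γ α ξ' w₀) t := by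
      unfold Exited
      refine exists_congr fun s => and_congr_right fun hs => ?_
      rw [e (s + 1) (by omega)]
    change stoppedDirection r (iter Γ α ξ w₀) t = stoppedDirection r (iter Γ α ξ' w₀) t
    unfold stoppedDirection
    rw [e t le_rfl]
    by_cases h' : Exited r (iter Γ α ξ' w₀) t
    · rw [if_pos h', if_pos (e2.2 h')]
    · rw [if_neg h', if_neg fun h => h' (e2.1 h)]

/-- The time by which the linear iteration has grown by the factor `e^{1000 ell}` despite a loss of
order `√d`: it is inversely proportional to the unknown curvature `l`. -/
lemma exists_exit_time (hell : 1 ≤ ell) (hα : 0 < α) (hl : 0 < l) (hαl : α * l ≤ 1 / 1000) :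
    ∃ n : ℕ, 1008 * ell ≤ n * Real.log (1 + α * l) ∧ n * (α * l) ≤ 1010 * ell := by
  have hαl0 : 0 < α * l := by positivity
  have hlog := le_log_one_add hαl0.le hαl
  have hpos : 0 < Real.log (1 + α * l) := Real.log_pos (by linarith)
  refine ⟨⌈1008 * ell / Real.log (1 + α * l)⌉₊, ?_, ?_⟩
  · rw [← div_le_iff₀ hpos]
    exact Nat.le_ceil _
  · have h1 := (Nat.ceil_lt_add_one (show 0 ≤ 1008 * ell / Real.log (1 + α * l) by positivity)).le
    have h2 : 1008 * ell / Real.log (1 + α * l) * (999 / 1000 * (α * l)) ≤ 1008 * ell := by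
      calc _ ≤ 1008 * ell / Real.log (1 + α * l) * Real.log (1 + α * l) :=
            mul_le_mul_of_nonneg_left hlog (by positivity)
        _ = _ := by field_simp
    have h3 := mul_le_mul_of_nonneg_right h1 hαl0.le
    linarith

/-- On the event of fast growth and small noise, the iteration leaves the ball so early that the
average Rayleigh quotient before the exit has to be close to the bottom of the spectrum. -/
lemma volume_bad_stoppedCandidate_le (hA : RandomOperator D A H L)
    (hΓ : IsNearLinear A Γ L κ r) (hε : 0 < ε) (hεL : ε < L) (hεl : ε < l)
    (hH : ∀ v, -l * ‖v‖ ^ 2 ≤ inner ℝ v (H v)) (hell : 1 ≤ ell) (hα : 0 < α)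
    (hαL2 : α * L ^ 2 ≤ ε / 400000) (hα2 : α * L ≤ 1 / 1000) {n T : ℕ} (hnT : n ≤ T)
    (hn2 : n * (α * l) ≤ 1010 * ell) (hκ : 0 ≤ κ) (hκε : κ ≤ ε / 1000)
    (hκT : κ * (α * T * (1 + α * L) ^ T) < 1) (hσ : 0 < σ)
    (hr : r = σ * Real.exp (1000 * ell)) {w₀ : Vec d} (hw₀ : ‖w₀‖ = σ) {ξ : ℕ → Ξ}
    (hlin : 2 * r ≤ ‖iter (fun ξ w => A ξ w) α ξ w₀ n‖)
    (hns : |noiseSum A H (fun t ξ => stoppedDirection r (iter Γ α ξ w₀) t) n ξ| < ell / α) :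
    (volume : Measure unitInterval)
        {u | ¬ (‖stoppedCandidate r (iter Γ α ξ w₀) T u‖ = 1 ∧
          inner ℝ (stoppedCandidate r (iter Γ α ξ w₀) T u)
            (H (stoppedCandidate r (iter Γ α ξ w₀) T u)) ≤ -(9 / 10) * ε)} ≤
          ENNReal.ofReal (1 / 5) := by
  have hl : 0 < l := hε.trans hεl
  have hL : 0 < L := hε.trans hεL
  have hw₀ne : w₀ ≠ 0 := norm_pos_iff.1 (by rw [hw₀]; exact hσ)
  have hex := exited_of_fast_growth hΓ hA hα hL hκ hσ hr hell hnT hκT hw₀ hlin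
  obtain ⟨s, hsT, hτ, hrs, hsne⟩ := stepCount_of_exited (hex.mono hnT)
  have hsn : s < n := by
    by_contra hcon
    exact hsne (hex.mono (not_lt.1 hcon))
  rw [noiseSum_stoppedDirection (w := fun ξ => iter Γ α ξ w₀) hsn hrs hsne] at hns
  set w : ℕ → Vec d := iter Γ α ξ w₀ with hw
  have hσr : σ < r := by
    rw [hr]
    exact lt_mul_of_one_lt_right hσ (Real.one_lt_exp_iff.2 (by linarith))
  have hr0 : 0 < r := hσ.trans hσr
  have hwne : ∀ t, w t ≠ 0 := fun t => iter_ne_zero hΓ hα.le (by linarith) ξ hw₀ne t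
  have hw0r : ‖w 0‖ < r := by
    have e : w 0 = w₀ := rfl
    rw [e, hw₀]
    exact hσr
  have hsum := sum_form_le (H := H) hΓ hα (by linarith) ξ hw₀ne (s + 1) fun t ht =>
    (norm_lt_of_not_exited hw0r hsne (Nat.lt_succ_iff.1 ht)).le
  have hmain : ∑ t ∈ Finset.range (s + 1),
      (inner ℝ (normalize (w t)) (H (normalize (w t))) : ℝ) ≤
      -(49 / 50) * l * ((s + 1 : ℕ) : ℝ) := by
    have hsn' : ((s + 1 : ℕ) : ℝ) ≤ n := by exact_mod_cast hsn
    have hs0 : (0 : ℝ) ≤ ((s + 1 : ℕ) : ℝ) := Nat.cast_nonneg _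
    have h0 : Real.log σ + 1000 * ell ≤ Real.log ‖w (s + 1)‖ := by
      have h := Real.log_le_log hr0 hrs
      rwa [hr, Real.log_mul hσ.ne' (Real.exp_ne_zero _), Real.log_exp] at h
    have h1 : (Real.log ‖w₀‖ - Real.log ‖w (s + 1)‖) / α ≤ -(1000 * (ell / α)) := by
      rw [hw₀, div_le_iff₀ hα]
      have : -(1000 * (ell / α)) * α = -(1000 * ell) := by field_simp
      rw [this]
      linarith
    have h2 : ((s + 1 : ℕ) : ℝ) * (α * L ^ 2 / 2 + κ) ≤ ((s + 1 : ℕ) : ℝ) * (l / 900) :=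
      mul_le_mul_of_nonneg_left (by linarith) hs0
    have h3 : ((s + 1 : ℕ) : ℝ) * l ≤ 1010 * (ell / α) := by
      have h4 : (n : ℝ) * l ≤ 1010 * (ell / α) := by
        rw [← mul_div_assoc, le_div_iff₀ hα]
        linarith
      exact le_trans (by gcongr) h4
    simp only [real_inner_comm (H _)] at hsum ⊢
    nlinarith
  have hp : ∀ t < s + 1, -l ≤ (inner ℝ (normalize (w (s + 1 - 1 - t)))
      (H (normalize (w (s + 1 - 1 - t)))) : ℝ) := by
    intro t _
    have := hH (normalize (w (s + 1 - 1 - t)))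
    rwa [norm_normalize (hwne _), one_pow, mul_one] at this
  refine (measure_mono ?_).trans (volume_bad_index_le (Nat.succ_pos s) hl hp ?_)
  · intro v hv hcon
    refine hv ?_
    unfold stoppedCandidate
    rw [hτ, if_pos ⟨hex.mono hnT, hcon.1⟩]
    refine ⟨norm_normalize (hwne _), hcon.2.trans ?_⟩
    linarith
  · rw [Finset.sum_range_reflect
      (fun t => (inner ℝ (normalize (w t)) (H (normalize (w t))) : ℝ)) (s + 1)]
    exact hmain

variable [IsProbabilityMeasure D]

/-- With constant probability the stopped iteration grows fast and meets little noise. Fast growth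
over the time `n` of `exists_exit_time`, which depends on the unknown curvature `l`, forces the exit
before time `n`, so that the noise need only be controlled up to `n`. -/
lemma exists_bad_set_stopped (hd : 1 ≤ d) (hA : RandomOperator D A H L)
    (hΓ : IsNearLinear A Γ L κ r) (hε : 0 < ε) (hεL : ε < L) (hεl : ε < l) (hlL : l ≤ L)
    (hHs : ∀ v w, inner ℝ (H v) w = inner ℝ v (H w)) (hu : H u = (-l) • u) (hu1 : ‖u‖ = 1)
    (hH : ∀ v, -l * ‖v‖ ^ 2 ≤ inner ℝ v (H v)) (hell : 1 ≤ ell)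
    (hlog : Real.log (400 * Real.sqrt d) ≤ 8 * ell) (hα : 0 < α)
    (hα1 : α * L ^ 2 * ell = ε / 400000) (hα2 : α * L ≤ 1 / 1000) {T : ℕ}
    (hT1 : 1010 * ell ≤ α * ε * T) (hκ : 0 ≤ κ) (hκε : κ ≤ ε / 1000)
    (hκT : κ * (α * T * (1 + α * L) ^ T) < 1) (hσ : 0 < σ)
    (hr : r = σ * Real.exp (1000 * ell)) :
    ∃ B : Set (Vec d × (ℕ → Ξ)),
      ((stdGaussian (Vec d)).prod (Measure.infinitePi fun _ : ℕ => D)) B ≤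
        ENNReal.ofReal (27 / 200) ∧
      ∀ p ∉ B, (volume : Measure unitInterval)
        {u | ¬ (‖stoppedCandidate r (iter Γ α p.2 (σ • normalize p.1)) T u‖ = 1 ∧
          inner ℝ (stoppedCandidate r (iter Γ α p.2 (σ • normalize p.1)) T u)
            (H (stoppedCandidate r (iter Γ α p.2 (σ • normalize p.1)) T u)) ≤ -(9 / 10) * ε)} ≤
          ENNReal.ofReal (1 / 5) := by
  have hl : 0 < l := hε.trans hεl
  have hL : 0 < L := hε.trans hεL
  have hαl : α * l ≤ 1 / 1000 := (mul_le_mul_of_nonneg_left hlL hα.le).trans hα2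
  have hαL2 : α * L ^ 2 ≤ ε / 400000 := by
    have h0 : 0 ≤ α * L ^ 2 := by positivity
    nlinarith
  obtain ⟨n, hn1, hn2⟩ := exists_exit_time hell hα hl hαl
  have hn0 : (0 : ℝ) ≤ n := Nat.cast_nonneg n
  have hnT : n ≤ T := by
    have h1 : (α * l) * n ≤ (α * l) * T := by
      have : α * ε * T ≤ α * l * T := by gcongr
      linarith
    exact_mod_cast le_of_mul_le_mul_left h1 (by positivity)
  have hn : α ^ 2 * L ^ 2 * n ≤ 1 / 200 := by
    have h0 : n * (α * ε) ≤ 1010 * ell := le_trans (by gcongr) hn2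
    have h1 : α * L ^ 2 * (n * (α * ε)) ≤ α * L ^ 2 * (1010 * ell) :=
      mul_le_mul_of_nonneg_left h0 (by positivity)
    have h2 : ε * (α ^ 2 * L ^ 2 * n) ≤ ε * (1 / 200) := by nlinarith
    exact le_of_mul_le_mul_left h2 hε
  have hθ : 100 * (n * L ^ 2) ≤ (ell / α) ^ 2 := by
    rw [div_pow, le_div_iff₀ (by positivity)]
    nlinarith
  -- slow growth has probability at most `1/8`, large noise at most `1/100`
  have hgrow := measure_slow_growth_le hd hA hα.le hL.le hl.le hHs hu hu1 hH n hn
  have hnoise := prod_measure_noiseSum_ge hA hL.le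
    (v := fun g t ξ => stoppedDirection r (iter Γ α ξ (σ • normalize g)) t)
    (fun g => isPredictable_stoppedDirection hΓ.meas α r _)
    (fun t => measurable_stoppedDirection (measurable_iter_normalize hΓ.meas α σ) r t) n
    (θ := ell / α) (by positivity) hθ
  refine ⟨_ ∪ _, (measure_union_le _ _).trans ((add_le_add hgrow hnoise).trans ?_), ?_⟩
  · rw [← ENNReal.ofReal_add (by norm_num) (by norm_num)]
    exact ENNReal.ofReal_le_ofReal (by norm_num)
  rintro ⟨g, ξ⟩ hp
  simp only [Set.mem_union, Set.mem_ofPred_eq, not_or, not_lt, not_le] at hp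
  obtain ⟨⟨hg, hgr⟩, hns⟩ := hp
  have hg0 : g ≠ 0 := fun h => hg (by simp [h])
  have hg' : 0 < ‖g‖ := norm_pos_iff.2 hg0
  have hw₀ : ‖σ • normalize g‖ = σ := by
    rw [norm_smul, norm_normalize hg0, mul_one, Real.norm_of_nonneg hσ.le]
  have hsd : 0 < Real.sqrt d := Real.sqrt_pos.2 (by exact_mod_cast hd)
  have hlin : 2 * r ≤ ‖iter (fun ξ w => A ξ w) α ξ (σ • normalize g) n‖ := by
    unfold normalize
    rw [smul_smul, iter_smul, norm_smul, Real.norm_of_nonneg (by positivity)]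
    have h1 : Real.exp (1000 * ell) * (400 * Real.sqrt d) ≤ (1 + α * l) ^ n := by
      have h2 : 400 * Real.sqrt d ≤ Real.exp (8 * ell) := by
        rw [← Real.log_le_iff_le_exp (by positivity)]; exact hlog
      calc _ ≤ Real.exp (1000 * ell) * Real.exp (8 * ell) := by gcongr
        _ = Real.exp (1008 * ell) := by rw [← Real.exp_add]; ring_nf
        _ ≤ Real.exp (n * Real.log (1 + α * l)) := Real.exp_le_exp.2 hn1
        _ = (1 + α * l) ^ n := by
          rw [Real.exp_nat_mul, Real.exp_log (by positivity)]
    calc 2 * r = σ * ‖g‖⁻¹ * (Real.exp (1000 * ell) * (400 * Real.sqrt d) * ‖g‖ /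
          (200 * Real.sqrt d)) := by rw [hr]; field_simp; ring
      _ ≤ σ * ‖g‖⁻¹ * ((1 + α * l) ^ n * ‖g‖ / (200 * Real.sqrt d)) := by gcongr
      _ ≤ _ := by gcongr
  exact volume_bad_stoppedCandidate_le hA hΓ hε hεL hεl hH hell hα hαL2 hα2 hnT hn2 hκ hκε hκT hσ
    hr hw₀ hlin hns

end StoppedCandidate

/-! ### The programs in closed form -/

section OjaProgram

variable {d : ℕ} {Ξ : Type*}

lemma ojaIterate_val (O : Ξ → Vec d → Vec d) (η : ℝ) (ξ : ℕ → Ξ) (w₀ : Vec d) (t : ℕ) :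
    (ojaIterate O η ξ w₀ t).val = iter O η ξ w₀ t := by
  induction t with
  | zero => rfl
  | succ t ih => simp [ojaIterate, iter, query, ih]

lemma ojaIterate_calls (O : Ξ → Vec d → Vec d) (η : ℝ) (ξ : ℕ → Ξ) (w₀ : Vec d) (t : ℕ) :
    (ojaIterate O η ξ w₀ t).calls = t := by
  induction t with
  | zero => rfl
  | succ t ih => simp [ojaIterate, query, ih]

lemma hvpFormSum_val (O : Ξ → Vec d → Vec d) (ξ : ℕ → Ξ) (v : Vec d) (m : ℕ) :
    (hvpFormSum O ξ v m).val = ∑ i ∈ Finset.range m, inner ℝ v (O (ξ i) v) := by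
  induction m with
  | zero => simp [hvpFormSum]
  | succ m ih => simp [hvpFormSum, query, ih, Finset.sum_range_succ]

lemma hvpFormSum_calls (O : Ξ → Vec d → Vec d) (ξ : ℕ → Ξ) (v : Vec d) (m : ℕ) :
    (hvpFormSum O ξ v m).calls = m := by
  induction m with
  | zero => rfl
  | succ m ih => simp [hvpFormSum, query, ih]

lemma floor_unitInterval_mul_le (u : unitInterval) (n : ℕ) : ⌊(u : ℝ) * n⌋₊ ≤ n :=
  Nat.floor_le_of_le (mul_le_of_le_one_left (Nat.cast_nonneg n) u.2.2)

lemma ojaTrial_calls_le (p : OjaParams) (ε : ℝ) (O : Ξ → Vec d → Vec d) (seed : TrialSeed d Ξ) :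
    (ojaTrial p ε O seed).calls ≤ p.steps + p.tests := by
  obtain ⟨g, ξ, u, ξ'⟩ := seed
  simp only [ojaTrial, calls_bind, ojaIterate_calls, hvpFormSum_calls]
  have h := floor_unitInterval_mul_le u p.steps
  split_ifs <;> simp <;> omega

lemma ojaTrial_val (p : OjaParams) {ε : ℝ} (hε : 0 < ε) (O : Ξ → Vec d → Vec d)
    (seed : TrialSeed d Ξ) : (ojaTrial p ε O seed).val =
      toOption (trialOutcome O 1 ε p.tests (linearCandidate O p.stepSize p.steps) seed) := by
  obtain ⟨g, ξ, u, ξ'⟩ := seed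
  simp only [ojaTrial, val_bind, ojaIterate_val, hvpFormSum_val, trialOutcome]
  change (if (∑ i ∈ Finset.range p.tests, inner ℝ (linearCandidate O p.stepSize p.steps g ξ u)
      (O (ξ' i) (linearCandidate O p.stepSize p.steps g ξ u))) / (p.tests : ℝ) ≤ -(3 * ε / 4)
      then pure (some (linearCandidate O p.stepSize p.steps g ξ u)) else pure none :
        Counted (Option (Vec d))).val = _
  generalize linearCandidate O p.stepSize p.steps g ξ u = v
  have e : ∀ i, testStat O 1 (ξ' i) v = inner ℝ v (O (ξ' i) v) := fun i => by simp [testStat]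
  by_cases hv : v = 0
  -- the statistic of the zero vector is `0` and fails the test
  · subst hv
    rw [if_neg (by simp; linarith)]
    simp [tested, Accepts, toOption]
  · simp only [tested, Accepts, e, ne_eq, hv, not_false_eq_true, true_and]
    split_ifs <;> simp [toOption, hv]

end OjaProgram

section NeonProgram

variable {d : ℕ} {Ξ : Type*}

/-- The oracle `w ↦ ∇F(x + w; ξ) - ∇F(x; ξ)` in coordinates centred at `x`. -/
def shiftedOracle (G : Ξ → Vec d → Vec d) (x : Vec d) (ξ : Ξ) (w : Vec d) : Vec d :=
  G ξ (x + w) - G ξ x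

/-- The state of the stopped iteration in terms of the path without stopping. -/
lemma neonRun_val (G : Ξ → Vec d → Vec d) (x : Vec d) (η r : ℝ) (ξ : ℕ → Ξ) (w₀ : Vec d) (t : ℕ) :
    (neonRun G x η r ξ (x + w₀) t).val.current =
        x + iter (shiftedOracle G x) η ξ w₀ (stepCount r (iter (shiftedOracle G x) η ξ w₀) t) ∧
      (neonRun G x η r ξ (x + w₀) t).val.past =
        (List.range (stepCount r (iter (shiftedOracle G x) η ξ w₀) t)).reverse.map
          (fun i => x + iter (shiftedOracle G x) η ξ w₀ i) ∧
      ((neonRun G x η r ξ (x + w₀) t).val.exited = true ↔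
        Exited r (iter (shiftedOracle G x) η ξ w₀) t) := by
  set w := iter (shiftedOracle G x) η ξ w₀ with hw
  induction t with
  | zero => exact ⟨rfl, rfl, by simp [neonRun, Exited]⟩
  | succ t ih =>
    obtain ⟨h1, h2, h3⟩ := ih
    simp only [neonRun, val_bind]
    generalize (neonRun G x η r ξ (x + w₀) t).val = S at h1 h2 h3 ⊢
    by_cases he : Exited r w t
    · have e : stepCount r w (t + 1) = stepCount r w t := if_pos he
      rw [e, exited_succ]
      simp only [neonStep, h3.2 he, if_true]
      exact ⟨h1, h2, by simp [h3.2 he, he]⟩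
    · have e : stepCount r w (t + 1) = t + 1 := if_neg he
      have hf : ¬ S.exited = true := fun h => he (h3.1 h)
      rw [stepCount_of_not_exited he] at h1 h2
      rw [e, exited_succ]
      have hc : S.current - η • (G (ξ t) S.current - G (ξ t) x) = x + w (t + 1) := by
        rw [h1, hw]
        simp only [iter, shiftedOracle]
        abel
      simp only [neonStep, hf, if_false, val_bind, query, val_pure, Bool.false_eq_true, hc]
      refine ⟨trivial, ?_, ?_⟩
      · rw [h1, h2, List.range_succ]
        simp
      · simp [he]

lemma neonRun_calls_le (G : Ξ → Vec d → Vec d) (x : Vec d) (η r : ℝ) (ξ : ℕ → Ξ) (y₀ : Vec d)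
    (t : ℕ) : (neonRun G x η r ξ y₀ t).calls ≤ 2 * t := by
  induction t with
  | zero => exact le_rfl
  | succ t ih =>
    simp only [neonRun, calls_bind]
    have h : ∀ S, (neonStep G x η r (ξ t) S).calls ≤ 2 := by
      intro S
      unfold neonStep
      split_ifs <;> simp [query]
    have := h (neonRun G x η r ξ y₀ t).val
    omega

lemma gradFormSum_val (G : Ξ → Vec d → Vec d) (x : Vec d) (ξ : ℕ → Ξ) (v : Vec d) (m : ℕ) :
    (gradFormSum G x ξ v m).val =
      ∑ i ∈ Finset.range m, inner ℝ v (shiftedOracle G x (ξ i) v) := by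
  induction m with
  | zero => simp [gradFormSum]
  | succ m ih => simp [gradFormSum, query, ih, Finset.sum_range_succ, shiftedOracle]

lemma gradFormSum_calls (G : Ξ → Vec d → Vec d) (x : Vec d) (ξ : ℕ → Ξ) (v : Vec d) (m : ℕ) :
    (gradFormSum G x ξ v m).calls = 2 * m := by
  induction m with
  | zero => rfl
  | succ m ih => simp [gradFormSum, query, ih]; omega

lemma getD_map_reverse_range (f : ℕ → Vec d) (n i : ℕ) (x : Vec d) :
    ((List.range n).reverse.map f).getD i x = if i < n then f (n - 1 - i) else x := by
  split_ifs with h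
  · rw [List.getD_eq_getElem _ _ (by simpa using h)]
    simp
  · rw [List.getD_eq_default _ _ (by simpa using h)]

lemma neonWeak_calls_le (p : NeonParams) (G : Ξ → Vec d → Vec d) (x g : Vec d) (ξ : ℕ → Ξ)
    (u : unitInterval) : (neonWeak p G x g ξ u).calls ≤ 2 * p.steps := by
  have h := neonRun_calls_le G x p.stepSize p.exitRadius ξ (x + p.perturbation • normalize g)
    p.steps
  simp only [neonWeak, calls_bind]
  split_ifs <;> simpa using h

/-- A candidate `0` and the absence of a candidate both end in the rejection of the trial. -/
lemma neonWeak_val (p : NeonParams) (G : Ξ → Vec d → Vec d) (x g : Vec d) (ξ : ℕ → Ξ)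
    (u : unitInterval) :
    (neonWeak p G x g ξ u).val = some (stoppedCandidate p.exitRadius
        (iter (shiftedOracle G x) p.stepSize ξ (p.perturbation • normalize g)) p.steps u) ∨
    (neonWeak p G x g ξ u).val = none ∧ stoppedCandidate p.exitRadius
        (iter (shiftedOracle G x) p.stepSize ξ (p.perturbation • normalize g)) p.steps u = 0 := by
  obtain ⟨-, h2, h3⟩ := neonRun_val G x p.stepSize p.exitRadius ξ (p.perturbation • normalize g)
    p.steps
  simp only [neonWeak, val_bind]
  generalize (neonRun G x p.stepSize p.exitRadius ξ (x + p.perturbation • normalize g)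
    p.steps).val = S at h2 h3 ⊢
  generalize iter (shiftedOracle G x) p.stepSize ξ (p.perturbation • normalize g) = w at h2 h3 ⊢
  by_cases he : Exited p.exitRadius w p.steps
  · left
    rw [if_pos (h3.2 he), h2, getD_map_reverse_range]
    simp only [val_pure, List.length_map, List.length_reverse, List.length_range, Option.some.injEq,
      stoppedCandidate, he, true_and]
    split_ifs
    · rw [add_sub_cancel_left]
    · rw [sub_self, normalize_zero]
  · right
    rw [if_neg fun h => he (h3.1 h)]
    exact ⟨rfl, if_neg fun h => he h.1⟩

lemma neonTrial_calls_le (p : NeonParams) (ε : ℝ) (G : Ξ → Vec d → Vec d) (x : Vec d)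
    (seed : TrialSeed d Ξ) : (neonTrial p ε G x seed).calls ≤ 2 * p.steps + 2 * p.tests := by
  obtain ⟨g, ξ, u, ξ'⟩ := seed
  have h := neonWeak_calls_le p G x g ξ u
  simp only [neonTrial, calls_bind]
  rcases (neonWeak p G x g ξ u).val with _ | v
  · simp; omega
  · simp only [calls_bind, gradFormSum_calls]
    split_ifs <;> simp <;> omega

lemma neonTrial_val (p : NeonParams) {ε : ℝ} (hε : 0 < ε) (hρ : 0 < p.testLength)
    (G : Ξ → Vec d → Vec d) (x : Vec d) (seed : TrialSeed d Ξ) :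
    (neonTrial p ε G x seed).val =
      toOption (trialOutcome (shiftedOracle G x) p.testLength ε p.tests
        (fun g ξ u => stoppedCandidate p.exitRadius
          (iter (shiftedOracle G x) p.stepSize ξ (p.perturbation • normalize g)) p.steps u)
        seed) := by
  obtain ⟨g, ξ, u, ξ'⟩ := seed
  have hw := neonWeak_val p G x g ξ u
  have hunit := stoppedCandidate_unit p.exitRadius
    (iter (shiftedOracle G x) p.stepSize ξ (p.perturbation • normalize g)) p.steps u
  simp only [neonTrial, val_bind, trialOutcome]
  generalize stoppedCandidate p.exitRadius
    (iter (shiftedOracle G x) p.stepSize ξ (p.perturbation • normalize g)) p.steps u = v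
    at hw hunit ⊢
  have h0 : toOption (tested (shiftedOracle G x) p.testLength ε p.tests ξ' (0 : Vec d)) = none := by
    simp [tested, Accepts, toOption]
  rcases hw with hw | ⟨hw, rfl⟩
  · rw [hw]
    simp only [val_bind, gradFormSum_val]
    by_cases hv : v = 0
    -- the statistic of the zero vector is `0 / 0 = 0` and fails the test
    · subst hv
      rw [h0, if_neg (by simp; linarith)]
      rfl
    · have hv1 := hunit.resolve_left hv
      have e : (∑ i ∈ Finset.range p.tests, inner ℝ (p.testLength • v)
          (shiftedOracle G x (ξ' i) (p.testLength • v))) / (p.tests * ‖p.testLength • v‖ ^ 2) =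
          (∑ i ∈ Finset.range p.tests, testStat (shiftedOracle G x) p.testLength (ξ' i) v) /
            p.tests := by
        unfold testStat
        rw [norm_smul, hv1, mul_one, Real.norm_of_nonneg hρ.le, ← Finset.sum_div, div_div,
          mul_comm (p.tests : ℝ)]
      rw [e]
      simp only [tested, Accepts, ne_eq, hv, not_false_eq_true, true_and]
      split_ifs <;> simp [toOption, hv]
  · rw [hw, h0]
    rfl

end NeonProgram

/-! ### Guarantees of the whole search -/

section Guarantee

variable {d : ℕ} {Ξ : Type*}

lemma normalize_eq_zero_or_norm_eq_one (w : Vec d) : normalize w = 0 ∨ ‖normalize w‖ = 1 := by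
  by_cases h : w = 0
  · left; rw [h, normalize_zero]
  · exact Or.inr (norm_normalize h)

lemma trialOutcome_unit {Γ : Ξ → Vec d → Vec d} {ρ ε : ℝ} {m : ℕ}
    {cand : Vec d → (ℕ → Ξ) → unitInterval → Vec d}
    (hunit : ∀ g ξ u, cand g ξ u = 0 ∨ ‖cand g ξ u‖ = 1) (s : TrialSeed d Ξ) :
    trialOutcome Γ ρ ε m cand s = 0 ∨ ‖trialOutcome Γ ρ ε m cand s‖ = 1 := by
  unfold trialOutcome tested
  split_ifs
  · exact hunit _ _ _
  · exact Or.inl rfl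

variable [MeasurableSpace Ξ] {D : Measure Ξ} [IsProbabilityMeasure D]

/-- The guarantees of the descent step follow once the candidates of a trial are good with constant
probability. -/
lemma ncd3_guarantee {A : Ξ → Vec d →L[ℝ] Vec d} {Γ : Ξ → Vec d → Vec d} {f : Vec d → ℝ}
    {x : Vec d} {L₁ L₃ κ r ρ ε δ M : ℝ} {m J : ℕ}
    (hA : RandomOperator D A (hessian f x) L₁) (hΓ : IsNearLinear A Γ L₁ κ r)
    (hL₁ : 0 < L₁) (hL₃ : 0 < L₃) (hf : HasLipschitzThirdDeriv L₃ f) (hε : 0 < ε) (hδ : 0 < δ)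
    (hρ : 0 < ρ) (hρr : ρ ≤ r) (hκ : κ ≤ ε / 20) (hm : 0 < m) (hM0 : 500 ≤ M)
    (hM : M ≤ m * ε ^ 2 / (2 * L₁ ^ 2)) (hJ : (1 / 2 : ℝ) ^ J ≤ δ / 2)
    (hJM : J * Real.exp (-(M / 25)) ≤ δ / 24)
    {cand : Vec d → (ℕ → Ξ) → unitInterval → Vec d}
    (hc : Measurable fun q : Vec d × (ℕ → Ξ) × unitInterval => cand q.1 q.2.1 q.2.2)
    (hunit : ∀ g ξ u, cand g ξ u = 0 ∨ ‖cand g ξ u‖ = 1)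
    {B : Set (Vec d × (ℕ → Ξ))}
    (hB : ((stdGaussian (Vec d)).prod (Measure.infinitePi fun _ : ℕ => D)) B ≤
      ENNReal.ofReal (27 / 200))
    (hgood : ∀ p ∉ B, (volume : Measure unitInterval)
      {u | ¬ (‖cand p.1 p.2 u‖ = 1 ∧
        inner ℝ (cand p.1 p.2 u) (hessian f x (cand p.1 p.2 u)) ≤ -(9 / 10) * ε)} ≤
        ENNReal.ofReal (1 / 5))
    {trial : TrialSeed d Ξ → Counted (Option (Vec d))}
    (htrial : ∀ s, (trial s).val = toOption (trialOutcome Γ ρ ε m cand s)) :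
    seedLaw d D {ω | ¬ SignDecrease f x
        (ncd3 L₃ ε x (firstSuccess (fun j => trial (ω j)) J)) (3 * ε ^ 2 / (8 * L₃))} ≤
      ENNReal.ofReal δ ∧
    (δ ≤ 1 / 3 →
      Integrable (fun q : (ℕ → TrialSeed d Ξ) × ℝ =>
        f ((ncd3 L₃ ε x (firstSuccess (fun j => trial (q.1 j)) J) q.2).val.getD x) - f x)
        ((seedLaw d D).prod rademacher) ∧
      ∫ q : (ℕ → TrialSeed d Ξ) × ℝ,
        (f ((ncd3 L₃ ε x (firstSuccess (fun j => trial (q.1 j)) J) q.2).val.getD x) - f x)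
        ∂((seedLaw d D).prod rademacher) ≤ -(ε ^ 2 / (8 * L₃))) := by
  set T := trialOutcome Γ ρ ε m cand with hT
  have hTm : Measurable T := measurable_trialOutcome hΓ.meas hc
  have hV : Measurable fun ω : ℕ → TrialSeed d Ξ => firstNonzero T ω J :=
    measurable_firstNonzero hTm J
  have hVu : ∀ ω, firstNonzero T ω J = 0 ∨ ‖firstNonzero T ω J‖ = 1 := fun ω =>
    firstNonzero_unit (trialOutcome_unit hunit) ω J
  have hrun : ∀ (ω : ℕ → TrialSeed d Ξ) (ζ : ℝ),
      (ncd3 L₃ ε x (firstSuccess (fun j => trial (ω j)) J) ζ).val =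
        (toOption (firstNonzero T ω J)).map
          fun v => x + (ζ * Real.sqrt (3 * ε / L₃)) • v := fun ω ζ => by
    rw [ncd3_val, firstSuccess_val (T := T) fun j => htrial (ω j)]
  have h0 : seedLaw d D {ω | firstNonzero T ω J = 0} ≤ ENNReal.ofReal (δ / 2) := by
    have h := trialLaw_outcome_eq_zero_le hA hΓ hL₁ hε hρ hρr hκ hm (hM0.trans hM) hc hB hgood
    unfold seedLaw
    rw [measure_firstNonzero_eq_zero hTm]
    calc _ ≤ ENNReal.ofReal (1 / 2) ^ J := pow_le_pow_left' h J
      _ = ENNReal.ofReal ((1 / 2) ^ J) := (ENNReal.ofReal_pow (by norm_num) J).symm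
      _ ≤ _ := ENNReal.ofReal_le_ofReal hJ
  have hb : ∫⁻ ω, badness (hessian f x) ε (firstNonzero T ω J) ∂(seedLaw d D) ≤
      ENNReal.ofReal (δ / 24) := by
    have h := lintegral_badness_trialOutcome_le hA hΓ hL₁ hε hρ hρr hκ hm hM0 hM hc hunit
    unfold seedLaw
    refine (lintegral_badness_firstNonzero_le _ ε hTm J).trans ?_
    calc _ ≤ (J : ℝ≥0∞) * ENNReal.ofReal (Real.exp (-(M / 25))) := by gcongr
      _ = ENNReal.ofReal (J * Real.exp (-(M / 25))) := by
        rw [ENNReal.ofReal_mul (Nat.cast_nonneg J), ENNReal.ofReal_natCast]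
      _ ≤ _ := ENNReal.ofReal_le_ofReal hJM
  exact ⟨measure_not_signDecrease_le hL₃ hε hδ hf hV hVu hrun h0 hb,
    fun hδ3 => expected_decrease hL₃ hε hδ3 hf hV hVu hrun h0 hb⟩

end Guarantee

/-! ### The choice of the parameters -/

section Parameters

/-- The logarithmic factor `1 + log (d/δ)`, called `ell` below. -/
def logFactor (d : ℕ) (δ : ℝ) : ℝ := 1 + Real.log (d / δ)

/-- The step size of both iterations. It is small enough that over `1010 ell / (α ε)` steps the
second-order terms `α² L²` and the martingale noise add up to little compared with the growth. -/
def stepSize (L ε ell : ℝ) : ℝ := ε / (400000 * L ^ 2 * ell)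

/-- The number of steps of both iterations: in that time the slowest admissible growth, at rate
`ε`, overcomes the factor `√d` that is lost at the start. -/
def stepBound (L ε ell : ℝ) : ℕ := ⌈1010 * ell / (stepSize L ε ell * ε)⌉₊

/-- The number of samples for one test. By Hoeffding's inequality the failure probability of a test
is exponentially small in `ell`. -/
def testCount (L ε ell : ℝ) : ℕ := ⌈1000 * ell * (L ^ 2 / ε ^ 2)⌉₊

/-- The number of trials, each of which succeeds with probability at least one half. -/
def trialCount (ell : ℝ) : ℕ := ⌈2 * ell⌉₊

/-- The relative deviation of the gradient oracle from a linear one that Neon2 tolerates: the errors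
accumulated over all steps must stay below the exit radius. -/
def tolerance (L ε ell : ℝ) : ℝ :=
  ε / (1000 * (1 + stepSize L ε ell * stepBound L ε ell) *
    (1 + stepSize L ε ell * L) ^ stepBound L ε ell)

variable {d : ℕ} {L ε δ ell : ℝ}

lemma log_nat_le_log_div (hd : 1 ≤ d) (hδ : 0 < δ) (hδ1 : δ < 1) :
    Real.log d ≤ Real.log (d / δ) := by
  have hd' : (0 : ℝ) < d := by exact_mod_cast hd
  refine Real.log_le_log hd' ?_
  rw [le_div_iff₀ hδ]
  nlinarith

lemma one_le_logFactor (hd : 1 ≤ d) (hδ : 0 < δ) (hδ1 : δ < 1) : 1 ≤ logFactor d δ := by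
  have h := log_nat_le_log_div hd hδ hδ1
  have h2 := Real.log_natCast_nonneg d
  unfold logFactor
  linarith

/-- The tail bounds are compared with `δ` in this form. -/
lemma exp_one_sub_logFactor_le (hd : 1 ≤ d) (hδ : 0 < δ) :
    Real.exp (1 - logFactor d δ) ≤ δ := by
  have hd' : (1 : ℝ) ≤ d := by exact_mod_cast hd
  have e : 1 - logFactor d δ = -Real.log (d / δ) := by unfold logFactor; ring
  rw [e, Real.exp_neg, Real.exp_log (by positivity), inv_div]
  exact div_le_self hδ.le hd'

lemma log_mul_sqrt_le (hd : 1 ≤ d) (hδ : 0 < δ) (hδ1 : δ < 1) {c a : ℝ} (hc : 0 < c)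
    (hca : c ≤ Real.exp a) (ha : 0 ≤ a) :
    Real.log (c * Real.sqrt d) ≤ (a + 1) * logFactor d δ := by
  have hd' : (0 : ℝ) < d := by exact_mod_cast hd
  have h1 := log_nat_le_log_div hd hδ hδ1
  have h2 := one_le_logFactor hd hδ hδ1
  have h3 : Real.log c ≤ a := (Real.log_le_iff_le_exp hc).2 hca
  have h4 := Real.log_natCast_nonneg d
  rw [Real.log_mul hc.ne' (Real.sqrt_pos.2 hd').ne', Real.log_sqrt hd'.le]
  have h5 : Real.log (d / δ) = logFactor d δ - 1 := by unfold logFactor; ring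
  have h6 : a * 1 ≤ a * logFactor d δ := mul_le_mul_of_nonneg_left h2 ha
  linarith

lemma pow_le_exp_natCast (n : ℕ) : (27 / 10 : ℝ) ^ n ≤ Real.exp n := by
  have h := Real.exp_one_gt_d9
  have e : Real.exp n = Real.exp 1 ^ n := by rw [← Real.exp_nat_mul, mul_one]
  rw [e]
  exact pow_le_pow_left₀ (by norm_num) (by linarith) n

lemma log_two_hundred_mul_sqrt_le (hd : 1 ≤ d) (hδ : 0 < δ) (hδ1 : δ < 1) :
    Real.log (200 * Real.sqrt d) ≤ 7 * logFactor d δ := by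
  have h := log_mul_sqrt_le hd hδ hδ1 (c := 200) (a := (6 : ℕ)) (by norm_num)
    (le_trans (by norm_num) (pow_le_exp_natCast 6)) (by norm_num)
  norm_num at h
  exact h

lemma log_four_hundred_mul_sqrt_le (hd : 1 ≤ d) (hδ : 0 < δ) (hδ1 : δ < 1) :
    Real.log (400 * Real.sqrt d) ≤ 8 * logFactor d δ := by
  have h := log_mul_sqrt_le hd hδ hδ1 (c := 400) (a := (7 : ℕ)) (by norm_num)
    (le_trans (by norm_num) (pow_le_exp_natCast 7)) (by norm_num)
  norm_num at h
  exact h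

lemma half_pow_trialCount_le (hd : 1 ≤ d) (hδ : 0 < δ) (hδ1 : δ < 1) :
    (1 / 2 : ℝ) ^ trialCount (logFactor d δ) ≤ δ / 2 := by
  have h1 := one_le_logFactor hd hδ hδ1
  have h2 := exp_one_sub_logFactor_le hd hδ
  have hl1 := Real.log_two_gt_d9
  have hl2 := Real.log_two_lt_d9
  have hJ : 2 * logFactor d δ ≤ trialCount (logFactor d δ) := Nat.le_ceil _
  have e : (1 / 2 : ℝ) ^ trialCount (logFactor d δ) =
      Real.exp (-(trialCount (logFactor d δ) * Real.log 2)) := by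
    rw [Real.exp_neg, Real.exp_nat_mul, Real.exp_log (by norm_num), one_div, inv_pow]
  have e2 : Real.exp (1 - logFactor d δ) / 2 = Real.exp (1 - logFactor d δ - Real.log 2) := by
    rw [Real.exp_sub _ (Real.log 2), Real.exp_log (by norm_num)]
  calc _ = _ := e
    _ ≤ Real.exp (1 - logFactor d δ - Real.log 2) := by
      refine Real.exp_le_exp.2 ?_
      have : 2 * logFactor d δ * Real.log 2 ≤ trialCount (logFactor d δ) * Real.log 2 :=
        mul_le_mul_of_nonneg_right hJ (by linarith)
      nlinarith
    _ ≤ _ := by rw [← e2]; linarith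

lemma trialCount_le (hell : 1 ≤ ell) : (trialCount ell : ℝ) ≤ 3 * ell := by
  have := (Nat.ceil_lt_add_one (show 0 ≤ 2 * ell by linarith)).le
  unfold trialCount
  linarith

lemma trialCount_mul_exp_le (hd : 1 ≤ d) (hδ : 0 < δ) (hδ1 : δ < 1) :
    trialCount (logFactor d δ) * Real.exp (-(500 * logFactor d δ / 25)) ≤ δ / 24 := by
  have h1 := one_le_logFactor hd hδ hδ1
  have h2 := exp_one_sub_logFactor_le hd hδ
  have hJ := trialCount_le h1
  set y := logFactor d δ
  have h3 : y ≤ Real.exp y := by linarith [Real.add_one_le_exp y]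
  have h4 : (72 : ℝ) ≤ Real.exp (5 : ℕ) := le_trans (by norm_num) (pow_le_exp_natCast 5)
  have h5 : Real.exp (5 : ℕ) * (Real.exp y * Real.exp (-(500 * y / 25))) ≤ Real.exp (1 - y) := by
    rw [← Real.exp_add, ← Real.exp_add]
    refine Real.exp_le_exp.2 ?_
    push_cast
    linarith
  have h6 : 0 < Real.exp (-(500 * y / 25)) := Real.exp_pos _
  have h7 : 0 < Real.exp y * Real.exp (-(500 * y / 25)) := by positivity
  calc _ ≤ 3 * Real.exp y * Real.exp (-(500 * y / 25)) := by gcongr; linarith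
    _ ≤ _ := by
      have h8 := mul_le_mul_of_nonneg_right h4 h7.le
      linarith

lemma stepSize_pos (hL : 0 < L) (hε : 0 < ε) (hell : 1 ≤ ell) : 0 < stepSize L ε ell := by
  unfold stepSize; positivity

lemma stepSize_mul_sq (hL : 0 < L) (hell : 1 ≤ ell) :
    stepSize L ε ell * L ^ 2 * ell = ε / 400000 := by
  unfold stepSize; field_simp

lemma stepSize_mul_le (hL : 0 < L) (hεL : ε < L) (hell : 1 ≤ ell) :
    stepSize L ε ell * L ≤ 1 / 1000 := by
  unfold stepSize
  rw [div_mul_eq_mul_div, div_le_div_iff₀ (by positivity) (by norm_num)]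
  have h1 : ε * L ≤ L ^ 2 := by nlinarith
  have h2 : L ^ 2 * 1 ≤ L ^ 2 * ell := mul_le_mul_of_nonneg_left hell (by positivity)
  nlinarith

lemma le_stepSize_mul_stepBound (hL : 0 < L) (hε : 0 < ε) (hell : 1 ≤ ell) :
    1010 * ell ≤ stepSize L ε ell * ε * stepBound L ε ell := by
  have hα := stepSize_pos hL hε hell
  have h := Nat.le_ceil (1010 * ell / (stepSize L ε ell * ε))
  rw [div_le_iff₀ (by positivity)] at h
  unfold stepBound
  linarith

lemma stepBound_le_add_one (hL : 0 < L) (hε : 0 < ε) (hell : 1 ≤ ell) :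
    (stepBound L ε ell : ℝ) ≤ 1010 * ell / (stepSize L ε ell * ε) + 1 := by
  have hα := stepSize_pos hL hε hell
  exact (Nat.ceil_lt_add_one (by positivity)).le

lemma stepSize_mul_stepBound_le (hL : 0 < L) (hε : 0 < ε) (hεL : ε < L) (hell : 1 ≤ ell) :
    stepSize L ε ell * ε * stepBound L ε ell ≤ 1010 * ell + 1 := by
  have hα := stepSize_pos hL hε hell
  have h1 : stepSize L ε ell * ε ≤ 1 :=
    (mul_le_mul_of_nonneg_left hεL.le hα.le).trans
      ((stepSize_mul_le hL hεL hell).trans (by norm_num))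
  calc _ ≤ stepSize L ε ell * ε * (1010 * ell / (stepSize L ε ell * ε) + 1) :=
        mul_le_mul_of_nonneg_left (stepBound_le_add_one hL hε hell) (by positivity)
    _ = 1010 * ell + stepSize L ε ell * ε := by field_simp
    _ ≤ _ := by linarith

lemma le_testCount (hL : 0 < L) (hε : 0 < ε) :
    500 * ell ≤ testCount L ε ell * ε ^ 2 / (2 * L ^ 2) := by
  have h : 1000 * ell * (L ^ 2 / ε ^ 2) ≤ testCount L ε ell := Nat.le_ceil _
  rw [le_div_iff₀ (by positivity)]
  calc 500 * ell * (2 * L ^ 2) = 1000 * ell * (L ^ 2 / ε ^ 2) * ε ^ 2 := by field_simp; ring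
    _ ≤ _ := by gcongr

lemma testCount_pos (hL : 0 < L) (hε : 0 < ε) (hell : 1 ≤ ell) : 0 < testCount L ε ell :=
  Nat.ceil_pos.2 (by positivity)

/-- The bound for the total number of oracle calls: `O(ell)` trials with `O(ell² L²/ε²)` calls each.
For `ε < L` the roundings to integers are absorbed by the constant. -/
lemma total_calls_le (hL : 0 < L) (hε : 0 < ε) (hεL : ε < L) (hell : 1 ≤ ell) :
    ((trialCount ell * (2 * stepBound L ε ell + 2 * testCount L ε ell) : ℕ) : ℝ) ≤
      10 ^ 10 * (L ^ 2 / ε ^ 2) * ell ^ 3 := by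
  set X := L ^ 2 / ε ^ 2 with hX
  have hX1 : 1 ≤ X := by
    rw [hX, le_div_iff₀ (by positivity), one_mul]
    exact pow_le_pow_left₀ hε.le hεL.le 2
  have h2 : 1 ≤ ell ^ 2 := one_le_pow₀ hell
  have h3 : ell ≤ ell ^ 2 := by nlinarith
  have hT : (stepBound L ε ell : ℝ) ≤ 405000000 * (X * ell ^ 2) := by
    refine (stepBound_le_add_one hL hε hell).trans ?_
    have e : 1010 * ell / (stepSize L ε ell * ε) = 404000000 * (X * ell ^ 2) := by
      rw [hX]; unfold stepSize; field_simp; ring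
    rw [e]
    nlinarith
  have hm : (testCount L ε ell : ℝ) ≤ 1001 * (X * ell ^ 2) := by
    have h := (Nat.ceil_lt_add_one (show 0 ≤ 1000 * ell * X by positivity)).le
    refine h.trans ?_
    nlinarith
  have hJ := trialCount_le hell
  push_cast
  calc _ ≤ 3 * ell * (2 * (405000000 * (X * ell ^ 2)) + 2 * (1001 * (X * ell ^ 2))) := by gcongr
    _ ≤ _ := by
      have : 0 ≤ X * ell ^ 3 := by positivity
      nlinarith

lemma tolerance_pos (hL : 0 < L) (hε : 0 < ε) (hell : 1 ≤ ell) : 0 < tolerance L ε ell := by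
  have := stepSize_pos hL hε hell
  unfold tolerance
  positivity

lemma tolerance_le (hL : 0 < L) (hε : 0 < ε) (hell : 1 ≤ ell) : tolerance L ε ell ≤ ε / 1000 := by
  have hα := stepSize_pos hL hε hell
  unfold tolerance
  refine div_le_div_of_nonneg_left hε.le (by norm_num) ?_
  have h1 : 1 ≤ 1 + stepSize L ε ell * stepBound L ε ell := by
    have : 0 ≤ stepSize L ε ell * stepBound L ε ell := by positivity
    linarith
  have h2 : 1 ≤ (1 + stepSize L ε ell * L) ^ stepBound L ε ell :=
    one_le_pow₀ (by nlinarith [mul_pos hα hL])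
  nlinarith

lemma tolerance_mul_lt (hL : 0 < L) (hε : 0 < ε) (hε1 : ε < 1) (hell : 1 ≤ ell) :
    tolerance L ε ell * (stepSize L ε ell * stepBound L ε ell *
      (1 + stepSize L ε ell * L) ^ stepBound L ε ell) < 1 := by
  have hα := stepSize_pos hL hε hell
  have h1 : 0 ≤ stepSize L ε ell * stepBound L ε ell := by positivity
  have h2 : 0 < (1 + stepSize L ε ell * L) ^ stepBound L ε ell := by positivity
  unfold tolerance
  rw [div_mul_eq_mul_div, div_lt_one (by positivity), ← mul_assoc]
  refine mul_lt_mul_of_pos_right ?_ h2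
  nlinarith

/-- The bound on `δ` in the expected decrease is used only through `δ ≤ 1/3`. -/
lemma le_third_of_le {L₂ : ℝ} (hε : 0 < ε) (hL₂ : 0 ≤ L₂) (h : δ ≤ ε / (3 * ε + 8 * L₂)) :
    δ ≤ 1 / 3 := by
  refine h.trans ?_
  rw [div_le_div_iff₀ (by positivity) (by norm_num)]
  linarith

end Parameters

/-! ### The two methods -/

section Methods

/-- The parameters of online Oja's algorithm. -/
def ojaParams (d : ℕ) (L ε δ : ℝ) : OjaParams where
  stepSize := stepSize L ε (logFactor d δ)
  steps := stepBound L ε (logFactor d δ)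
  trials := trialCount (logFactor d δ)
  tests := testCount L ε (logFactor d δ)

/-- The radius of the ball on which the gradient oracle is linear up to the tolerance. -/
def neonRadius (d : ℕ) (L L₂ ε δ : ℝ) : ℝ := tolerance L ε (logFactor d δ) / (L₂ + 1)

/-- The parameters of Neon2. The perturbation is smaller than the exit radius by a factor that is
polynomial in `δ / d`, so that an iteration that exits has spent most of its time in the direction
of negative curvature. -/
def neonParams (d : ℕ) (L L₂ ε δ : ℝ) : NeonParams where
  stepSize := stepSize L ε (logFactor d δ)
  steps := stepBound L ε (logFactor d δ)
  perturbation := neonRadius d L L₂ ε δ * Real.exp (-(1000 * logFactor d δ))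
  exitRadius := neonRadius d L L₂ ε δ
  trials := trialCount (logFactor d δ)
  tests := testCount L ε (logFactor d δ)
  testLength := neonRadius d L L₂ ε δ

variable {d : ℕ} {Ξ : Type*} [MeasurableSpace Ξ] {D : Measure Ξ} [IsProbabilityMeasure D]
  {F : Vec d → Ξ → ℝ} {f : Vec d → ℝ} {x : Vec d} {L₁ L₂ L₃ ε δ : ℝ}

/-- A bottom eigenvector of the Hessian, whose curvature is between `ε` and the smoothness
constant. -/
lemma RandomOperator.exists_bottom_eigenvector {A : Ξ → Vec d →L[ℝ] Vec d} {H : Vec d →L[ℝ] Vec d}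
    {L : ℝ} (hA : RandomOperator D A H L) (hH : ∀ v w, inner ℝ (H v) w = inner ℝ v (H w))
    (hε : 0 < ε) (h : lambdaMin H < -ε) :
    ∃ l u, ε < l ∧ l ≤ L ∧ ‖u‖ = 1 ∧ H u = (-l) • u ∧ ∀ v, -l * ‖v‖ ^ 2 ≤ inner ℝ v (H v) := by
  obtain ⟨l, u, hl, hu1, hu, hb⟩ := NCD3.exists_bottom_eigenvector hε hH h
  refine ⟨l, u, hl, ?_, hu1, hu, hb⟩
  have h1 := hA.abs_mean_le u u
  rw [hu, real_inner_smul_left, real_inner_self_eq_norm_sq, hu1] at h1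
  have h2 := neg_le_abs (-l * (1 : ℝ) ^ 2)
  linarith

lemma ncd3Oja_spec (hd : 1 ≤ d) (hL₁ : 0 < L₁) (hL₂ : 0 ≤ L₂) (hε : 0 < ε) (hδ : 0 < δ)
    (hδ1 : δ < 1) (hL₃ : 0 < L₃) (h : IsStochasticObjective D F f L₁ L₂ L₃)
    (hx : lambdaMin (hessian f x) < -ε) :
    seedLaw d D {ω | ¬ SignDecrease f x (ncd3Oja (ojaParams d L₁ ε δ) L₃ ε F x ω)
        (3 * ε ^ 2 / (8 * L₃))} ≤ ENNReal.ofReal δ ∧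
      (δ ≤ ε / (3 * ε + 8 * L₂) →
        Integrable (fun q : (ℕ → TrialSeed d Ξ) × ℝ =>
          f ((ncd3Oja (ojaParams d L₁ ε δ) L₃ ε F x q.1 q.2).val.getD x) - f x)
          ((seedLaw d D).prod rademacher) ∧
        ∫ q : (ℕ → TrialSeed d Ξ) × ℝ,
          (f ((ncd3Oja (ojaParams d L₁ ε δ) L₃ ε F x q.1 q.2).val.getD x) - f x)
          ∂((seedLaw d D).prod rademacher) ≤ -(ε ^ 2 / (8 * L₃))) ∧
      ∀ ω ζ, ((ncd3Oja (ojaParams d L₁ ε δ) L₃ ε F x ω ζ).calls : ℝ) ≤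
        10 ^ 10 * (L₁ ^ 2 / ε ^ 2) * (1 + Real.log (d / δ)) ^ 3 := by
  have hell := one_le_logFactor hd hδ hδ1
  have hA := h.randomOperator hL₁ hL₂ x
  have hHs := inner_hessian_comm (h.thirdDerivLipschitz.1.differentiable (by norm_num))
    (differentiable_gradient (h.thirdDerivLipschitz.1.of_le (by norm_num))) x
  obtain ⟨l, u, hεl, hlL, hu1, hu, hH⟩ := hA.exists_bottom_eigenvector hHs hε hx
  have hεL : ε < L₁ := hεl.trans_le hlL
  obtain ⟨B, hB, hgood⟩ := exists_bad_set_linear hd hA hε hεL hεl hlL hHs hu hu1 hH hell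
    (log_two_hundred_mul_sqrt_le hd hδ hδ1) (stepSize_pos hL₁ hε hell) (stepSize_mul_sq hL₁ hell)
    (stepSize_mul_le hL₁ hεL hell) (le_stepSize_mul_stepBound hL₁ hε hell)
    (stepSize_mul_stepBound_le hL₁ hε hεL hell)
  have hg := ncd3_guarantee hA (hA.nearLinear (κ := 0) (r := 1) le_rfl) hL₁ hL₃
    h.thirdDerivLipschitz hε hδ one_pos le_rfl (by positivity) (testCount_pos hL₁ hε hell)
    (M := 500 * logFactor d δ) (by linarith) (le_testCount hL₁ hε)
    (half_pow_trialCount_le hd hδ hδ1) (trialCount_mul_exp_le hd hδ hδ1)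
    (measurable_linearCandidate hA.measurable_uncurry _ _)
    (fun g ξ u => normalize_eq_zero_or_norm_eq_one _) hB hgood
    (ojaTrial_val (ojaParams d L₁ ε δ) hε _)
  refine ⟨hg.1, fun hδ3 => hg.2 (le_third_of_le hε hL₂ hδ3), fun ω ζ => ?_⟩
  refine le_trans (Nat.cast_le.2 ?_) (total_calls_le hL₁ hε hεL hell)
  unfold ncd3Oja approxNCOja
  rw [ncd3_calls]
  refine (firstSuccess_calls_le (fun j => ojaTrial_calls_le _ _ _ _) _).trans
    (Nat.mul_le_mul_left _ ?_)
  change stepBound L₁ ε (logFactor d δ) + testCount L₁ ε (logFactor d δ) ≤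
    2 * stepBound L₁ ε (logFactor d δ) + 2 * testCount L₁ ε (logFactor d δ)
  omega

lemma ncd3Neon_spec (hd : 1 ≤ d) (hL₁ : 0 < L₁) (hL₂ : 0 ≤ L₂) (hε : 0 < ε) (hε1 : ε < 1)
    (hδ : 0 < δ) (hδ1 : δ < 1) (hL₃ : 0 < L₃) (h : IsStochasticObjective D F f L₁ L₂ L₃)
    (hx : lambdaMin (hessian f x) < -ε) :
    seedLaw d D {ω | ¬ SignDecrease f x (ncd3Neon (neonParams d L₁ L₂ ε δ) L₃ ε F x ω)
        (3 * ε ^ 2 / (8 * L₃))} ≤ ENNReal.ofReal δ ∧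
      (δ ≤ ε / (3 * ε + 8 * L₂) →
        Integrable (fun q : (ℕ → TrialSeed d Ξ) × ℝ =>
          f ((ncd3Neon (neonParams d L₁ L₂ ε δ) L₃ ε F x q.1 q.2).val.getD x) - f x)
          ((seedLaw d D).prod rademacher) ∧
        ∫ q : (ℕ → TrialSeed d Ξ) × ℝ,
          (f ((ncd3Neon (neonParams d L₁ L₂ ε δ) L₃ ε F x q.1 q.2).val.getD x) - f x)
          ∂((seedLaw d D).prod rademacher) ≤ -(ε ^ 2 / (8 * L₃))) ∧
      ∀ ω ζ, ((ncd3Neon (neonParams d L₁ L₂ ε δ) L₃ ε F x ω ζ).calls : ℝ) ≤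
        10 ^ 10 * (L₁ ^ 2 / ε ^ 2) * (1 + Real.log (d / δ)) ^ 3 := by
  have hell := one_le_logFactor hd hδ hδ1
  have hA := h.randomOperator hL₁ hL₂ x
  have hHs := inner_hessian_comm (h.thirdDerivLipschitz.1.differentiable (by norm_num))
    (differentiable_gradient (h.thirdDerivLipschitz.1.of_le (by norm_num))) x
  obtain ⟨l, u, hεl, hlL, hu1, hu, hH⟩ := hA.exists_bottom_eigenvector hHs hε hx
  have hεL : ε < L₁ := hεl.trans_le hlL
  set κ := tolerance L₁ ε (logFactor d δ) with hκ
  have hκ0 : 0 < κ := tolerance_pos hL₁ hε hell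
  have hκε : κ ≤ ε / 1000 := tolerance_le hL₁ hε hell
  set r := neonRadius d L₁ L₂ ε δ with hr
  have hr0 : 0 < r := div_pos hκ0 (by linarith)
  have hrκ : L₂ * r ≤ κ := by
    have e : (L₂ + 1) * r = κ := by
      rw [hr, neonRadius, mul_div_cancel₀ _ (by linarith : L₂ + 1 ≠ 0)]
    linarith
  have hΓ : IsNearLinear _ (shiftedOracle (gradOracle F) x) L₁ κ r :=
    h.nearLinear_grad hL₁ hL₂ x hrκ
  obtain ⟨B, hB, hgood⟩ := exists_bad_set_stopped (T := stepBound L₁ ε (logFactor d δ))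
    (σ := r * Real.exp (-(1000 * logFactor d δ))) hd hA hΓ hε hεL hεl hlL hHs hu hu1 hH hell
    (log_four_hundred_mul_sqrt_le hd hδ hδ1) (stepSize_pos hL₁ hε hell) (stepSize_mul_sq hL₁ hell)
    (stepSize_mul_le hL₁ hεL hell) (le_stepSize_mul_stepBound hL₁ hε hell) hκ0.le hκε
    (tolerance_mul_lt hL₁ hε hε1 hell) (by positivity)
    (by rw [mul_assoc, ← Real.exp_add, neg_add_cancel, Real.exp_zero, mul_one])
  have hcm : Measurable fun q : Vec d × (ℕ → Ξ) × unitInterval => stoppedCandidate r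
      (iter (shiftedOracle (gradOracle F) x) (stepSize L₁ ε (logFactor d δ)) q.2.1
        ((r * Real.exp (-(1000 * logFactor d δ))) • normalize q.1))
      (stepBound L₁ ε (logFactor d δ)) q.2.2 :=
    measurable_stoppedCandidate
      (fun t => (measurable_iter_normalize hΓ.meas _ _ t).comp
        (measurable_fst.prodMk (measurable_fst.comp measurable_snd)))
      (measurable_snd.comp measurable_snd) _ _
  have hg := ncd3_guarantee (cand := fun g ξ u => stoppedCandidate r
      (iter (shiftedOracle (gradOracle F) x) (stepSize L₁ ε (logFactor d δ)) ξ
        ((r * Real.exp (-(1000 * logFactor d δ))) • normalize g))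
      (stepBound L₁ ε (logFactor d δ)) u) hA hΓ hL₁ hL₃
    h.thirdDerivLipschitz hε hδ hr0 le_rfl (by linarith) (testCount_pos hL₁ hε hell)
    (M := 500 * logFactor d δ) (by linarith) (le_testCount hL₁ hε)
    (half_pow_trialCount_le hd hδ hδ1) (trialCount_mul_exp_le hd hδ hδ1)
    hcm (fun g ξ u => stoppedCandidate_unit _ _ _ _) hB hgood
    (neonTrial_val (neonParams d L₁ L₂ ε δ) hε hr0 (gradOracle F) x)
  refine ⟨hg.1, fun hδ3 => hg.2 (le_third_of_le hε hL₂ hδ3), fun ω ζ => ?_⟩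
  refine le_trans (Nat.cast_le.2 ?_) (total_calls_le hL₁ hε hεL hell)
  unfold ncd3Neon approxNCNeon
  rw [ncd3_calls]
  exact firstSuccess_calls_le (fun j => neonTrial_calls_le _ _ _ _ _) _

end Methods

end NCD3

end

theorem lemma4p6 :
    -- absolute constants of the running time bounds
    ∃ (C : ℝ) (k : ℕ),
      ∀ (d : ℕ) (L₁ L₂ εH δ : ℝ), 1 ≤ d → 0 < L₁ → 0 ≤ L₂ → 0 < εH → εH < 1 → 0 < δ → δ < 1 →
        -- online Oja's algorithm, counting stochastic Hessian-vector products
        (∃ p : NCD3.OjaParams,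
          ∀ (Ξ : Type*) [MeasurableSpace Ξ] (D : MeasureTheory.Measure Ξ)
            [MeasureTheory.IsProbabilityMeasure D]
            (F : NCD3.Vec d → Ξ → ℝ) (f : NCD3.Vec d → ℝ) (L₃ : ℝ) (x : NCD3.Vec d),
            0 < L₃ → NCD3.IsStochasticObjective D F f L₁ L₂ L₃ →
            NCD3.lambdaMin (NCD3.hessian f x) < -εH →
            -- with probability at least `1 - δ`
            NCD3.seedLaw d D {ω | ¬ NCD3.SignDecrease f x (NCD3.ncd3Oja p L₃ εH F x ω)
                (3 * εH ^ 2 / (8 * L₃))} ≤ ENNReal.ofReal δ ∧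
            -- expectation over all randomness; the iterate stays at `x` if the output is `⊥`
            (δ ≤ εH / (3 * εH + 8 * L₂) →
              MeasureTheory.Integrable
                (fun q : (ℕ → NCD3.TrialSeed d Ξ) × ℝ =>
                  f ((NCD3.ncd3Oja p L₃ εH F x q.1 q.2).val.getD x) - f x)
                ((NCD3.seedLaw d D).prod NCD3.rademacher) ∧
              ∫ q : (ℕ → NCD3.TrialSeed d Ξ) × ℝ,
                  (f ((NCD3.ncd3Oja p L₃ εH F x q.1 q.2).val.getD x) - f x)
                  ∂((NCD3.seedLaw d D).prod NCD3.rademacher)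
                ≤ -(εH ^ 2 / (8 * L₃))) ∧
            -- running time, on every run
            (∀ ω ζ, ((NCD3.ncd3Oja p L₃ εH F x ω ζ).calls : ℝ) ≤
              C * (L₁ ^ 2 / εH ^ 2) * (1 + Real.log (d / δ)) ^ k)) ∧
        -- Neon2^online, counting stochastic gradients
        (∃ p : NCD3.NeonParams,
          ∀ (Ξ : Type*) [MeasurableSpace Ξ] (D : MeasureTheory.Measure Ξ)
            [MeasureTheory.IsProbabilityMeasure D]
            (F : NCD3.Vec d → Ξ → ℝ) (f : NCD3.Vec d → ℝ) (L₃ : ℝ) (x : NCD3.Vec d),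
            0 < L₃ → NCD3.IsStochasticObjective D F f L₁ L₂ L₃ →
            NCD3.lambdaMin (NCD3.hessian f x) < -εH →
            -- with probability at least `1 - δ`
            NCD3.seedLaw d D {ω | ¬ NCD3.SignDecrease f x (NCD3.ncd3Neon p L₃ εH F x ω)
                (3 * εH ^ 2 / (8 * L₃))} ≤ ENNReal.ofReal δ ∧
            -- expectation over all randomness; the iterate stays at `x` if the output is `⊥`
            (δ ≤ εH / (3 * εH + 8 * L₂) →
              MeasureTheory.Integrable
                (fun q : (ℕ → NCD3.TrialSeed d Ξ) × ℝ =>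
                  f ((NCD3.ncd3Neon p L₃ εH F x q.1 q.2).val.getD x) - f x)
                ((NCD3.seedLaw d D).prod NCD3.rademacher) ∧
              ∫ q : (ℕ → NCD3.TrialSeed d Ξ) × ℝ,
                  (f ((NCD3.ncd3Neon p L₃ εH F x q.1 q.2).val.getD x) - f x)
                  ∂((NCD3.seedLaw d D).prod NCD3.rademacher)
                ≤ -(εH ^ 2 / (8 * L₃))) ∧
            -- running time, on every run
            (∀ ω ζ, ((NCD3.ncd3Neon p L₃ εH F x ω ζ).calls : ℝ) ≤
              C * (L₁ ^ 2 / εH ^ 2) * (1 + Real.log (d / δ)) ^ k)) := by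
  refine ⟨10 ^ 10, 3, fun d L₁ L₂ εH δ hd hL₁ hL₂ hε hε1 hδ hδ1 => ⟨?_, ?_⟩⟩
  · exact ⟨NCD3.ojaParams d L₁ εH δ, fun Ξ _ D _ F f L₃ x hL₃ h hx =>
      NCD3.ncd3Oja_spec hd hL₁ hL₂ hε hδ hδ1 hL₃ h hx⟩
  · exact ⟨NCD3.neonParams d L₁ L₂ εH δ, fun Ξ _ D _ F f L₃ x hL₃ h hx =>
      NCD3.ncd3Neon_spec hd hL₁ hL₂ hε hε1 hδ hδ1 hL₃ h hx⟩
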